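/- Let $n\ge 1$, let $\Omega\subset\mathbb R^n$ be a bounded open set with $\mathcal C^1$ boundary, let $p\ge 1$, $\lambda\in\mathbb R$ and $H\in L^\infty(\Omega)$ (for instance $H$ Lipschitz on $\Omega$). Put $f(s)=|s|^{p-1}s$, $F(s)=\frac{1}{p+1}|s|^{p+1}$ and $G(s,t)=F(t)-F(s)-f(s)(t-s)$. For $u\in \mathrm{BV}(\Omega)$ let $$\mathscr A(u)=\int_\Omega\sqrt{1+|\nabla u|^2}:=\sup\Big\{\int_\Omega \big(g_0+u\,\mathrm{div}\,g\big)\,dx:\ g_0\in \mathcal C^1_c(\Omega),\ g\in \mathcal C^1_c(\Omega)^n,\ g_0^2+|g|^2\le 1\Big\},$$ $$\mathcal L(u)(\varphi)=\lim_{t\downarrow 0}\frac{\mathscr A(u+t\varphi)-\mathscr A(u)}{t}\quad(\varphi\in \mathrm{BV}(\Omega)),$$ and, for $u\in L^{p+1}\cap\mathrm{BV}(\Omega)$, $$\mathscr J_\lambda(u)=\mathscr A(u)-\int_\Omega \big(Hu+\lambda F(u)\big)\,dx .$$ Boundary values of $v\in\mathrm{BV}(\Omega)$ are understood in the sense of traces: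 the trace of $v$ is the ($\mathscr H^{n-1}$-a.e. unique) function $Tv\in L^1(\partial\Omega)$ such that $r^{-n}\int_{B(x,r)\cap\Omega}|v(y)-Tv(x)|\,dy\to0$ as $r\downarrow0$ for $\mathscr H^{n-1}$-a.e. $x\in\partial\Omega$; we write $v$ for $Tv$ on $\partial\Omega$. A function $u\in L^{p+1}\cap\mathrm{BV}(\Omega)$ is called a weak solution of $-\mathrm{div}\big(\nabla u/\sqrt{1+|\nabla u|^2}\big)=H+\lambda f(u)$ in $\Omega$, $u=0$ on $\partial\Omega$, if $u\ge0$ a.e. in $\Omega$, $u=0$ on $\partial\Omega$, and for every $\varphi\in L^{p+1}\cap \mathrm{BV}(\Omega)$ with $\varphi=0$ on $\partial\Omega$ the limit $\mathcal L(u)(\varphi)$ exists and $\mathcal L(u)(\varphi)\ge\int_\Omega (H+\lambda f(u))\varphi\,dx$. Then $G(s,t)\ge 0$ for all $s,t\in\mathbb R$, and for every non-negative $u\in L^{p+1}\cap\mathrm{BV}(\Omega)$ the following are equivalent: (i) $u$ is a weak solution; (ii) $u=0$ on $\partial\Omega$, and every $v\in L^{p+1}\cap\mathrm{BV}(\Omega)$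 has a trace on $\partial\Omega$ and satisfies $$\mathscr A(u)-\int_\Omega (H+\lambda f(u))\,u\,dx\le\mathscr A(v)-\int_\Omega (H+\lambda f(u))\,v\,dx+\int_{\partial\Omega}|v|\,d\mathscr H^{n-1};$$ (iii) $u=0$ on $\partial\Omega$, and every $v\in L^{p+1}\cap\mathrm{BV}(\Omega)$ has a trace on $\partial\Omega$ and satisfies $$\mathscr J_\lambda(u)\le\mathscr J_\lambda(v)+\int_\Omega\lambda\, G(u,v)\,dx+\int_{\partial\Omega}|v|\,d\mathscr H^{n-1}.$$ -/

import Mathlib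

open MeasureTheory Filter Topology
open scoped ENNReal

noncomputable section

namespace MeanCurvature

variable {n : ℕ}

/-- The divergence `∑ i, ∂ᵢ gᵢ (x)` of a vector field on `ℝⁿ`. -/
def divergence (g : EuclideanSpace ℝ (Fin n) → EuclideanSpace ℝ (Fin n))
    (x : EuclideanSpace ℝ (Fin n)) : ℝ :=
  ∑ i : Fin n, (fderiv ℝ g x (EuclideanSpace.single i 1)) i

/-- `g` is of class `C¹` with compact support contained in `Ω`. -/
def IsTest {F : Type*} [NormedAddCommGroup F] [NormedSpace ℝ F]
    (Ω : Set (EuclideanSpace ℝ (Fin n))) (g : EuclideanSpace ℝ (Fin n) → F) : Prop :=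
  ContDiff ℝ 1 g ∧ HasCompactSupport g ∧ tsupport g ⊆ Ω

/-- The numbers `∫_Ω u div g` whose supremum is the total variation `∫_Ω |Du|`. -/
def variationSet (Ω : Set (EuclideanSpace ℝ (Fin n))) (u : EuclideanSpace ℝ (Fin n) → ℝ) :
    Set ℝ :=
  {s | ∃ g : EuclideanSpace ℝ (Fin n) → EuclideanSpace ℝ (Fin n),
    IsTest Ω g ∧ (∀ x, ‖g x‖ ≤ 1) ∧ s = ∫ x in Ω, u x * divergence g x}

/-- `u ∈ BV(Ω)`: `u` is integrable on `Ω` and has finite total variation in `Ω`. -/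
def IsBV (Ω : Set (EuclideanSpace ℝ (Fin n))) (u : EuclideanSpace ℝ (Fin n) → ℝ) : Prop :=
  IntegrableOn u Ω ∧ BddAbove (variationSet Ω u)

/-- `u ∈ L^{p+1}(Ω) ∩ BV(Ω)`. -/
def IsAdmissible (Ω : Set (EuclideanSpace ℝ (Fin n))) (p : ℝ)
    (u : EuclideanSpace ℝ (Fin n) → ℝ) : Prop :=
  MemLp u (ENNReal.ofReal (p + 1)) (volume.restrict Ω) ∧ IsBV Ω u

/-- The numbers `∫_Ω g₀ + u div g` whose supremum is the area of the graph of `u`; the pair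
`(g₀, g)` takes its values in the closed Euclidean unit ball of `ℝ × ℝⁿ = ℝⁿ⁺¹`. -/
def areaSet (Ω : Set (EuclideanSpace ℝ (Fin n))) (u : EuclideanSpace ℝ (Fin n) → ℝ) : Set ℝ :=
  {s | ∃ (g₀ : EuclideanSpace ℝ (Fin n) → ℝ)
      (g : EuclideanSpace ℝ (Fin n) → EuclideanSpace ℝ (Fin n)),
    IsTest Ω g₀ ∧ IsTest Ω g ∧ (∀ x, g₀ x ^ 2 + ‖g x‖ ^ 2 ≤ 1) ∧
      s = ∫ x in Ω, (g₀ x + u x * divergence g x)}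

/-- The area functional `𝒜(u) = ∫_Ω √(1 + |∇u|²)`, for `u ∈ BV(Ω)` and `Ω` bounded. -/
def area (Ω : Set (EuclideanSpace ℝ (Fin n))) (u : EuclideanSpace ℝ (Fin n) → ℝ) : ℝ :=
  sSup (areaSet Ω u)

/-- `ℓ` is the one-sided directional derivative `lim_{t ↓ 0} (𝒜(u + t φ) - 𝒜(u)) / t`. -/
def HasAreaDeriv (Ω : Set (EuclideanSpace ℝ (Fin n))) (u φ : EuclideanSpace ℝ (Fin n) → ℝ)
    (ℓ : ℝ) : Prop :=
  Tendsto (fun t : ℝ => (area Ω (fun x => u x + t * φ x) - area Ω u) / t) (𝓝[>] 0) (𝓝 ℓ)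

/-- The surface measure `ℋⁿ⁻¹` on `∂Ω`, normalized so that it agrees with Lebesgue measure
on hyperplanes. -/
def surfaceMeasure (Ω : Set (EuclideanSpace ℝ (Fin n))) : Measure (EuclideanSpace ℝ (Fin n)) :=
  (Measure.euclideanHausdorffMeasure (n - 1)).restrict (frontier Ω)

/-- `∂Ω` is of class `C¹`: near each boundary point, `Ω` is the set of points strictly above the
graph, in the direction of a unit vector `e`, of a `C¹` function `ψ` of the variables orthogonal
to `e`. -/
def HasC1Boundary (Ω : Set (EuclideanSpace ℝ (Fin n))) : Prop :=
  ∀ x ∈ frontier Ω, ∃ (e : EuclideanSpace ℝ (Fin n)) (ψ : EuclideanSpace ℝ (Fin n) → ℝ) (r : ℝ),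
    ‖e‖ = 1 ∧ ContDiff ℝ 1 ψ ∧ (∀ (y : EuclideanSpace ℝ (Fin n)) (t : ℝ), ψ (y + t • e) = ψ y) ∧
      0 < r ∧ ∀ y ∈ Metric.ball x r, y ∈ Ω ↔ ψ y < inner ℝ y e

/-- `T ∈ L¹(∂Ω)` is the trace of `u` on `∂Ω`: for `ℋⁿ⁻¹`-almost every `x ∈ ∂Ω`,
`r⁻ⁿ ∫_{B(x,r) ∩ Ω} |u(y) - T(x)| dy → 0` as `r ↓ 0`. -/
def HasTrace (Ω : Set (EuclideanSpace ℝ (Fin n))) (u T : EuclideanSpace ℝ (Fin n) → ℝ) : Prop :=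
  Integrable T (surfaceMeasure Ω) ∧
    ∀ᵐ x ∂(surfaceMeasure Ω),
      Tendsto (fun r : ℝ => (∫ y in Metric.ball x r ∩ Ω, |u y - T x|) / r ^ n) (𝓝[>] 0) (𝓝 0)

/-- `u = 0` on `∂Ω`, in the sense of traces. -/
def VanishesOnBoundary (Ω : Set (EuclideanSpace ℝ (Fin n)))
    (u : EuclideanSpace ℝ (Fin n) → ℝ) : Prop :=
  HasTrace Ω u (fun _ => 0)

/-- The nonlinearity `f(s) = |s|^{p-1} s`. -/
def f (p s : ℝ) : ℝ := |s| ^ (p - 1) * s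

/-- The primitive `F(s) = |s|^{p+1} / (p+1)` of `f`. -/
def F (p s : ℝ) : ℝ := |s| ^ (p + 1) / (p + 1)

/-- `G(s,t) = F(t) - F(s) - f(s)(t - s)`. -/
def G (p s t : ℝ) : ℝ := F p t - F p s - f p s * (t - s)

/-- `𝒥_λ(u) = 𝒜(u) - ∫_Ω (H u + λ F(u))`. -/
def energy (Ω : Set (EuclideanSpace ℝ (Fin n))) (H : EuclideanSpace ℝ (Fin n) → ℝ) (p lam : ℝ)
    (u : EuclideanSpace ℝ (Fin n) → ℝ) : ℝ :=
  area Ω u - ∫ x in Ω, (H x * u x + lam * F p (u x))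

/-- `u` is a weak solution of `-div (∇u / √(1 + |∇u|²)) = H + λ f(u)` in `Ω`, `u = 0` on `∂Ω`. -/
def IsWeakSolution (Ω : Set (EuclideanSpace ℝ (Fin n))) (H : EuclideanSpace ℝ (Fin n) → ℝ)
    (p lam : ℝ) (u : EuclideanSpace ℝ (Fin n) → ℝ) : Prop :=
  IsAdmissible Ω p u ∧
    (∀ φ : EuclideanSpace ℝ (Fin n) → ℝ, IsAdmissible Ω p φ → VanishesOnBoundary Ω φ →
      ∃ ℓ : ℝ, HasAreaDeriv Ω u φ ℓ ∧ ∫ x in Ω, (H x + lam * f p (u x)) * φ x ≤ ℓ) ∧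
    (∀ᵐ x ∂(volume.restrict Ω), 0 ≤ u x) ∧
    VanishesOnBoundary Ω u

end MeanCurvature

end

/-!
Put `K = H + λ f(u)`. By Young's inequality `G ≥ 0`, and the definition of `G` gives
`𝒥_λ(v) + ∫ λ G(u, v) = 𝒜(v) - ∫ K v + C` with a constant `C` that does not depend on `v`; for
`v = u` the left-hand side is `𝒥_λ(u)`. So (iii) is (ii) with `C` added on both sides.

Since `𝒜` is convex, its one-sided directional derivatives exist, and the variational inequality is
equivalent to minimality of `u` for `v ↦ 𝒜(v) - ∫ K v` among the admissible `v` which vanish on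
`∂Ω`. What remains is to pass from these competitors to all `v`, at the cost of `∫_{∂Ω} |v|`. Cut
`v` off near the boundary by test functions `ηₖ` with values in `[0, 1]` and limit `1` on `Ω`.
Testing `𝒜(ηₖ v)` with a pair `(g₀, g)` and using `ηₖ v div g = v div (ηₖ g) - v ∇ηₖ · g` gives
`𝒜(ηₖ v) ≤ 𝒜(v) + ∫ |v| |∇ηₖ|`, so it is enough to have `limsup ∫ |v| |∇ηₖ| ≤ ∫_{∂Ω} |v| dℋⁿ⁻¹`.

Both this estimate and the existence of traces are local. Where `Ω` is the region above the graph of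
a `C¹` function `ψ` over `ℝᵐ`, with `n = m + 1`, almost every vertical slice of a `BV` function has
finite essential variation, hence a limit at height `0`. The means over `(0, s)` of the deviation
from this limit are dominated, for `s ≤ s₀`, by a function on `ℝᵐ` which tends to `0` almost
everywhere as `s₀ → 0`; Lebesgue differentiation of that function turns the limits along slices into
traces. If `ηₖ` is a function of `(k + 1) * height` near the boundary, then on each fibre `|∇ηₖ|` is
an approximate identity in the height times `√(1 + |∇ψ|²)`, the density of `ℋᵐ` on the graph.
-/

namespace MeanCurvature

local notation:max "𝔼" n:max => EuclideanSpace ℝ (Fin n)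

/-! ### Test fields, total variation and area -/

section TestFields

variable {n : ℕ} {F : Type*} [NormedAddCommGroup F] [NormedSpace ℝ F] {Ω : Set (𝔼 n)}
  {g : 𝔼 n → F} {η u : 𝔼 n → ℝ} {X : 𝔼 n → 𝔼 n} {x : 𝔼 n}

lemma IsTest.continuous (hg : IsTest Ω g) : Continuous g :=
  hg.1.continuous

lemma IsTest.continuous_fderiv (hg : IsTest Ω g) : Continuous (fderiv ℝ g) :=
  hg.1.continuous_fderiv one_ne_zero

lemma IsTest.integrable (hg : IsTest Ω g) : Integrable g :=
  hg.continuous.integrable_of_hasCompactSupport hg.2.1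

lemma IsTest.zero : IsTest Ω (fun _ => (0 : F)) := by
  refine ⟨contDiff_const, HasCompactSupport.zero, ?_⟩
  simp [tsupport_eq_empty_iff.2 (rfl : (fun _ : 𝔼 n => (0 : F)) = 0)]

lemma IsTest.neg (hg : IsTest Ω g) : IsTest Ω (fun x => -g x) :=
  ⟨hg.1.neg, hg.2.1.neg, (tsupport_neg g).trans_subset hg.2.2⟩

lemma IsTest.smul (hη : IsTest Ω η) (hg : ContDiff ℝ 1 g) : IsTest Ω (fun x => η x • g x) :=
  ⟨hη.1.smul hg, hη.2.1.smul_right, (tsupport_smul_subset_left η g).trans hη.2.2⟩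

lemma IsTest.continuous_divergence (hX : IsTest Ω X) : Continuous (divergence X) := by
  have := hX.continuous_fderiv
  unfold divergence
  fun_prop

lemma divergence_eq_zero_of_notMem_tsupport (hx : x ∉ tsupport X) : divergence X x = 0 := by
  have : fderiv ℝ X x = 0 := Function.notMem_support.1 fun h => hx (support_fderiv_subset ℝ h)
  simp [divergence, this]

lemma IsTest.integrableOn_mul_divergence (hX : IsTest Ω X) (hu : IntegrableOn u Ω) :
    IntegrableOn (fun x => u x * divergence X x) Ω := by
  obtain ⟨C, hC⟩ := hX.continuous_divergence.bounded_above_of_compact_support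
    (HasCompactSupport.intro hX.2.1 fun _ => divergence_eq_zero_of_notMem_tsupport)
  exact hu.mul_bdd hX.continuous_divergence.aestronglyMeasurable (.of_forall hC)

lemma IsTest.integrableOn_mul (hη : IsTest Ω η) (hu : IntegrableOn u Ω) :
    IntegrableOn (fun x => η x * u x) Ω := by
  obtain ⟨C, hC⟩ := hη.continuous.bounded_above_of_compact_support hη.2.1
  exact hu.bdd_mul hη.continuous.aestronglyMeasurable (.of_forall hC)

lemma IsTest.integrableOn_abs_mul_norm_fderiv (hη : IsTest Ω η) (hu : IntegrableOn u Ω) :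
    IntegrableOn (fun x => |u x| * ‖fderiv ℝ η x‖) Ω := by
  obtain ⟨C, hC⟩ := hη.continuous_fderiv.bounded_above_of_compact_support (hη.2.1.fderiv ℝ)
  exact hu.abs.mul_bdd (c := C) hη.continuous_fderiv.norm.aestronglyMeasurable
    (.of_forall fun x => by simpa using hC x)

lemma divergence_neg (X : 𝔼 n → 𝔼 n) (x : 𝔼 n) :
    divergence (fun y => -X y) x = -divergence X x := by
  simp [divergence, fderiv_fun_neg]

lemma divergence_smul (hη : DifferentiableAt ℝ η x) (hX : DifferentiableAt ℝ X x) :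
    divergence (fun y => η y • X y) x = η x * divergence X x + fderiv ℝ η x (X x) := by
  have hsum : ∑ i, X x i • EuclideanSpace.single i (1 : ℝ) = X x := by
    simpa using (EuclideanSpace.basisFun (Fin n) ℝ).sum_repr (X x)
  have happly : fderiv ℝ η x (X x) = ∑ i, fderiv ℝ η x (EuclideanSpace.single i 1) * X x i := by
    conv_lhs => rw [← hsum]
    simp [map_sum, mul_comm]
  simp [divergence, fderiv_fun_smul hη hX, happly, Finset.mul_sum, Finset.sum_add_distrib]

lemma divergence_smul_const (hη : DifferentiableAt ℝ η x) (e : 𝔼 n) :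
    divergence (fun y => η y • e) x = fderiv ℝ η x e := by
  rw [divergence_smul hη (differentiableAt_const e)]
  simp [divergence]

end TestFields

section Variation

variable {n : ℕ} {Ω : Set (𝔼 n)} {u v η : 𝔼 n → ℝ} {X : 𝔼 n → 𝔼 n} {p : ℝ}

/-- The total variation `∫_Ω |Du|`, for `u ∈ BV(Ω)`. -/
noncomputable def totalVariation (Ω : Set (𝔼 n)) (u : 𝔼 n → ℝ) : ℝ :=
  sSup (variationSet Ω u)

lemma IsBV.integral_mul_divergence_le (hu : IsBV Ω u) (hX : IsTest Ω X) (hle : ∀ x, ‖X x‖ ≤ 1) :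
    ∫ x in Ω, u x * divergence X x ≤ totalVariation Ω u :=
  le_csSup hu.2 ⟨X, hX, hle, rfl⟩

lemma IsBV.abs_integral_mul_divergence_le (hu : IsBV Ω u) (hX : IsTest Ω X)
    (hle : ∀ x, ‖X x‖ ≤ 1) : |∫ x in Ω, u x * divergence X x| ≤ totalVariation Ω u := by
  refine abs_le'.2 ⟨hu.integral_mul_divergence_le hX hle, ?_⟩
  simpa [divergence_neg, integral_neg] using
    hu.integral_mul_divergence_le hX.neg fun x => (norm_neg _).trans_le (hle x)

lemma IsBV.congr (hu : IsBV Ω u) (h : u =ᵐ[volume.restrict Ω] v) : IsBV Ω v := by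
  refine ⟨hu.1.congr_fun_ae h, totalVariation Ω u, ?_⟩
  rintro _ ⟨X, hX, hle, rfl⟩
  refine le_of_eq_of_le (integral_congr_ae ?_) (hu.integral_mul_divergence_le hX hle)
  filter_upwards [h] with x hx
  rw [hx]

lemma IsBV.add (hu : IsBV Ω u) (hv : IsBV Ω v) : IsBV Ω (fun x => u x + v x) := by
  refine ⟨hu.1.add hv.1, totalVariation Ω u + totalVariation Ω v, ?_⟩
  rintro _ ⟨X, hX, hle, rfl⟩
  simp only [add_mul]
  rw [integral_add (hX.integrableOn_mul_divergence hu.1) (hX.integrableOn_mul_divergence hv.1)]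
  exact add_le_add (hu.integral_mul_divergence_le hX hle) (hv.integral_mul_divergence_le hX hle)

lemma IsBV.const_mul (hu : IsBV Ω u) (c : ℝ) : IsBV Ω (fun x => c * u x) := by
  refine ⟨hu.1.const_mul c, |c| * totalVariation Ω u, ?_⟩
  rintro _ ⟨X, hX, hle, rfl⟩
  simp only [mul_assoc, integral_const_mul]
  refine (le_abs_self _).trans ?_
  rw [abs_mul]
  gcongr
  exact hu.abs_integral_mul_divergence_le hX hle

/- `η v div X = v div (η X) - v ∇η · X`. -/
lemma integral_cutoff_mul_divergence_le (hη : IsTest Ω η) (hX : IsTest Ω X)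
    (hle : ∀ x, ‖X x‖ ≤ 1) (hv : IntegrableOn v Ω) :
    ∫ x in Ω, η x * v x * divergence X x ≤
      (∫ x in Ω, v x * divergence (fun y => η y • X y) x)
        + ∫ x in Ω, |v x| * ‖fderiv ℝ η x‖ := by
  have hi₁ := (hη.smul hX.1).integrableOn_mul_divergence hv
  have hi₂ := hη.integrableOn_abs_mul_norm_fderiv hv
  rw [← integral_add hi₁ hi₂]
  refine integral_mono (hX.integrableOn_mul_divergence (hη.integrableOn_mul hv)) (hi₁.add hi₂)
    fun x => ?_
  have hgrad : -(v x * fderiv ℝ η x (X x)) ≤ |v x| * ‖fderiv ℝ η x‖ := by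
    refine (neg_le_abs _).trans ?_
    rw [abs_mul]
    gcongr
    exact (fderiv ℝ η x).unit_le_opNorm _ (hle x)
  simp only [divergence_smul (hη.1.differentiable one_ne_zero x)
    (hX.1.differentiable one_ne_zero x)]
  linarith

lemma norm_smul_le_of_mem_Icc {E : Type*} [SeminormedAddCommGroup E] [NormedSpace ℝ E] {a : ℝ}
    (ha : a ∈ Set.Icc (0 : ℝ) 1) (y : E) : ‖a • y‖ ≤ ‖y‖ := by
  rw [norm_smul, Real.norm_of_nonneg ha.1]
  exact mul_le_of_le_one_left (norm_nonneg _) ha.2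

lemma IsBV.cutoff (hv : IsBV Ω v) (hη : IsTest Ω η) (h01 : ∀ x, η x ∈ Set.Icc (0 : ℝ) 1) :
    IsBV Ω (fun x => η x * v x) := by
  refine ⟨hη.integrableOn_mul hv.1, totalVariation Ω v + ∫ x in Ω, |v x| * ‖fderiv ℝ η x‖, ?_⟩
  rintro _ ⟨X, hX, hle, rfl⟩
  refine (integral_cutoff_mul_divergence_le hη hX hle hv.1).trans ?_
  gcongr
  exact hv.integral_mul_divergence_le (hη.smul hX.1)
    fun x => (norm_smul_le_of_mem_Icc (h01 x) _).trans (hle x)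

lemma IsAdmissible.add (hu : IsAdmissible Ω p u) (hv : IsAdmissible Ω p v) :
    IsAdmissible Ω p (fun x => u x + v x) :=
  ⟨hu.1.add hv.1, hu.2.add hv.2⟩

lemma IsAdmissible.const_mul (hu : IsAdmissible Ω p u) (c : ℝ) :
    IsAdmissible Ω p (fun x => c * u x) :=
  ⟨hu.1.const_mul c, hu.2.const_mul c⟩

lemma IsAdmissible.cutoff (hv : IsAdmissible Ω p v) (hη : IsTest Ω η)
    (h01 : ∀ x, η x ∈ Set.Icc (0 : ℝ) 1) : IsAdmissible Ω p (fun x => η x * v x) :=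
  ⟨hv.1.of_le (hη.continuous.aestronglyMeasurable.mul hv.1.1)
    (.of_forall fun x => norm_smul_le_of_mem_Icc (h01 x) (v x)), hv.2.cutoff hη h01⟩

end Variation

section Area

variable {n : ℕ} {Ω : Set (𝔼 n)} {u v φ η g₀ : 𝔼 n → ℝ} {g : 𝔼 n → 𝔼 n}

lemma norm_le_one_of_sq_add_sq_le {a b : ℝ} (h : a ^ 2 + b ^ 2 ≤ 1) : |a| ≤ 1 ∧ |b| ≤ 1 := by
  constructor <;> rw [← sq_le_one_iff_abs_le_one] <;> nlinarith

lemma integral_add_mul_divergence (h₀ : IsTest Ω g₀) (hg : IsTest Ω g) (hu : IntegrableOn u Ω) :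
    ∫ x in Ω, (g₀ x + u x * divergence g x)
      = (∫ x in Ω, g₀ x) + ∫ x in Ω, u x * divergence g x :=
  integral_add h₀.integrable.integrableOn (hg.integrableOn_mul_divergence hu)

lemma IsBV.bddAbove_areaSet (hΩ : Bornology.IsBounded Ω) (hu : IsBV Ω u) :
    BddAbove (areaSet Ω u) := by
  refine ⟨volume.real Ω + totalVariation Ω u, ?_⟩
  rintro _ ⟨g₀, g, h₀, hg, hle, rfl⟩
  rw [integral_add_mul_divergence h₀ hg hu.1]
  refine add_le_add ?_ (hu.integral_mul_divergence_le hg fun x => by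
    simpa using (norm_le_one_of_sq_add_sq_le (hle x)).2)
  have := norm_setIntegral_le_of_norm_le_const (μ := volume) (f := g₀) hΩ.measure_lt_top
    fun x _ => (norm_le_one_of_sq_add_sq_le (hle x)).1
  rw [one_mul] at this
  exact (le_abs_self _).trans this

lemma IsBV.le_area (hΩ : Bornology.IsBounded Ω) (hu : IsBV Ω u) (h₀ : IsTest Ω g₀)
    (hg : IsTest Ω g) (hle : ∀ x, g₀ x ^ 2 + ‖g x‖ ^ 2 ≤ 1) :
    ∫ x in Ω, (g₀ x + u x * divergence g x) ≤ area Ω u :=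
  le_csSup (hu.bddAbove_areaSet hΩ) ⟨g₀, g, h₀, hg, hle, rfl⟩

lemma area_le {c : ℝ} (h : ∀ (g₀ : 𝔼 n → ℝ) (g : 𝔼 n → 𝔼 n), IsTest Ω g₀ → IsTest Ω g →
      (∀ x, g₀ x ^ 2 + ‖g x‖ ^ 2 ≤ 1) → ∫ x in Ω, (g₀ x + u x * divergence g x) ≤ c) :
    area Ω u ≤ c := by
  refine csSup_le ⟨0, fun _ => 0, fun _ => 0, .zero, .zero, by simp, by simp [divergence]⟩ ?_
  rintro _ ⟨g₀, g, h₀, hg, hle, rfl⟩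
  exact h g₀ g h₀ hg hle

/- `𝒜` is a supremum of affine functionals. -/
lemma convexOn_area (hΩ : Bornology.IsBounded Ω) : ConvexOn ℝ {u | IsBV Ω u} (area Ω) := by
  refine ⟨fun u hu v hv a b _ _ _ => (hu.const_mul a).add (hv.const_mul b),
    fun u hu v hv a b ha hb hab => area_le fun g₀ g h₀ hg hle => ?_⟩
  have hi {w : 𝔼 n → ℝ} (hw : IsBV Ω w) : IntegrableOn (fun x => g₀ x + w x * divergence g x) Ω :=
    h₀.integrable.integrableOn.add (hg.integrableOn_mul_divergence hw.1)
  calc ∫ x in Ω, (g₀ x + (a • u + b • v) x * divergence g x)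
      = ∫ x in Ω, (a * (g₀ x + u x * divergence g x) + b * (g₀ x + v x * divergence g x)) := by
        congr with x
        simp only [Pi.add_apply, Pi.smul_apply, smul_eq_mul]
        linear_combination -g₀ x * hab
    _ = a * (∫ x in Ω, (g₀ x + u x * divergence g x))
          + b * ∫ x in Ω, (g₀ x + v x * divergence g x) := by
        rw [integral_add ((hi hu).const_mul _) ((hi hv).const_mul _), integral_const_mul,
          integral_const_mul]
    _ ≤ a • area Ω u + b • area Ω v := by
        simp only [smul_eq_mul]
        gcongr
        exacts [hu.le_area hΩ h₀ hg hle, hv.le_area hΩ h₀ hg hle]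

lemma convexOn_area_add_mul (hΩ : Bornology.IsBounded Ω) (hu : IsBV Ω u) (hφ : IsBV Ω φ) :
    ConvexOn ℝ Set.univ fun t : ℝ => area Ω (fun x => u x + t * φ x) := by
  have h := (convexOn_area hΩ).comp_affineMap (AffineMap.lineMap u (u + φ))
  have hline : (AffineMap.lineMap u (u + φ) : ℝ → 𝔼 n → ℝ) = fun t x => u x + t * φ x := by
    ext t x
    simp [AffineMap.lineMap_apply, add_comm]
  rw [hline] at h
  exact h.subset (fun t _ => hu.add (hφ.const_mul t)) convex_univ

lemma hasAreaDeriv_iff_hasDerivWithinAt {ℓ : ℝ} : HasAreaDeriv Ω u φ ℓ ↔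
    HasDerivWithinAt (fun t : ℝ => area Ω (fun x => u x + t * φ x)) ℓ (Set.Ioi 0) 0 := by
  rw [hasDerivWithinAt_iff_tendsto_slope' Set.self_notMem_Ioi, HasAreaDeriv]
  simp [slope_fun_def_field]

lemma exists_hasAreaDeriv (hΩ : Bornology.IsBounded Ω) (hu : IsBV Ω u) (hφ : IsBV Ω φ) :
    ∃ ℓ, HasAreaDeriv Ω u φ ℓ :=
  ⟨_, hasAreaDeriv_iff_hasDerivWithinAt.2
    ((convexOn_area_add_mul hΩ hu hφ).hasDerivWithinAt_rightDeriv_of_mem_interior (by simp))⟩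

lemma HasAreaDeriv.le_of_forall_mul_le {ℓ c : ℝ} (h : HasAreaDeriv Ω u φ ℓ)
    (hc : ∀ t : ℝ, 0 < t → t * c ≤ area Ω (fun x => u x + t * φ x) - area Ω u) : c ≤ ℓ :=
  ge_of_tendsto h <| eventually_nhdsWithin_of_forall fun t ht => by
    rw [le_div_iff₀ ht, mul_comm]
    exact hc t ht

lemma HasAreaDeriv.le_area_add_sub (hΩ : Bornology.IsBounded Ω) (hu : IsBV Ω u) (hφ : IsBV Ω φ)
    {ℓ : ℝ} (h : HasAreaDeriv Ω u φ ℓ) : ℓ ≤ area Ω (fun x => u x + φ x) - area Ω u := by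
  simpa [slope_def_field] using (convexOn_area_add_mul hΩ hu hφ).le_slope_of_hasDerivWithinAt_Ioi
    (Set.mem_univ 0) (Set.mem_univ 1) one_pos (hasAreaDeriv_iff_hasDerivWithinAt.1 h)

lemma area_cutoff_le (hΩ : Bornology.IsBounded Ω) (hv : IsBV Ω v) (hη : IsTest Ω η)
    (h01 : ∀ x, η x ∈ Set.Icc (0 : ℝ) 1) :
    area Ω (fun x => η x * v x) ≤ area Ω v + ∫ x in Ω, |v x| * ‖fderiv ℝ η x‖ := by
  refine area_le fun g₀ g h₀ hg hle => ?_
  have hcut := integral_cutoff_mul_divergence_le hη hg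
    (fun x => by simpa using (norm_le_one_of_sq_add_sq_le (hle x)).2) hv.1
  have harea := hv.le_area hΩ h₀ (hη.smul hg.1) fun x => by
    have := pow_le_pow_left₀ (norm_nonneg _) (norm_smul_le_of_mem_Icc (h01 x) (g x)) 2
    linarith [hle x]
  rw [integral_add_mul_divergence h₀ hg (hη.integrableOn_mul hv.1)]
  rw [integral_add_mul_divergence h₀ (hη.smul hg.1) hv.1] at harea
  linarith

end Area

/-! ### The nonlinearity -/

section Nonlinearity

variable {p : ℝ}

lemma measurable_f : Measurable (f p) := by
  unfold f; fun_prop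

lemma abs_f (hp : p ≠ 0) (s : ℝ) : |f p s| = |s| ^ p := by
  rcases eq_or_ne s 0 with rfl | hs
  · simp [f, Real.zero_rpow hp]
  · rw [f, abs_mul, Real.abs_rpow_of_nonneg (abs_nonneg s), abs_abs,
      ← Real.rpow_add_one (abs_ne_zero.2 hs), sub_add_cancel]

lemma f_mul_self (hp : p + 1 ≠ 0) (s : ℝ) : f p s * s = |s| ^ (p + 1) := by
  rcases eq_or_ne s 0 with rfl | hs
  · simp [f, Real.zero_rpow hp]
  · have hs' : |s| ≠ 0 := abs_ne_zero.2 hs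
    rw [f, mul_assoc, ← abs_mul_abs_self s, ← mul_assoc, ← Real.rpow_add_one hs', sub_add_cancel,
      Real.rpow_add_one hs']

lemma holderConjugate_add_one (hp : 0 < p) : (p + 1).HolderConjugate ((p + 1) / p) :=
  Real.holderConjugate_iff.2 ⟨by linarith, by field_simp; ring⟩

lemma f_mul_le (hp : 0 < p) (s t : ℝ) : f p s * t ≤ F p t + p * F p s := by
  have young := Real.young_inequality_of_nonneg (abs_nonneg t) (abs_nonneg (f p s))
    (holderConjugate_add_one hp)
  rw [abs_f hp.ne', ← Real.rpow_mul (abs_nonneg s), mul_div_cancel₀ _ hp.ne', ← abs_f hp.ne',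
    mul_comm, ← abs_mul] at young
  calc f p s * t ≤ |f p s * t| := le_abs_self _
    _ ≤ _ := young
    _ = F p t + p * F p s := by unfold F; field_simp

lemma G_nonneg (hp : 0 < p) (s t : ℝ) : 0 ≤ G p s t := by
  have hself : f p s * s = F p s + p * F p s := by
    rw [f_mul_self (by positivity), F]
    field_simp
    ring
  rw [G]
  linarith [f_mul_le hp s t]

end Nonlinearity

section Source

variable {n : ℕ} {Ω : Set (𝔼 n)} {H u v : 𝔼 n → ℝ} {p lam : ℝ}

lemma memLp_f_comp (hp : 0 < p) (hu : MemLp u (ENNReal.ofReal (p + 1)) (volume.restrict Ω)) :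
    MemLp (fun x => f p (u x)) (ENNReal.ofReal ((p + 1) / p)) (volume.restrict Ω) := by
  have hpow := hu.norm_rpow_div (ENNReal.ofReal p)
  rw [ENNReal.toReal_ofReal hp.le, ← ENNReal.ofReal_div_of_pos hp] at hpow
  refine hpow.mono (measurable_f.comp_aemeasurable hu.1.aemeasurable).aestronglyMeasurable
    (.of_forall fun x => ?_)
  rw [Real.norm_eq_abs, abs_f hp.ne']
  exact le_abs_self _

lemma integrableOn_mul_of_memLp (hp : 0 < p)
    (hH : MemLp H (ENNReal.ofReal ((p + 1) / p)) (volume.restrict Ω))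
    (hv : MemLp v (ENNReal.ofReal (p + 1)) (volume.restrict Ω)) :
    IntegrableOn (fun x => H x * v x) Ω :=
  have := (holderConjugate_add_one hp).symm.ennrealOfReal
  hH.integrable_mul hv

lemma IsAdmissible.integrableOn_F (hp : 0 < p) (hu : IsAdmissible Ω p u) :
    IntegrableOn (fun x => F p (u x)) Ω := by
  have h := hu.1.integrable_norm_rpow (by simp; linarith) ENNReal.ofReal_ne_top
  rw [ENNReal.toReal_ofReal (by linarith)] at h
  exact h.div_const _

lemma energy_add_integral_G (hp : 0 < p)
    (hH : MemLp H (ENNReal.ofReal ((p + 1) / p)) (volume.restrict Ω))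
    (hu : IsAdmissible Ω p u) (hv : IsAdmissible Ω p v) :
    energy Ω H p lam v + ∫ x in Ω, lam * G p (u x) (v x)
      = area Ω v - (∫ x in Ω, (H x + lam * f p (u x)) * v x)
        + ∫ x in Ω, lam * (f p (u x) * u x - F p (u x)) := by
  have hfu := memLp_f_comp hp hu.1
  have iEnergy : IntegrableOn (fun x => H x * v x + lam * F p (v x)) Ω :=
    (integrableOn_mul_of_memLp hp hH hv.1).add ((hv.integrableOn_F hp).const_mul lam)
  have iSource : IntegrableOn (fun x => (H x + lam * f p (u x)) * v x) Ω :=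
    integrableOn_mul_of_memLp hp (hH.add (hfu.const_mul lam)) hv.1
  have iConst : IntegrableOn (fun x => lam * (f p (u x) * u x - F p (u x))) Ω :=
    ((integrableOn_mul_of_memLp hp hfu hu.1).sub (hu.integrableOn_F hp)).const_mul lam
  have expand : ∀ x, lam * G p (u x) (v x) = (H x * v x + lam * F p (v x))
      - (H x + lam * f p (u x)) * v x + lam * (f p (u x) * u x - F p (u x)) := fun x => by
    rw [G]; ring
  simp only [expand]
  rw [integral_add (by exact iEnergy.sub iSource) iConst, integral_sub iEnergy iSource, energy]
  ring

lemma energy_eq (hp : 0 < p)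
    (hH : MemLp H (ENNReal.ofReal ((p + 1) / p)) (volume.restrict Ω)) (hu : IsAdmissible Ω p u) :
    energy Ω H p lam u = area Ω u - (∫ x in Ω, (H x + lam * f p (u x)) * u x)
        + ∫ x in Ω, lam * (f p (u x) * u x - F p (u x)) := by
  simpa [G] using energy_add_integral_G hp hH hu hu

end Source

/-! ### Translations and slices of `BV` functions -/

section Duality

open scoped Convolution

variable {n : ℕ} {U K : Set (𝔼 n)} {w : 𝔼 n → ℝ}

lemma isTest_convolution_normed {s : 𝔼 n → ℝ} {ε : ℝ} (hKU : Metric.cthickening ε K ⊆ U)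
    (hK : IsCompact K) (φ : ContDiffBump (0 : 𝔼 n)) (hφ : φ.rOut ≤ ε)
    (hs : LocallyIntegrable s) (hsK : Function.support s ⊆ K) :
    IsTest U (φ.normed volume ⋆[ContinuousLinearMap.lsmul ℝ ℝ] s) := by
  have hsupp : Function.support (φ.normed volume ⋆[ContinuousLinearMap.lsmul ℝ ℝ] s)
      ⊆ Metric.cthickening ε K := by
    refine (support_convolution_subset _).trans ?_
    rintro _ ⟨a, ha, b, hb, rfl⟩
    rw [φ.support_normed_eq, mem_ball_zero_iff] at ha
    refine Metric.mem_cthickening_of_dist_le _ b _ _ (hsK hb) ?_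
    simpa using ha.le.trans hφ
  exact ⟨φ.hasCompactSupport_normed.contDiff_convolution_left _ φ.contDiff_normed hs,
    .of_support_subset_isCompact hK.cthickening hsupp,
    (closure_minimal hsupp Metric.isClosed_cthickening).trans hKU⟩

lemma abs_convolution_normed_le_one {s : 𝔼 n → ℝ} (φ : ContDiffBump (0 : 𝔼 n))
    (hs : AEStronglyMeasurable s) (hs1 : ∀ x, |s x| ≤ 1) (x : 𝔼 n) :
    |(φ.normed volume ⋆[ContinuousLinearMap.lsmul ℝ ℝ] s) x| ≤ 1 := by
  simpa using dist_convolution_le (z₀ := (0 : ℝ)) zero_le_one φ.support_normed_eq.le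
    φ.nonneg_normed φ.integral_normed hs fun y _ => by simpa using hs1 y

lemma exists_seq_isTest_tendsto (hU : IsOpen U) (hK : IsCompact K) (hKU : K ⊆ U) {s : 𝔼 n → ℝ}
    (hs : LocallyIntegrable s) (hsK : Function.support s ⊆ K) (hs1 : ∀ x, |s x| ≤ 1) :
    ∃ φ : ℕ → 𝔼 n → ℝ, (∀ k, IsTest U (φ k)) ∧ (∀ k x, |φ k x| ≤ 1) ∧
      ∀ᵐ x, Tendsto (fun k => φ k x) atTop (𝓝 (s x)) := by
  obtain ⟨ε, hε, hεU⟩ := hK.exists_cthickening_subset_open hU hKU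
  let r : ℕ → ℝ := fun k => ε / 2 / (k + 1)
  have hr : ∀ k, 0 < r k := fun k => by positivity
  let ρ : ℕ → ContDiffBump (0 : 𝔼 n) := fun k => ⟨r k, 2 * r k, hr k, by linarith [hr k]⟩
  have hρ : Tendsto (fun k => (ρ k).rOut) atTop (𝓝 0) := by
    have := (tendsto_one_div_add_atTop_nhds_zero_nat.const_mul (ε / 2)).const_mul 2
    simp only [mul_one_div, mul_zero] at this
    exact this
  have hρε : ∀ k, (ρ k).rOut ≤ ε := fun k => by
    have := div_le_self (half_pos hε).le (by simp : (1 : ℝ) ≤ k + 1)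
    change 2 * (ε / 2 / (k + 1)) ≤ ε
    linarith
  exact ⟨fun k => (ρ k).normed volume ⋆[ContinuousLinearMap.lsmul ℝ ℝ] s,
    fun k => isTest_convolution_normed hεU hK (ρ k) (hρε k) hs hsK,
    fun k => abs_convolution_normed_le_one (ρ k) hs.aestronglyMeasurable hs1,
    ContDiffBump.ae_convolution_tendsto_right_of_locallyIntegrable (K := 2) hρ
      (.of_forall fun _ => le_rfl) hs⟩

lemma setIntegral_abs_le_of_isCompact (hU : IsOpen U) (hK : IsCompact K) (hKU : K ⊆ U)
    (hw : IntegrableOn w U) {C : ℝ}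
    (h : ∀ φ : 𝔼 n → ℝ, IsTest U φ → (∀ x, |φ x| ≤ 1) → ∫ x in U, w x * φ x ≤ C) :
    ∫ x in K, |w x| ≤ C := by
  -- `w / |w|` is the sign of `w`, with value `0` at the zeros of `w`.
  have hs1 : ∀ x, |K.indicator (fun x => w x / |w x|) x| ≤ 1 := fun x => by
    rw [← Real.norm_eq_abs, norm_indicator_eq_indicator_norm]
    refine Set.indicator_apply_le' (fun _ => ?_) fun _ => zero_le_one
    simpa using div_self_le_one |w x|
  have hs : Integrable (K.indicator fun x => w x / |w x|) := by
    have hwK := (hw.mono_set hKU).1.aemeasurable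
    refine IntegrableOn.integrable_indicator ?_ hK.measurableSet
    refine .of_bound hK.measure_lt_top (hwK.div hwK.abs).aestronglyMeasurable 1
      (.of_forall fun x => ?_)
    simpa using div_self_le_one |w x|
  obtain ⟨φ, hφ, hφ1, hlim⟩ :=
    exists_seq_isTest_tendsto hU hK hKU hs.locallyIntegrable Set.support_indicator_subset hs1
  have hint : Tendsto (fun k => ∫ x in U, w x * φ k x) atTop
      (𝓝 (∫ x in U, w x * K.indicator (fun x => w x / |w x|) x)) := by
    refine tendsto_integral_of_dominated_convergence (fun x => |w x|)
      (fun k => hw.1.mul (hφ k).continuous.aestronglyMeasurable) hw.abs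
      (fun k => .of_forall fun x => ?_) ?_
    · rw [norm_mul]
      exact mul_le_of_le_one_right (norm_nonneg _) (hφ1 k x)
    · filter_upwards [ae_restrict_of_ae hlim] with x hx using hx.const_mul (w x)
  refine le_of_eq_of_le ?_ (le_of_tendsto' hint fun k => h _ (hφ k) (hφ1 k))
  have hmul : ∀ x, w x * K.indicator (fun x => w x / |w x|) x = K.indicator (fun x => |w x|) x :=
    fun x => by
      rw [← Set.indicator_mul_right]
      simp only [← mul_div_assoc, ← abs_mul_abs_self (w _), mul_self_div_self]
  simp only [hmul]
  rw [setIntegral_indicator hK.measurableSet, Set.inter_eq_right.2 hKU]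

lemma setIntegral_abs_le_of_isTest (hU : IsOpen U) (hw : IntegrableOn w U) {C : ℝ}
    (h : ∀ φ : 𝔼 n → ℝ, IsTest U φ → (∀ x, |φ x| ≤ 1) → ∫ x in U, w x * φ x ≤ C) :
    ∫ x in U, |w x| ≤ C := by
  have := hU.locallyCompactSpace
  obtain ⟨K, hK, hKU⟩ : IsSigmaCompact U := isSigmaCompact_iff_sigmaCompactSpace.2 inferInstance
  have hlim := tendsto_setIntegral_of_monotone (μ := volume) (f := fun x => |w x|)
    (fun k => (isCompact_accumulate hK k).measurableSet) Set.monotone_accumulate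
    (by rw [Set.iUnion_accumulate, hKU]; exact hw.abs)
  rw [Set.iUnion_accumulate, hKU] at hlim
  refine le_of_tendsto' hlim fun k => setIntegral_abs_le_of_isCompact hU
    (isCompact_accumulate hK k) ?_ hw h
  exact (Set.subset_iUnion _ k).trans (Set.iUnion_accumulate.trans hKU).le

end Duality

section Translation

variable {n : ℕ} {Ω U : Set (𝔼 n)} {v φ : 𝔼 n → ℝ} {e : 𝔼 n}

lemma IsTest.translate (hφ : IsTest U φ) {y : 𝔼 n} (hy : ∀ x ∈ U, x + y ∈ Ω) :
    IsTest Ω (fun x => φ (x - y)) := by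
  refine ⟨hφ.1.comp (contDiff_id.sub contDiff_const),
    hφ.2.1.comp_homeomorph (Homeomorph.subRight y), ?_⟩
  rw [show tsupport (fun x => φ (x - y)) = _ from
    tsupport_comp_eq_preimage φ (Homeomorph.subRight y)]
  intro x hx
  simpa using hy _ (hφ.2.2 hx)

lemma divergence_translate_smul_const (hφ : Differentiable ℝ φ) (y x : 𝔼 n) :
    divergence (fun z => φ (z - y) • e) x = fderiv ℝ φ (x - y) e := by
  have hφy : DifferentiableAt ℝ (fun z => φ (z - y)) x :=
    (hφ _).comp x (differentiableAt_id.sub_const y)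
  rw [divergence_smul_const hφy, fderiv_comp_sub (f := φ)]

lemma IsTest.hasDerivAt_integral_mul_translate {μ : Measure (𝔼 n)} (hφ : IsTest U φ)
    (hv : Integrable v μ) (s : ℝ) :
    HasDerivAt (fun s : ℝ => ∫ x, v x * φ (x - s • e) ∂μ)
      (-∫ x, v x * fderiv ℝ φ (x - s • e) e ∂μ) s := by
  obtain ⟨C, hC⟩ := hφ.continuous.bounded_above_of_compact_support hφ.2.1
  obtain ⟨C', hC'⟩ := hφ.continuous_fderiv.bounded_above_of_compact_support (hφ.2.1.fderiv ℝ)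
  have hcont := hφ.continuous
  have hcont' := hφ.continuous_fderiv
  have hint : ∀ s : ℝ, Integrable (fun x => v x * φ (x - s • e)) μ := fun s =>
    hv.mul_bdd (Continuous.aestronglyMeasurable (by fun_prop)) (.of_forall fun x => hC _)
  have hderiv : ∀ x (s : ℝ), HasDerivAt (fun s : ℝ => φ (x - s • e))
      (-(fderiv ℝ φ (x - s • e) e)) s := fun x s => by
    have hline : HasDerivAt (fun s : ℝ => x - s • e) (-e) s := by
      simpa using ((hasDerivAt_id s).smul_const e).const_sub x
    rw [← map_neg]
    exact (hφ.1.differentiable one_ne_zero (x - s • e)).hasFDerivAt.comp_hasDerivAt s hline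
  rw [← integral_neg]
  simp only [← mul_neg]
  refine (hasDerivAt_integral_of_dominated_loc_of_deriv_le (s := Set.univ)
    (bound := fun x => |v x| * (C' * ‖e‖)) univ_mem (.of_forall fun s => (hint s).1) (hint s)
    (hv.1.mul (Continuous.aestronglyMeasurable (by fun_prop))) ?_
    (hv.abs.mul_const _) (.of_forall fun x t _ => (hderiv x t).const_mul _)).2
  refine .of_forall fun x t _ => ?_
  rw [norm_mul, norm_neg]
  gcongr
  · exact le_rfl
  · exact ((fderiv ℝ φ (x - t • e)).le_opNorm e).trans (by gcongr; exact hC' _)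

lemma IsBV.abs_integral_mul_translate_sub_le (hv : IsBV Ω v) (he : ‖e‖ ≤ 1) {h : ℝ} (hh : 0 ≤ h)
    (hUΩ : ∀ x ∈ U, ∀ s ∈ Set.Icc 0 h, x + s • e ∈ Ω) (hφ : IsTest U φ) (hφ1 : ∀ x, |φ x| ≤ 1) :
    |(∫ x in Ω, v x * φ (x - h • e)) - ∫ x in Ω, v x * φ x| ≤ totalVariation Ω v * h := by
  have hbound : ∀ s ∈ Set.Ico (0 : ℝ) h,
      ‖-∫ x in Ω, v x * fderiv ℝ φ (x - s • e) e‖ ≤ totalVariation Ω v := fun s hs => by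
    have htrans : IsTest Ω (fun x => φ (x - s • e)) :=
      hφ.translate fun x hx => hUΩ x hx s (Set.Ico_subset_Icc_self hs)
    simp only [norm_neg, ← divergence_translate_smul_const (hφ.1.differentiable one_ne_zero)]
    refine hv.abs_integral_mul_divergence_le (htrans.smul contDiff_const) fun x => ?_
    rw [norm_smul]
    exact mul_le_one₀ (hφ1 _) (norm_nonneg _) he
  simpa using norm_image_sub_le_of_norm_deriv_le_segment'
    (fun s _ => (hφ.hasDerivAt_integral_mul_translate hv.1 s).hasDerivWithinAt)
    hbound h (Set.right_mem_Icc.2 hh)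

lemma IsTest.setIntegral_mul_eq (hφ : IsTest U φ) (hU : U ⊆ Ω) :
    ∫ x in U, v x * φ x = ∫ x in Ω, v x * φ x := by
  have hzero : ∀ x, x ∉ U → v x * φ x = 0 := fun x hx => by
    rw [image_eq_zero_of_notMem_tsupport fun hx' => hx (hφ.2.2 hx'), mul_zero]
  rw [setIntegral_eq_integral_of_forall_compl_eq_zero hzero,
    setIntegral_eq_integral_of_forall_compl_eq_zero fun x hx => hzero x fun hx' => hx (hU hx')]

lemma integrableOn_translate (hv : IntegrableOn v Ω) {y : 𝔼 n} (hUΩ : ∀ x ∈ U, x + y ∈ Ω) :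
    IntegrableOn (fun x => v (x + y)) U :=
  (((measurePreserving_add_right (volume : Measure (𝔼 n)) y).integrableOn_comp_preimage
    (MeasurableEquiv.addRight y).measurableEmbedding).2 hv).mono_set hUΩ

lemma IsBV.setIntegral_abs_translate_sub_le (hU : IsOpen U) (hv : IsBV Ω v) (he : ‖e‖ ≤ 1)
    {h : ℝ} (hh : 0 ≤ h) (hUΩ : ∀ x ∈ U, ∀ s ∈ Set.Icc 0 h, x + s • e ∈ Ω) :
    ∫ x in U, |v (x + h • e) - v x| ≤ totalVariation Ω v * h := by
  have hUΩ0 : U ⊆ Ω := fun x hx => by simpa using hUΩ x hx 0 (Set.left_mem_Icc.2 hh)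
  have hUΩh : ∀ x ∈ U, x + h • e ∈ Ω := fun x hx => hUΩ x hx h (Set.right_mem_Icc.2 hh)
  have hvU : IntegrableOn v U := hv.1.mono_set hUΩ0
  have hpres := measurePreserving_add_right (volume : Measure (𝔼 n)) (h • e)
  have hemb := (MeasurableEquiv.addRight (h • e)).measurableEmbedding
  have hvUh : IntegrableOn (fun x => v (x + h • e)) U := integrableOn_translate hv.1 hUΩh
  refine setIntegral_abs_le_of_isTest hU (hvUh.sub hvU) fun φ hφ hφ1 => ?_
  have hshift : ∫ x in U, v (x + h • e) * φ x = ∫ x in Ω, v x * φ (x - h • e) := by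
    have hsub : (fun x => x - h • e) ⁻¹' U ⊆ Ω := fun x hx => by simpa using hUΩh _ hx
    have htrans : IsTest ((fun x => x - h • e) ⁻¹' U) fun x => φ (x - h • e) :=
      hφ.translate fun x hx => by simpa using hx
    have hpre : (fun x => x + h • e) ⁻¹' ((fun x => x - h • e) ⁻¹' U) = U := by ext x; simp
    have := hpres.setIntegral_preimage_emb hemb (fun x => v x * φ (x - h • e))
      ((fun x => x - h • e) ⁻¹' U)
    rw [← htrans.setIntegral_mul_eq hsub, ← this, hpre]
    simp only [add_sub_cancel_right]
  obtain ⟨C, hC⟩ := hφ.continuous.bounded_above_of_compact_support hφ.2.1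
  have hφm := hφ.continuous.aestronglyMeasurable (μ := volume.restrict U)
  simp only [Pi.sub_apply, sub_mul]
  rw [integral_sub (hvUh.mul_bdd hφm (.of_forall hC)) (hvU.mul_bdd hφm (.of_forall hC)), hshift,
    hφ.setIntegral_mul_eq hUΩ0]
  exact (le_abs_self _).trans (hv.abs_integral_mul_translate_sub_le he hh hUΩ hφ hφ1)

end Translation

section Slices

variable {w : ℝ → ℝ} {δ : ℝ}

instance neBot_nhdsGT_inf_ae : (𝓝[>] (0 : ℝ) ⊓ ae volume).NeBot := by
  refine inf_neBot_iff.2 fun {s} hs {t} ht => ?_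
  obtain ⟨ε, hε, hsub⟩ := mem_nhdsGT_iff_exists_Ioo_subset.1 hs
  have hne : volume (Set.Ioo 0 ε ∩ t) ≠ 0 := by
    rw [measure_inter_conull (mem_ae_iff.1 ht)]
    simpa using hε
  obtain ⟨x, hx⟩ := nonempty_of_measure_ne_zero hne
  exact ⟨x, hsub hx.1, hx.2⟩

lemma sum_lintegral_Ioc (g : ℝ → ℝ≥0∞) {u : ℕ → ℝ} (hu : Monotone u) (N : ℕ) :
    ∑ i ∈ Finset.range N, ∫⁻ x in Set.Ioc (u i) (u (i + 1)), g x
      = ∫⁻ x in Set.Ioc (u 0) (u N), g x := by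
  induction N with
  | zero => simp
  | succ N ih =>
    rw [Finset.sum_range_succ, ih, ← Set.Ioc_union_Ioc_eq_Ioc (hu N.zero_le) (hu N.le_succ),
      lintegral_union measurableSet_Ioc (Set.Ioc_disjoint_Ioc_of_le le_rfl)]

/-- The `L¹(0, δ)` norm of the difference quotient of `w` over the step `1 / (k + 1)`; its lower
limit as `k → ∞` stands in for the essential variation of `w` on `(0, δ)`. -/
noncomputable def quotientNorm (δ : ℝ) (w : ℝ → ℝ) (k : ℕ) : ℝ≥0∞ :=
  ∫⁻ s in Set.Ioo 0 δ, ‖((k : ℝ) + 1) * (w (s + 1 / ((k : ℝ) + 1)) - w s)‖ₑ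

lemma intervalIntegrable_of_locallyIntegrable (hw : LocallyIntegrable w) (a b : ℝ) :
    IntervalIntegrable w volume a b :=
  (hw.integrableOn_isCompact isCompact_uIcc).intervalIntegrable

lemma edist_average_le (hw : LocallyIntegrable w) (c h : ℝ) {σ τ : ℝ} (hστ : σ ≤ τ) :
    edist (c * ∫ x in τ..(τ + h), w x) (c * ∫ x in σ..(σ + h), w x)
      ≤ ∫⁻ s in Set.Ioc σ τ, ‖c * (w (s + h) - w s)‖ₑ := by
  have hi := intervalIntegrable_of_locallyIntegrable hw
  have hsub : (∫ x in τ..(τ + h), w x) - ∫ x in σ..(σ + h), w x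
      = ∫ s in σ..τ, (w (s + h) - w s) := by
    rw [intervalIntegral.integral_sub (by simpa using (hi (σ + h) (τ + h)).comp_add_right h)
      (hi _ _), intervalIntegral.integral_comp_add_right,
      intervalIntegral.integral_interval_sub_interval_comm' (hi _ _) (hi _ _) (hi _ _)]
  rw [edist_eq_enorm_sub, ← mul_sub, hsub, ← intervalIntegral.integral_const_mul,
    intervalIntegral.integral_of_le hστ]
  exact enorm_integral_le_lintegral_enorm _

lemma tendsto_average (hw : LocallyIntegrable w) {σ : ℝ}
    (hσ : HasDerivAt (fun x => ∫ t in (0 : ℝ)..x, w t) (w σ) σ) :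
    Tendsto (fun k : ℕ => ((k : ℝ) + 1) * ∫ x in σ..(σ + 1 / ((k : ℝ) + 1)), w x) atTop
      (𝓝 (w σ)) := by
  have hstep : Tendsto (fun k : ℕ => 1 / ((k : ℝ) + 1)) atTop (𝓝[≠] 0) :=
    tendsto_nhdsWithin_iff.2 ⟨tendsto_one_div_add_atTop_nhds_zero_nat,
      .of_forall fun k => Nat.one_div_pos_of_nat.ne'⟩
  have hi := intervalIntegrable_of_locallyIntegrable hw
  refine (hσ.tendsto_slope_zero.comp hstep).congr fun k => ?_
  simp only [Function.comp_apply, one_div, inv_inv, smul_eq_mul,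
    intervalIntegral.integral_interval_sub_left (hi _ _) (hi _ _)]

lemma eVariationOn_le_liminf (hw : LocallyIntegrable w) :
    eVariationOn w {σ | σ ∈ Set.Ioo 0 δ ∧
        HasDerivAt (fun x => ∫ t in (0 : ℝ)..x, w t) (w σ) σ}
      ≤ liminf (quotientNorm δ w) atTop := by
  refine iSup_le ?_
  rintro ⟨N, u, hu, huL⟩
  have hlim : Tendsto (fun k : ℕ => ∑ i ∈ Finset.range N,
      edist (((k : ℝ) + 1) * ∫ x in u (i + 1)..(u (i + 1) + 1 / ((k : ℝ) + 1)), w x)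
        (((k : ℝ) + 1) * ∫ x in u i..(u i + 1 / ((k : ℝ) + 1)), w x)) atTop
      (𝓝 (∑ i ∈ Finset.range N, edist (w (u (i + 1))) (w (u i)))) :=
    tendsto_finsetSum _ fun i _ =>
      (tendsto_average hw (huL (i + 1)).2).edist (tendsto_average hw (huL i).2)
  rw [← hlim.liminf_eq]
  refine liminf_le_liminf (.of_forall fun k => ?_)
  refine (Finset.sum_le_sum fun i _ => edist_average_le hw _ _ (hu i.le_succ)).trans ?_
  rw [sum_lintegral_Ioc _ hu]
  exact lintegral_mono_set fun x hx => ⟨(huL 0).1.1.trans hx.1, hx.2.trans_lt (huL N).1.2⟩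

lemma exists_essLimit (hw : LocallyIntegrable w) (hδ : 0 < δ)
    (hV : liminf (quotientNorm δ w) atTop ≠ ∞) :
    ∃ c, Tendsto w (𝓝[>] 0 ⊓ ae volume) (𝓝 c) ∧
      ∀ᵐ τ ∂(volume.restrict (Set.Ioo 0 δ)),
        ‖w τ - c‖ₑ ≤ liminf (quotientNorm δ w) atTop := by
  set A : Set ℝ := {σ | σ ∈ Set.Ioo 0 δ ∧
    HasDerivAt (fun x => ∫ t in (0 : ℝ)..x, w t) (w σ) σ}
  have hvar : eVariationOn w A ≤ _ := eVariationOn_le_liminf hw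
  have hderiv : ∀ᵐ τ : ℝ, HasDerivAt (fun x => ∫ t in (0 : ℝ)..x, w t) (w τ) τ :=
    (LocallyIntegrable.ae_hasDerivAt_integral hw).mono fun τ hτ => hτ 0
  obtain ⟨c, hc⟩ := BoundedVariationOn.exists_tendsto_right (ne_top_of_le_ne_top hV hvar) 0
  have hA : 𝓝[>] (0 : ℝ) ⊓ ae volume ≤ 𝓝[A ∩ Set.Ioi 0] 0 :=
    le_inf (inf_le_left.trans inf_le_left) <| le_principal_iff.2 <|
      mem_inf_of_inter (Ioo_mem_nhdsGT hδ) hderiv fun x hx => ⟨⟨hx.1, hx.2⟩, hx.1.1⟩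
  refine ⟨c, hc.mono_left hA, ?_⟩
  filter_upwards [ae_restrict_of_ae hderiv, ae_restrict_mem measurableSet_Ioo] with τ hτ hτδ
  have hτA : τ ∈ A := ⟨hτδ, hτ⟩
  rw [← edist_eq_enorm_sub]
  refine le_of_tendsto (tendsto_const_nhds.edist (hc.mono_left hA)) ?_
  filter_upwards [hA self_mem_nhdsWithin] with σ hσ
  exact (eVariationOn.edist_le w hτA hσ.1).trans hvar

end Slices

/-! ### Boundary charts -/

/-- The graph of a `C¹` function `ψ` over the hyperplane orthogonal to a unit vector `e`, the
hyperplane being identified with `ℝᵐ` through the isometry `J`. -/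
structure GraphFrame (m : ℕ) where
  J : 𝔼 m →ₗᵢ[ℝ] 𝔼(m + 1)
  e : 𝔼(m + 1)
  norm_e : ‖e‖ = 1
  inner_J : ∀ w, inner ℝ (J w) e = 0
  ψ : 𝔼 m → ℝ
  contDiff_ψ : ContDiff ℝ 1 ψ

lemma exists_linearIsometry_orthogonal {m : ℕ} {e : 𝔼(m + 1)} (he : e ≠ 0) :
    ∃ J : 𝔼 m →ₗᵢ[ℝ] 𝔼(m + 1), ∀ w, inner ℝ (J w) e = 0 := by
  have : Fact (Module.finrank ℝ (𝔼(m + 1)) = m + 1) := ⟨by simp⟩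
  let b := OrthonormalBasis.fromOrthogonalSpanSingleton (𝕜 := ℝ) m he
  refine ⟨(Submodule.subtypeₗᵢ _).comp b.repr.symm.toLinearIsometry, fun w => ?_⟩
  rw [real_inner_comm]
  exact Submodule.mem_orthogonal_singleton_iff_inner_right.1 (b.repr.symm w).2

namespace GraphFrame

variable {m : ℕ} (c : GraphFrame m)

/-- The point at height `τ` above the point of the graph with base `w`. -/
noncomputable def point (w : 𝔼 m) (τ : ℝ) : 𝔼(m + 1) := c.J w + (c.ψ w + τ) • c.e

/-- The coordinate of `x` in the hyperplane orthogonal to `e`, as a point of `ℝᵐ`. -/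
noncomputable def base : 𝔼(m + 1) →L[ℝ] 𝔼 m := c.J.toContinuousLinearMap.adjoint

/-- The signed height of `x` above the graph, measured in the direction `e`. -/
noncomputable def height (x : 𝔼(m + 1)) : ℝ := inner ℝ x c.e - c.ψ (c.base x)

lemma inner_e_self : inner ℝ c.e c.e = (1 : ℝ) := by
  rw [real_inner_self_eq_norm_sq, c.norm_e, one_pow]

lemma base_J (w : 𝔼 m) : c.base (c.J w) = w := by
  refine ext_inner_right ℝ fun y => ?_
  rw [base, ContinuousLinearMap.adjoint_inner_left]
  exact c.J.inner_map_map w y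

lemma base_e : c.base c.e = 0 := by
  refine ext_inner_right ℝ fun y => ?_
  rw [base, ContinuousLinearMap.adjoint_inner_left, real_inner_comm]
  simpa using c.inner_J y

lemma norm_sq_add (w : 𝔼 m) (t : ℝ) : ‖c.J w + t • c.e‖ ^ 2 = ‖w‖ ^ 2 + t ^ 2 := by
  rw [norm_add_sq_real, inner_smul_right, c.inner_J, norm_smul, c.norm_e, c.J.norm_map]
  simp

/-- The orthogonal decomposition of `ℝᵐ⁺¹` into the hyperplane orthogonal to `e` and the line
spanned by `e`. -/
noncomputable def splitting : WithLp 2 (𝔼 m × ℝ) ≃ₗᵢ[ℝ] 𝔼(m + 1) :=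
  LinearIsometry.toLinearIsometryEquiv
    { toLinearMap := (c.J.toLinearMap.coprod (LinearMap.toSpanSingleton ℝ _ c.e)).comp
        (WithLp.linearEquiv 2 ℝ (𝔼 m × ℝ)).toLinearMap
      norm_map' := fun x => by
        rw [← sq_eq_sq₀ (norm_nonneg _) (norm_nonneg _), WithLp.prod_norm_sq_eq_of_L2]
        simpa using c.norm_sq_add x.fst x.snd }
    (by simp [(WithLp.linearEquiv 2 ℝ (𝔼 m × ℝ)).finrank_eq])

lemma splitting_toLp (w : 𝔼 m) (t : ℝ) : c.splitting (WithLp.toLp 2 (w, t)) = c.J w + t • c.e := by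
  simp [splitting]

lemma J_base_add (x : 𝔼(m + 1)) : c.J (c.base x) + inner ℝ x c.e • c.e = x := by
  obtain ⟨⟨⟨w, t⟩⟩, rfl⟩ := c.splitting.surjective x
  rw [splitting_toLp, map_add, map_smul, base_J, base_e, inner_add_left, inner_smul_left,
    c.inner_J, c.inner_e_self]
  simp

@[simp] lemma base_point (w : 𝔼 m) (τ : ℝ) : c.base (c.point w τ) = w := by
  simp [point, base_J, base_e]

@[simp] lemma height_point (w : 𝔼 m) (τ : ℝ) : c.height (c.point w τ) = τ := by
  rw [height, base_point, point, inner_add_left, inner_smul_left, c.inner_J, c.inner_e_self]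
  simp

@[simp] lemma point_base_height (x : 𝔼(m + 1)) : c.point (c.base x) (c.height x) = x := by
  rw [point, height, add_sub_cancel, c.J_base_add]

lemma point_add (w : 𝔼 m) (τ h : ℝ) : c.point w τ + h • c.e = c.point w (τ + h) := by
  rw [point, point, add_assoc, ← add_smul, add_assoc]

lemma continuous_point : Continuous fun x : 𝔼 m × ℝ => c.point x.1 x.2 := by
  have hψ : Continuous c.ψ := c.contDiff_ψ.continuous
  have hJ : Continuous c.J := c.J.continuous
  unfold point
  fun_prop

lemma contDiff_height : ContDiff ℝ 1 c.height :=
  (contDiff_id.inner ℝ contDiff_const).sub (c.contDiff_ψ.comp c.base.contDiff)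

/-- The coordinates of `ℝᵐ⁺¹` given by base and height. -/
noncomputable def homeomorph : 𝔼 m × ℝ ≃ₜ 𝔼(m + 1) where
  toFun x := c.point x.1 x.2
  invFun x := (c.base x, c.height x)
  left_inv x := by simp
  right_inv x := by simp
  continuous_toFun := c.continuous_point
  continuous_invFun := c.base.continuous.prodMk c.contDiff_height.continuous

lemma measurableEmbedding_point : MeasurableEmbedding fun x : 𝔼 m × ℝ => c.point x.1 x.2 :=
  c.homeomorph.measurableEmbedding

lemma measurePreserving_point : MeasurePreserving fun x : 𝔼 m × ℝ => c.point x.1 x.2 := by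
  have hψ : Continuous c.ψ := c.contDiff_ψ.continuous
  have hshear : MeasurePreserving fun x : 𝔼 m × ℝ => (id x.1, c.ψ x.1 + x.2) :=
    (MeasurePreserving.id volume).skew_product (Continuous.measurable (by fun_prop))
      (.of_forall fun w => (measurePreserving_add_left volume (c.ψ w)).map_eq)
  convert c.splitting.measurePreserving.comp
    ((WithLp.volume_preserving_toLp (𝔼 m) ℝ).comp hshear) using 1
  funext x
  simp [splitting_toLp, point]

lemma norm_base_le (x : 𝔼(m + 1)) : ‖c.base x‖ ≤ ‖x‖ := by
  have h := c.norm_sq_add (c.base x) (inner ℝ x c.e)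
  rw [c.J_base_add] at h
  exact le_of_sq_le_sq (h ▸ le_add_of_nonneg_right (sq_nonneg _)) (norm_nonneg _)

lemma exists_lipschitzOnWith (w : 𝔼 m) (r : ℝ) :
    ∃ L, LipschitzOnWith L c.ψ (Metric.closedBall w r) := by
  have hcont : Continuous fun x => ‖fderiv ℝ c.ψ x‖₊ :=
    (c.contDiff_ψ.continuous_fderiv one_ne_zero).nnnorm
  obtain ⟨L, hL⟩ := (isCompact_closedBall w r).bddAbove_image hcont.continuousOn
  exact ⟨L, (convex_closedBall w r).lipschitzOnWith_of_nnnorm_fderiv_le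
    (fun x _ => c.contDiff_ψ.differentiable one_ne_zero x) fun x hx => hL ⟨x, hx, rfl⟩⟩

/-- The area element `√(1 + |∇ψ|²)` of the graph. -/
noncomputable def slope (w : 𝔼 m) : ℝ := √(1 + ‖fderiv ℝ c.ψ w‖ ^ 2)

lemma one_le_slope (w : 𝔼 m) : 1 ≤ c.slope w :=
  Real.one_le_sqrt.2 (le_add_of_nonneg_right (sq_nonneg _))

lemma continuous_slope : Continuous c.slope := by
  have hcont := c.contDiff_ψ.continuous_fderiv one_ne_zero
  unfold slope
  fun_prop

lemma hasFDerivAt_height (x : 𝔼(m + 1)) :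
    HasFDerivAt c.height (innerSL ℝ c.e - (fderiv ℝ c.ψ (c.base x)).comp c.base) x := by
  refine ((innerSL ℝ c.e).hasFDerivAt.sub
    ((c.contDiff_ψ.differentiable one_ne_zero (c.base x)).hasFDerivAt.comp x
      c.base.hasFDerivAt)).congr_of_eventuallyEq (.of_forall fun y => ?_)
  simp [height, real_inner_comm]

lemma norm_fderiv_height_le (x : 𝔼(m + 1)) : ‖fderiv ℝ c.height x‖ ≤ c.slope (c.base x) := by
  rw [(c.hasFDerivAt_height x).fderiv]
  set a := fderiv ℝ c.ψ (c.base x) with ha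
  refine ContinuousLinearMap.opNorm_le_bound _ (Real.sqrt_nonneg _) fun y => ?_
  have pythagoras := c.norm_sq_add (c.base y) (inner ℝ y c.e)
  rw [c.J_base_add] at pythagoras
  have htriangle : ‖(innerSL ℝ c.e - a.comp c.base) y‖ ≤ |inner ℝ y c.e| + ‖a‖ * ‖c.base y‖ := by
    refine (norm_sub_le _ _).trans (add_le_add ?_ (a.le_opNorm _))
    change ‖inner ℝ c.e y‖ ≤ _
    rw [real_inner_comm, Real.norm_eq_abs]
  refine htriangle.trans ?_
  rw [slope, ← ha, ← Real.sqrt_sq (norm_nonneg y), ← Real.sqrt_mul (by positivity), pythagoras]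
  refine Real.le_sqrt_of_sq_le ?_
  nlinarith [sq_nonneg (‖c.base y‖ - ‖a‖ * |inner ℝ y c.e|), sq_abs (inner ℝ y c.e : ℝ)]

end GraphFrame

/-- A boundary chart of `Ω`: over a ball of radius `ρ` and up to height `2 δ`, the points of `Ω` are
those of positive height. The factor `2` leaves room for vertical translations of points at height
less than `δ`. -/
structure BoundaryChart {m : ℕ} (Ω : Set 𝔼(m + 1)) extends GraphFrame m where
  center : 𝔼 m
  ρ : ℝ
  δ : ℝ
  δ_pos : 0 < δ
  mem_iff : ∀ w ∈ Metric.ball center ρ, ∀ τ : ℝ, |τ| < 2 * δ →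
    (toGraphFrame.point w τ ∈ Ω ↔ 0 < τ)

lemma eq_zero_of_mem_frontier {X : Type*} [TopologicalSpace X] {Ω : Set X} {h : X → ℝ} {x : X}
    (hh : ContinuousAt h x) (hloc : ∀ᶠ y in 𝓝 x, y ∈ Ω ↔ 0 < h y) (hx : x ∈ frontier Ω) :
    h x = 0 := by
  rw [frontier_eq_closure_inter_closure, Set.mem_inter_iff, mem_closure_iff_frequently,
    mem_closure_iff_frequently] at hx
  refine le_antisymm (not_lt.1 fun hpos => ?_) (not_lt.1 fun hneg => ?_)
  · obtain ⟨y, hy, hyΩ, hypos⟩ := (hx.2.and_eventually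
      (hloc.and (hh.eventually_const_lt hpos))).exists
    exact hy (hyΩ.2 hypos)
  · obtain ⟨y, hy, hyΩ, hyneg⟩ := (hx.1.and_eventually
      (hloc.and (hh.eventually_lt_const hneg))).exists
    exact (hyΩ.1 hy).not_gt hyneg

namespace BoundaryChart

variable {m : ℕ} {Ω : Set 𝔼(m + 1)} (c : BoundaryChart Ω) {x : 𝔼(m + 1)}

/-- The base ball of a chart. -/
def ball : Set (𝔼 m) := Metric.ball c.center c.ρ

/-- The neighbourhood of the graph covered by a chart. -/
def domain : Set 𝔼(m + 1) := {x | c.base x ∈ c.ball ∧ |c.height x| < c.δ}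

lemma isOpen_ball : IsOpen c.ball := Metric.isOpen_ball

lemma measurableSet_ball : MeasurableSet c.ball := c.isOpen_ball.measurableSet

lemma isOpen_domain : IsOpen c.domain :=
  (c.isOpen_ball.preimage c.base.continuous).inter
    (isOpen_lt c.contDiff_height.continuous.abs continuous_const)

lemma mem_iff_height_pos (hx : c.base x ∈ c.ball) (hx' : |c.height x| < 2 * c.δ) :
    x ∈ Ω ↔ 0 < c.height x := by
  simpa using c.mem_iff _ hx _ hx'

lemma mem_iff_of_mem_domain (hx : x ∈ c.domain) : x ∈ Ω ↔ 0 < c.height x :=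
  c.mem_iff_height_pos hx.1 (by linarith [hx.2, c.δ_pos])

lemma point_mem_domain {w : 𝔼 m} (hw : w ∈ c.ball) {τ : ℝ} (hτ : |τ| < c.δ) :
    c.point w τ ∈ c.domain := by
  simpa [domain] using ⟨hw, hτ⟩

lemma mem_frontier_iff (hx : x ∈ c.domain) : x ∈ frontier Ω ↔ c.height x = 0 := by
  refine ⟨eq_zero_of_mem_frontier c.contDiff_height.continuous.continuousAt
    (eventually_of_mem (c.isOpen_domain.mem_nhds hx) fun y => c.mem_iff_of_mem_domain),
    fun h0 => ⟨?_, fun hint => ?_⟩⟩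
  · have hlim : Tendsto (fun τ : ℝ => c.point (c.base x) τ) (𝓝[>] 0) (𝓝 x) := by
      have := (c.continuous_point.comp (Continuous.prodMk_right (c.base x))).tendsto 0
      rw [Function.comp_apply, ← h0, c.point_base_height] at this
      exact h0 ▸ this.mono_left nhdsWithin_le_nhds
    refine mem_closure_of_tendsto hlim ?_
    filter_upwards [Ioo_mem_nhdsGT c.δ_pos] with τ hτ
    refine (c.mem_iff _ hx.1 τ ?_).2 hτ.1
    rw [abs_of_pos hτ.1]
    linarith [hτ.2, c.δ_pos]
  · exact ((c.mem_iff_of_mem_domain hx).1 (interior_subset hint)).ne' h0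

lemma frontier_inter_domain : frontier Ω ∩ c.domain = (fun w => c.point w 0) '' c.ball := by
  refine Set.Subset.antisymm (fun x hx => ⟨c.base x, hx.2.1, ?_⟩) ?_
  · simpa [(c.mem_frontier_iff hx.2).1 hx.1] using c.point_base_height x
  · rintro _ ⟨w, hw, rfl⟩
    have hmem : c.point w 0 ∈ c.domain := c.point_mem_domain hw (by simpa using c.δ_pos)
    exact ⟨(c.mem_frontier_iff hmem).2 (c.height_point w 0), hmem⟩

end BoundaryChart

section ExistsChart

variable {m : ℕ} {Ω : Set 𝔼(m + 1)} {x : 𝔼(m + 1)}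

lemma exists_graphFrame {e : 𝔼(m + 1)} {ψ : 𝔼(m + 1) → ℝ} (he : ‖e‖ = 1) (hψ : ContDiff ℝ 1 ψ)
    (hinv : ∀ (y : 𝔼(m + 1)) (t : ℝ), ψ (y + t • e) = ψ y) :
    ∃ c : GraphFrame m, ∀ y, c.height y = inner ℝ y e - ψ y := by
  obtain ⟨J, hJ⟩ := exists_linearIsometry_orthogonal (norm_ne_zero_iff.1 (he ▸ one_ne_zero))
  let c : GraphFrame m :=
    ⟨J, e, he, hJ, fun w => ψ (J w), hψ.comp J.toContinuousLinearMap.contDiff⟩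
  refine ⟨c, fun y => ?_⟩
  change inner ℝ y e - ψ (J (c.base y)) = _
  rw [← hinv (J (c.base y)) (inner ℝ y e)]
  congr 2
  exact c.J_base_add y

lemma GraphFrame.exists_boundaryChart (c : GraphFrame m) (hx : c.height x = 0)
    (hloc : ∀ᶠ y in 𝓝 x, y ∈ Ω ↔ 0 < c.height y) :
    ∃ c' : BoundaryChart Ω, x ∈ c'.domain := by
  have hpoint : c.point (c.base x) 0 = x := by rw [← hx, c.point_base_height]
  have htend := c.continuous_point.tendsto (c.base x, (0 : ℝ))
  rw [hpoint] at htend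
  obtain ⟨A, hA, B, hB, hAB⟩ := mem_nhds_prod_iff.1 (htend hloc)
  obtain ⟨ρ, hρ, hρA⟩ := Metric.mem_nhds_iff.1 hA
  obtain ⟨ε, hε, hεB⟩ := Metric.mem_nhds_iff.1 hB
  refine ⟨{ toGraphFrame := c, center := c.base x, ρ := ρ, δ := ε / 2,
            δ_pos := half_pos hε, mem_iff := fun w hw τ hτ => ?_ },
    Metric.mem_ball_self hρ, by simpa [hx] using hε⟩
  have hmem : (w, τ) ∈ A ×ˢ B := ⟨hρA hw, hεB (by simpa [mul_div_cancel₀] using hτ)⟩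
  simpa using hAB hmem

lemma HasC1Boundary.exists_boundaryChart (hΩ : HasC1Boundary Ω) (hx : x ∈ frontier Ω) :
    ∃ c : BoundaryChart Ω, x ∈ c.domain := by
  obtain ⟨e, ψ, r, he, hψ, hinv, hr, hmem⟩ := hΩ x hx
  obtain ⟨c, hc⟩ := exists_graphFrame he hψ hinv
  have hloc : ∀ᶠ y in 𝓝 x, y ∈ Ω ↔ 0 < c.height y :=
    eventually_of_mem (Metric.ball_mem_nhds x hr) fun y hy => by rw [hmem y hy, hc, sub_pos]
  exact c.exists_boundaryChart
    (eq_zero_of_mem_frontier c.contDiff_height.continuous.continuousAt hloc hx) hloc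

end ExistsChart

section Density

variable {m : ℕ} {Ω : Set 𝔼(m + 1)} {x : 𝔼(m + 1)}

lemma GraphFrame.height_add_smul_e (c : GraphFrame m) (x : 𝔼(m + 1)) (t : ℝ) :
    c.height (x + t • c.e) = c.height x + t := by
  simp only [height, map_add, map_smul, c.base_e, smul_zero, add_zero, inner_add_left,
    inner_smul_left, c.inner_e_self, RCLike.conj_to_real, mul_one]
  ring

lemma GraphFrame.abs_height_add_sub_le (c : GraphFrame m) {L : NNReal}
    (hL : LipschitzOnWith L c.ψ (Metric.closedBall (c.base x) 1)) {z : 𝔼(m + 1)} (hz : ‖z‖ ≤ 1) :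
    |c.height (x + z) - c.height x| ≤ (1 + L) * ‖z‖ := by
  have hψ : |c.ψ (c.base x + c.base z) - c.ψ (c.base x)| ≤ L * ‖z‖ := by
    have hdist := hL.dist_le_mul (c.base x + c.base z)
      (by simpa using (c.norm_base_le z).trans hz) (c.base x)
      (Metric.mem_closedBall_self zero_le_one)
    rw [dist_self_add_left] at hdist
    exact hdist.trans (by gcongr; exact c.norm_base_le z)
  have hinner : |inner ℝ z c.e| ≤ ‖z‖ := by
    simpa only [c.norm_e, mul_one] using abs_real_inner_le_norm z c.e
  calc |c.height (x + z) - c.height x|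
      = |inner ℝ z c.e - (c.ψ (c.base x + c.base z) - c.ψ (c.base x))| := by
        simp only [height, map_add, inner_add_left]
        ring_nf
    _ ≤ |inner ℝ z c.e| + |c.ψ (c.base x + c.base z) - c.ψ (c.base x)| := abs_sub _ _
    _ ≤ (1 + L) * ‖z‖ := by linarith

lemma BoundaryChart.exists_ball_subset (c : BoundaryChart Ω) (hxd : x ∈ c.domain)
    (hx : x ∈ frontier Ω) :
    ∃ a > 0, ∀ᶠ r in 𝓝[>] (0 : ℝ), ∃ y, Metric.ball y (a * r) ⊆ Metric.ball x r ∩ Ω := by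
  obtain ⟨L, hL⟩ := c.exists_lipschitzOnWith (c.base x) 1
  obtain ⟨R, hR, hRsub⟩ := Metric.isOpen_iff.1 c.isOpen_domain x hxd
  set a : ℝ := 1 / (4 * (1 + L)) with ha
  have haL : (1 + (L : ℝ)) * a = 1 / 4 := by rw [ha]; field_simp
  have ha0 : 0 < a := by positivity
  have ha4 : a ≤ 1 / 4 := by nlinarith [L.coe_nonneg]
  refine ⟨a, ha0, ?_⟩
  filter_upwards [Ioo_mem_nhdsGT (lt_min hR one_pos)] with r ⟨hr0, hr⟩
  obtain ⟨hrR, hr1⟩ := lt_min_iff.1 hr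
  refine ⟨x + (r / 2) • c.e, fun y hy => ?_⟩
  obtain ⟨z, rfl⟩ : ∃ z, y = x + (r / 2) • c.e + z := ⟨_, (add_sub_cancel _ _).symm⟩
  have hz : ‖z‖ < a * r := by simpa using hy
  have hyx : x + (r / 2) • c.e + z ∈ Metric.ball x r := by
    rw [add_assoc, mem_ball_iff_norm, add_sub_cancel_left]
    refine (norm_add_le _ _).trans_lt ?_
    rw [norm_smul, c.norm_e, Real.norm_of_nonneg (by positivity)]
    nlinarith
  refine ⟨hyx, (c.mem_iff_of_mem_domain (hRsub (Metric.ball_subset_ball hrR.le hyx))).2 ?_⟩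
  have hheight := c.abs_height_add_sub_le (x := x + (r / 2) • c.e) (L := L)
    (by simpa [c.base_e] using hL) (z := z) (by nlinarith)
  rw [c.height_add_smul_e, (c.mem_frontier_iff hxd).1 hx] at hheight
  have hLz : (1 + (L : ℝ)) * ‖z‖ ≤ (1 + L) * (a * r) := by gcongr
  rw [← mul_assoc, haL] at hLz
  linarith [(abs_le.1 hheight).1]

lemma BoundaryChart.exists_volume_ge (c : BoundaryChart Ω) (hxd : x ∈ c.domain)
    (hx : x ∈ frontier Ω) :
    ∃ κ > 0, ∀ᶠ r in 𝓝[>] (0 : ℝ), κ * r ^ (m + 1) ≤ volume.real (Metric.ball x r ∩ Ω) := by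
  obtain ⟨a, ha, hball⟩ := c.exists_ball_subset hxd hx
  have hpos : 0 < volume.real (Metric.ball (0 : 𝔼(m + 1)) 1) :=
    ENNReal.toReal_pos (Metric.measure_ball_pos _ _ one_pos).ne' measure_ball_lt_top.ne
  refine ⟨a ^ (m + 1) * volume.real (Metric.ball (0 : 𝔼(m + 1)) 1), by positivity, ?_⟩
  filter_upwards [hball, self_mem_nhdsWithin] with r ⟨y, hy⟩ hr
  have hr : 0 < r := hr
  have hvol : volume.real (Metric.ball y (a * r))
      = (a * r) ^ (m + 1) * volume.real (Metric.ball (0 : 𝔼(m + 1)) 1) := by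
    simp [Measure.real, Measure.addHaar_ball_of_pos _ _ (mul_pos ha hr), (mul_pos ha hr).le]
  calc _ = volume.real (Metric.ball y (a * r)) := by rw [hvol]; ring
    _ ≤ _ := measureReal_mono hy
      ((measure_mono Set.inter_subset_left).trans_lt measure_ball_lt_top).ne

end Density

/-! ### Pointwise traces -/

section TraceAt

variable {n : ℕ} {Ω : Set (𝔼 n)} {u v : 𝔼 n → ℝ} {x : 𝔼 n} {a b : ℝ}

/-- The boundary value of `v` at the point `x` is `a`. This is the pointwise condition in
`HasTrace`; it does not ask for `x ∈ frontier Ω`. -/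
def HasTraceAt (Ω : Set (𝔼 n)) (v : 𝔼 n → ℝ) (x : 𝔼 n) (a : ℝ) : Prop :=
  Tendsto (fun r : ℝ => (∫ y in Metric.ball x r ∩ Ω, |v y - a|) / r ^ n) (𝓝[>] 0) (𝓝 0)

lemma integrableOn_abs_sub_const_ball_inter (hv : IntegrableOn v Ω) (x : 𝔼 n) (r a : ℝ) :
    IntegrableOn (fun y => |v y - a|) (Metric.ball x r ∩ Ω) :=
  ((hv.mono_set Set.inter_subset_right).sub (integrableOn_const
    (hs := ((measure_mono Set.inter_subset_left).trans_lt measure_ball_lt_top).ne))).abs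

lemma HasTraceAt.congr (h : HasTraceAt Ω u x a) (huv : u =ᵐ[volume.restrict Ω] v) :
    HasTraceAt Ω v x a := by
  refine Tendsto.congr (fun r => ?_) h
  congr 1
  refine integral_congr_ae ?_
  filter_upwards [ae_restrict_of_ae_restrict_of_subset
    (Set.inter_subset_right (s := Metric.ball x r)) huv] with y hy
  rw [hy]

lemma HasTraceAt.add_const_mul (hu : IntegrableOn u Ω) (hv : IntegrableOn v Ω)
    (ha : HasTraceAt Ω u x a) (hb : HasTraceAt Ω v x b) (t : ℝ) :
    HasTraceAt Ω (fun y => u y + t * v y) x (a + t * b) := by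
  have hlim := ha.add (hb.const_mul |t|)
  rw [mul_zero, add_zero] at hlim
  refine squeeze_zero' ?_ ?_ hlim
  all_goals filter_upwards [self_mem_nhdsWithin] with r hr
  all_goals have hr : 0 < r := hr
  · positivity
  have hiu := integrableOn_abs_sub_const_ball_inter hu x r a
  have hiv := (integrableOn_abs_sub_const_ball_inter hv x r b).const_mul |t|
  rw [← mul_div_assoc, ← add_div, ← integral_const_mul, ← integral_add hiu hiv]
  refine div_le_div_of_nonneg_right (integral_mono (integrableOn_abs_sub_const_ball_inter
    (hu.add (hv.const_mul t)) x r _) (hiu.add hiv) fun y => ?_) (by positivity)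
  calc |u y + t * v y - (a + t * b)| = |(u y - a) + t * (v y - b)| := by ring_nf
    _ ≤ |u y - a| + |t * (v y - b)| := abs_add_le _ _
    _ = |u y - a| + |t| * |v y - b| := by rw [abs_mul]

lemma HasTraceAt.mul_of_notMem_tsupport {η : 𝔼 n → ℝ} (hx : x ∉ tsupport η) (v : 𝔼 n → ℝ) :
    HasTraceAt Ω (fun y => η y * v y) x 0 := by
  obtain ⟨R, hR, hsub⟩ := Metric.isOpen_iff.1 (isClosed_tsupport η).isOpen_compl x hx
  refine tendsto_const_nhds.congr' ?_
  filter_upwards [Ioo_mem_nhdsGT hR] with r hr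
  have hball : ∀ᵐ y ∂volume.restrict (Metric.ball x r ∩ Ω), y ∈ Metric.ball x r :=
    ae_restrict_of_ae_restrict_of_subset Set.inter_subset_left
      (ae_restrict_mem Metric.isOpen_ball.measurableSet)
  rw [integral_eq_zero_of_ae, zero_div]
  filter_upwards [hball] with y hy
  have hηy : η y = 0 :=
    image_eq_zero_of_notMem_tsupport (hsub (Metric.ball_subset_ball hr.2.le hy))
  simp [hηy]

lemma ae_surfaceMeasure_mem_frontier (Ω : Set (𝔼 n)) : ∀ᵐ x ∂surfaceMeasure Ω, x ∈ frontier Ω :=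
  ae_restrict_mem isClosed_frontier.measurableSet

lemma HasTrace.congr {T : 𝔼 n → ℝ} (h : HasTrace Ω u T) (huv : u =ᵐ[volume.restrict Ω] v) :
    HasTrace Ω v T :=
  ⟨h.1, h.2.mono fun _ hx => HasTraceAt.congr hx huv⟩

lemma HasTrace.add_const_mul {S T : 𝔼 n → ℝ} (hu : IntegrableOn u Ω) (hv : IntegrableOn v Ω)
    (hS : HasTrace Ω u S) (hT : HasTrace Ω v T) (t : ℝ) :
    HasTrace Ω (fun y => u y + t * v y) (fun y => S y + t * T y) := by
  refine ⟨hS.1.add (hT.1.const_mul t), ?_⟩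
  filter_upwards [hS.2, hT.2] with x hSx hTx
  exact HasTraceAt.add_const_mul hu hv hSx hTx t

lemma VanishesOnBoundary.add_const_mul (hu : IntegrableOn u Ω) (hv : IntegrableOn v Ω)
    (hu₀ : VanishesOnBoundary Ω u) (hv₀ : VanishesOnBoundary Ω v) (t : ℝ) :
    VanishesOnBoundary Ω (fun y => u y + t * v y) := by
  simpa [VanishesOnBoundary] using HasTrace.add_const_mul hu hv hu₀ hv₀ t

lemma IsTest.vanishesOnBoundary_mul (hΩ : IsOpen Ω) {η : 𝔼 n → ℝ} (hη : IsTest Ω η)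
    (v : 𝔼 n → ℝ) : VanishesOnBoundary Ω (fun y => η y * v y) := by
  refine ⟨integrable_zero _ _ _, ?_⟩
  filter_upwards [ae_surfaceMeasure_mem_frontier Ω] with x hx
  rw [hΩ.frontier_eq] at hx
  exact HasTraceAt.mul_of_notMem_tsupport (fun hxη => hx.2 (hη.2.2 hxη)) v

end TraceAt

section Uniqueness

variable {m : ℕ} {Ω : Set 𝔼(m + 1)} {v : 𝔼(m + 1) → ℝ}

lemma HasTraceAt.unique (hΩ : HasC1Boundary Ω) (hv : IntegrableOn v Ω) {x : 𝔼(m + 1)}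
    (hx : x ∈ frontier Ω) {a b : ℝ} (ha : HasTraceAt Ω v x a) (hb : HasTraceAt Ω v x b) :
    a = b := by
  obtain ⟨c, hc⟩ := hΩ.exists_boundaryChart hx
  obtain ⟨κ, hκ, hvol⟩ := c.exists_volume_ge hc hx
  have hsum := ha.add hb
  rw [add_zero] at hsum
  have hle : κ * |a - b| ≤ 0 := by
    refine ge_of_tendsto hsum ?_
    filter_upwards [hvol, self_mem_nhdsWithin] with r hr hr₀
    have hr₀ : 0 < r := hr₀
    have hia := integrableOn_abs_sub_const_ball_inter hv x r a
    have hib := integrableOn_abs_sub_const_ball_inter hv x r b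
    rw [← add_div, ← integral_add hia hib, le_div_iff₀ (by positivity)]
    calc κ * |a - b| * r ^ (m + 1) = (κ * r ^ (m + 1)) * |a - b| := by ring
      _ ≤ volume.real (Metric.ball x r ∩ Ω) * |a - b| := by gcongr
      _ = ∫ _ in Metric.ball x r ∩ Ω, |a - b| := by simp
      _ ≤ _ := integral_mono (integrableOn_const
          (hs := ((measure_mono Set.inter_subset_left).trans_lt measure_ball_lt_top).ne))
          (hia.add hib) fun y =>
          (abs_sub_le a (v y) b).trans_eq (by rw [abs_sub_comm a]; rfl)
  exact sub_eq_zero.1 (abs_eq_zero.1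
    ((nonpos_of_mul_nonpos_right hle hκ).antisymm (abs_nonneg _)))

lemma HasTrace.ae_eq (hΩ : HasC1Boundary Ω) (hv : IntegrableOn v Ω) {S T : 𝔼(m + 1) → ℝ}
    (hS : HasTrace Ω v S) (hT : HasTrace Ω v T) : S =ᵐ[surfaceMeasure Ω] T := by
  filter_upwards [hS.2, hT.2, ae_surfaceMeasure_mem_frontier Ω] with x hSx hTx hx
  exact HasTraceAt.unique hΩ hv hx hSx hTx

end Uniqueness

/-! ### Surface measure on graphs -/

section Hausdorff

open Measure

lemma euclideanHausdorffMeasure_image_le {X Y : Type*} [MetricSpace X] [MetricSpace Y]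
    [MeasurableSpace X] [BorelSpace X] [MeasurableSpace Y] [BorelSpace Y] {K : NNReal} {f : X → Y}
    {s : Set X} (h : LipschitzOnWith K f s) (d : ℕ) :
    euclideanHausdorffMeasure d (f '' s) ≤ (K : ℝ≥0∞) ^ d * euclideanHausdorffMeasure d s := by
  have hle := h.hausdorffMeasure_image_le (d := d) (by positivity)
  rw [ENNReal.rpow_natCast] at hle
  simp only [euclideanHausdorffMeasure_def, Measure.smul_apply]
  rw [mul_smul_comm]
  gcongr

lemma measure_le_of_forall_nhds {X : Type*} [TopologicalSpace X] [SecondCountableTopology X]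
    [MeasurableSpace X] [OpensMeasurableSpace X] {μ ν : Measure X}
    (h : ∀ x, ∃ U ∈ 𝓝 x, ∀ A ⊆ U, MeasurableSet A → μ A ≤ ν A) : μ ≤ ν := by
  choose U hU hle using h
  obtain ⟨s, hs, hcov⟩ := TopologicalSpace.countable_cover_nhds
    (fun x => interior_mem_nhds.2 (hU x))
  rcases s.eq_empty_or_nonempty with rfl | hne
  · have : IsEmpty X := Set.univ_eq_empty_iff.1 (by simpa using hcov.symm)
    rw [μ.eq_zero_of_isEmpty]
    exact Measure.zero_le ν
  obtain ⟨g, rfl⟩ := hs.exists_eq_range hne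
  rw [Set.biUnion_range] at hcov
  set D := disjointed fun k => interior (U (g k))
  have hD : ∀ k, MeasurableSet (D k) := fun k =>
    MeasurableSet.disjointed (fun i => isOpen_interior.measurableSet) k
  refine Measure.le_iff.2 fun A hA => ?_
  have hAD : A = ⋃ k, A ∩ D k := by
    rw [← Set.inter_iUnion, iUnion_disjointed, hcov, Set.inter_univ]
  have hdis : Pairwise (Function.onFun Disjoint fun k => A ∩ D k) := fun i j hij =>
    (disjoint_disjointed _ hij).mono Set.inter_subset_right Set.inter_subset_right
  rw [hAD, measure_iUnion hdis fun k => hA.inter (hD k),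
    measure_iUnion hdis fun k => hA.inter (hD k)]
  exact ENNReal.tsum_le_tsum fun k => hle (g k) _
    (Set.inter_subset_right.trans ((disjointed_subset _ k).trans interior_subset))
    (hA.inter (hD k))

section AreaInequality

variable {m : ℕ} {V : Type*} [NormedAddCommGroup V] [InnerProductSpace ℝ V]

lemma exists_linearIsometry_range_eq {T : 𝔼 m →L[ℝ] V} (hT : Function.Injective T) :
    ∃ J : 𝔼 m →ₗᵢ[ℝ] V, J.toLinearMap.range = T.toLinearMap.range := by
  have hrank : Module.finrank ℝ T.toLinearMap.range = m := by
    rw [LinearMap.finrank_range_of_inj hT, finrank_euclideanSpace_fin]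
  refine ⟨(Submodule.subtypeₗᵢ _).comp
    ((stdOrthonormalBasis ℝ T.toLinearMap.range).reindex
      (finCongr hrank)).repr.symm.toLinearIsometry, ?_⟩
  ext x
  constructor
  · rintro ⟨w, rfl⟩
    exact Subtype.coe_prop _
  · intro hx
    exact ⟨((stdOrthonormalBasis ℝ T.toLinearMap.range).reindex (finCongr hrank)).repr ⟨x, hx⟩,
      by simp⟩

lemma exists_contraction_abs_det_comp_eq_normDet [CompleteSpace V] {T : 𝔼 m →L[ℝ] V}
    (hT : Function.Injective T) :
    ∃ P : V →L[ℝ] 𝔼 m, ‖P‖ ≤ 1 ∧ |(P ∘L T).det| = T.toLinearMap.normDet := by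
  obtain ⟨J, hJ⟩ := exists_linearIsometry_range_eq hT
  refine ⟨J.toContinuousLinearMap.adjoint, ?_, ?_⟩
  · rw [LinearIsometryEquiv.norm_map]
    exact J.norm_toContinuousLinearMap_le
  · have hfactor : J.toLinearMap ∘ₗ (J.toContinuousLinearMap.adjoint ∘L T).toLinearMap
        = T.toLinearMap := by
      ext1 w
      obtain ⟨w', hw'⟩ : T w ∈ J.toLinearMap.range := hJ ▸ ⟨w, rfl⟩
      have hadj : J.toContinuousLinearMap.adjoint (J w') = w' :=
        DFunLike.congr_fun J.adjoint_comp_self w'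
      have hw' : J w' = T w := hw'
      simp [← hw', hadj]
    rw [← hfactor, LinearMap.normDet_comp_of_finrank_eq _ _ rfl, J.normDet_eq_one, one_mul,
      LinearMap.normDet_eq_abs_det]

lemma exists_nhds_mul_volume_le_image [CompleteSpace V] [MeasurableSpace V] [BorelSpace V]
    {g : 𝔼 m → V} {T : 𝔼 m →L[ℝ] V} {w : 𝔼 m} (hg : HasStrictFDerivAt g T w) {k : NNReal}
    (hk : k < T.toLinearMap.normDet) :
    ∃ U ∈ 𝓝 w, ∀ A ⊆ U, k * volume A ≤ euclideanHausdorffMeasure m (g '' A) := by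
  have hnormDet : T.toLinearMap.normDet ≠ 0 := (k.coe_nonneg.trans_lt hk).ne'
  obtain ⟨P, hP, hdet⟩ := exists_contraction_abs_det_comp_eq_normDet
    (((LinearMap.normDet_ne_zero_tfae T.toLinearMap).out 0 4).1 hnormDet)
  have hkdet : (k : ℝ≥0∞) < ENNReal.ofReal |(P ∘L T).det| := by
    rw [hdet, ← ENNReal.ofReal_coe_nnreal, ENNReal.ofReal_lt_ofReal_iff']
    exact ⟨hk, k.coe_nonneg.trans_lt hk⟩
  obtain ⟨d, hd, hd₀⟩ := ((mul_le_addHaar_image_of_lt_det volume _ hkdet).and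
    self_mem_nhdsWithin).exists
  obtain ⟨U, hU, happrox⟩ :=
    (P.hasStrictFDerivAt.comp w hg).approximates_deriv_on_nhds (c := d) (Or.inr hd₀)
  refine ⟨U, hU, fun A hA => (hd A _ (happrox.mono_set hA)).trans ?_⟩
  have hlip : LipschitzOnWith 1 P (g '' A) := (P.lipschitz.weaken hP).lipschitzOnWith
  simpa [← Set.image_image, EuclideanSpace.euclideanHausdorffMeasure_eq_volume]
    using euclideanHausdorffMeasure_image_le hlip m

end AreaInequality

namespace GraphFrame

variable {m : ℕ} (c : GraphFrame m)

lemma lipschitzOnWith_point {L : NNReal} {s : Set (𝔼 m)} (h : LipschitzOnWith L c.ψ s) :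
    LipschitzOnWith (1 + L) (fun w => c.point w 0) s := by
  refine LipschitzOnWith.of_dist_le_mul fun x hx y hy => ?_
  have hψ := h.dist_le_mul x hx y hy
  have hsub : c.point x 0 - c.point y 0 = c.J (x - y) + (c.ψ x - c.ψ y) • c.e := by
    simp only [point, add_zero, map_sub, sub_smul]; abel
  rw [dist_eq_norm, hsub]
  refine (norm_add_le _ _).trans ?_
  rw [c.J.norm_map, norm_smul, c.norm_e, mul_one, ← dist_eq_norm, ← dist_eq_norm]
  push_cast
  linarith

lemma exists_map_base_le (w : 𝔼 m) (r : ℝ) :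
    ∃ C : ℝ≥0∞, C ≠ ∞ ∧
      ((euclideanHausdorffMeasure m).restrict
        ((fun w => c.point w 0) '' Metric.ball w r)).map c.base
        ≤ C • volume.restrict (Metric.ball w r) := by
  obtain ⟨L, hL⟩ := c.exists_lipschitzOnWith w r
  refine ⟨((1 + L : NNReal) : ℝ≥0∞) ^ m, by simp, Measure.le_iff.2 fun A hA => ?_⟩
  have hbase : Measurable c.base := c.base.continuous.measurable
  have hset : c.base ⁻¹' A ∩ (fun w => c.point w 0) '' Metric.ball w r
      = (fun w => c.point w 0) '' (A ∩ Metric.ball w r) := by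
    rw [Set.inter_comm, ← Set.image_inter_preimage, Set.inter_comm]
    simp [← Set.preimage_comp, Function.comp_def]
  rw [Measure.map_apply hbase hA, Measure.restrict_apply (hbase hA), Measure.smul_apply,
    Measure.restrict_apply hA, smul_eq_mul, hset,
    ← EuclideanSpace.euclideanHausdorffMeasure_eq_volume]
  exact euclideanHausdorffMeasure_image_le (c.lipschitzOnWith_point
    (hL.mono (Set.inter_subset_right.trans Metric.ball_subset_closedBall))) m

/-- The derivative at `w` of the parametrization of the graph. -/
noncomputable def tangent (w : 𝔼 m) : 𝔼 m →L[ℝ] 𝔼(m + 1) :=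
  c.J.toContinuousLinearMap + (fderiv ℝ c.ψ w).smulRight c.e

lemma hasStrictFDerivAt_point (w : 𝔼 m) :
    HasStrictFDerivAt (fun w => c.point w 0) (c.tangent w) w := by
  have hψ := (c.contDiff_ψ.contDiffAt (x := w)).hasStrictFDerivAt one_ne_zero
  refine ((c.J.toContinuousLinearMap.hasStrictFDerivAt (x := w)).add
    (hψ.smul_const c.e)).congr_of_eventuallyEq (Eventually.of_forall fun w => ?_)
  simp [point]

lemma adjoint_tangent_comp_tangent (w : 𝔼 m) :
    (c.tangent w).toLinearMap.adjoint ∘ₗ (c.tangent w).toLinearMap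
      = LinearMap.transvection (fderiv ℝ c.ψ w).toLinearMap
        ((InnerProductSpace.toDual ℝ (𝔼 m)).symm (fderiv ℝ c.ψ w)) := by
  ext1 y
  refine ext_inner_right ℝ fun z => ?_
  simp [LinearMap.adjoint_inner_left, LinearMap.transvection.apply, tangent, inner_add_left,
    inner_smul_left, inner_smul_right, c.inner_J, real_inner_comm _ c.e, c.norm_e]

lemma normDet_tangent (w : 𝔼 m) : (c.tangent w).toLinearMap.normDet = c.slope w := by
  obtain ⟨a, ha⟩ := (InnerProductSpace.toDual ℝ (𝔼 m)).surjective (fderiv ℝ c.ψ w)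
  have hsq := LinearMap.normDet_sq (c.tangent w).toLinearMap
  rw [c.adjoint_tangent_comp_tangent, LinearMap.transvection.det, ← ha] at hsq
  refine (sq_eq_sq₀ (LinearMap.normDet_nonneg _) (Real.sqrt_nonneg _)).1 (hsq.trans ?_)
  rw [Real.sq_sqrt (by positivity), ← ha, LinearIsometryEquiv.norm_map]
  simp

lemma measurableEmbedding_graph : MeasurableEmbedding fun w => c.point w 0 :=
  (c.continuous_point.comp (Continuous.prodMk_left 0)).measurableEmbedding fun w w' h => by
    simpa using congrArg c.base h

lemma exists_nhds_withDensity_slope_le (w₀ : 𝔼 m) {ε : ℝ} (hε : 0 < ε) :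
    ∃ U ∈ 𝓝 w₀, ∀ A ⊆ U, MeasurableSet A →
      (volume.withDensity fun w => ENNReal.ofReal (c.slope w)) A
        ≤ (ENNReal.ofReal (1 + ε) •
            (euclideanHausdorffMeasure m).comap fun w => c.point w 0) A := by
  have hslope : 0 < c.slope w₀ := zero_lt_one.trans_le (c.one_le_slope w₀)
  obtain ⟨k, hk, hkslope⟩ : ∃ k : NNReal, c.slope w₀ < (1 + ε) * k ∧ k < c.slope w₀ := by
    obtain ⟨k, hk, hkslope⟩ := exists_between (div_lt_self hslope (lt_add_of_pos_right 1 hε))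
    lift k to NNReal using (by positivity : 0 ≤ c.slope w₀ / (1 + ε)).trans hk.le
    exact ⟨k, (div_lt_iff₀' (by positivity)).1 hk, hkslope⟩
  obtain ⟨V, hV, hle⟩ := exists_nhds_mul_volume_le_image (c.hasStrictFDerivAt_point w₀)
    (hkslope.trans_eq (c.normDet_tangent w₀).symm)
  refine ⟨V ∩ {w | c.slope w < (1 + ε) * k}, inter_mem hV
    ((isOpen_lt c.continuous_slope continuous_const).mem_nhds hk), fun A hA hAm => ?_⟩
  rw [withDensity_apply _ hAm, Measure.smul_apply, smul_eq_mul,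
    c.measurableEmbedding_graph.comap_apply]
  calc ∫⁻ w in A, ENNReal.ofReal (c.slope w)
      ≤ ∫⁻ _ in A, ENNReal.ofReal (1 + ε) * k := by
        refine setLIntegral_mono measurable_const fun w hw => ?_
        rw [← ENNReal.ofReal_coe_nnreal, ← ENNReal.ofReal_mul (by positivity)]
        exact ENNReal.ofReal_le_ofReal (hA hw).2.le
    _ = ENNReal.ofReal (1 + ε) * (k * volume A) := by rw [setLIntegral_const, mul_assoc]
    _ ≤ _ := by gcongr; exact hle A (hA.trans Set.inter_subset_left)

lemma withDensity_slope_le :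
    (volume.withDensity fun w => ENNReal.ofReal (c.slope w))
      ≤ (euclideanHausdorffMeasure m).comap fun w => c.point w 0 := by
  refine Measure.le_iff.2 fun A _ => ?_
  have hlim : Tendsto (fun ε : ℝ => ENNReal.ofReal (1 + ε) *
      ((euclideanHausdorffMeasure m).comap fun w => c.point w 0) A) (𝓝[>] 0)
      (𝓝 (1 * ((euclideanHausdorffMeasure m).comap fun w => c.point w 0) A)) := by
    refine ENNReal.Tendsto.mul_const ?_ (Or.inl one_ne_zero)
    have hcont : Continuous fun ε : ℝ => ENNReal.ofReal (1 + ε) :=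
      ENNReal.continuous_ofReal.comp (by fun_prop)
    simpa using hcont.continuousWithinAt.tendsto (x := (0 : ℝ)) (s := Set.Ioi 0)
  rw [one_mul] at hlim
  refine ge_of_tendsto hlim (eventually_nhdsWithin_of_forall fun ε hε => ?_)
  exact measure_le_of_forall_nhds (fun w => c.exists_nhds_withDensity_slope_le w hε) A

lemma setLIntegral_slope_le (B : Set (𝔼 m)) (g : 𝔼(m + 1) → ℝ≥0∞) :
    ∫⁻ w in B, g (c.point w 0) ∂(volume.withDensity fun w => ENNReal.ofReal (c.slope w))
      ≤ ∫⁻ x in (fun w => c.point w 0) '' B, g x ∂(euclideanHausdorffMeasure m) := by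
  have hemb := c.measurableEmbedding_graph
  calc _ ≤ ∫⁻ w in B, g (c.point w 0) ∂((euclideanHausdorffMeasure m).comap fun w => c.point w 0) :=
        lintegral_mono' (Measure.restrict_mono le_rfl c.withDensity_slope_le) le_rfl
    _ = ∫⁻ x in (fun w => c.point w 0) '' B, g x ∂(((euclideanHausdorffMeasure m).comap
          fun w => c.point w 0).map fun w => c.point w 0) := by
        rw [hemb.restrict_map, hemb.lintegral_map, Set.preimage_image_eq _ hemb.injective]
    _ ≤ _ := by
        rw [hemb.map_comap]
        exact lintegral_mono' (Measure.restrict_mono le_rfl Measure.restrict_le_self) le_rfl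

end GraphFrame

end Hausdorff

/-! ### Traces along the fibres of a chart -/

section Means

variable {w : ℝ → ℝ} {a : ℝ}

lemma eventually_ae_Ioo {P : ℝ → Prop} (h : ∀ᶠ τ in 𝓝[>] (0 : ℝ) ⊓ ae volume, P τ) :
    ∃ η > 0, ∀ᵐ τ ∂(volume.restrict (Set.Ioo 0 η)), P τ := by
  obtain ⟨A, hA, B, hB, hAB⟩ := mem_inf_iff_superset.1 h
  obtain ⟨η, hη, hsub⟩ := mem_nhdsGT_iff_exists_Ioo_subset.1 hA
  refine ⟨η, hη, ?_⟩
  filter_upwards [ae_restrict_of_ae (show ∀ᵐ τ, τ ∈ B from hB), ae_restrict_mem measurableSet_Ioo]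
    with τ hτB hτ
  exact hAB ⟨hsub hτ, hτB⟩

/-- The mean of `|w - a|` over the interval `(0, 1 / (j + 1))`. -/
noncomputable def meanDeviation (w : ℝ → ℝ) (a : ℝ) (j : ℕ) : ℝ≥0∞ :=
  ENNReal.ofReal ((j : ℝ) + 1) * ∫⁻ τ in Set.Ioo 0 (1 / ((j : ℝ) + 1)), ‖w τ - a‖ₑ

lemma meanDeviation_le_of_ae {η : ℝ} {C : ℝ≥0∞}
    (h : ∀ᵐ τ ∂(volume.restrict (Set.Ioo 0 η)), ‖w τ - a‖ₑ ≤ C) {j : ℕ}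
    (hj : 1 / ((j : ℝ) + 1) ≤ η) : meanDeviation w a j ≤ C := by
  have hj0 : (0 : ℝ) < (j : ℝ) + 1 := by positivity
  calc meanDeviation w a j
      ≤ ENNReal.ofReal ((j : ℝ) + 1) * ∫⁻ _ in Set.Ioo (0 : ℝ) (1 / ((j : ℝ) + 1)), C := by
        unfold meanDeviation
        gcongr 1
        exact lintegral_mono_ae
          (ae_restrict_of_ae_restrict_of_subset (Set.Ioo_subset_Ioo_right hj) h)
    _ = ENNReal.ofReal (((j : ℝ) + 1) * (1 / ((j : ℝ) + 1))) * C := by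
        rw [setLIntegral_const, Real.volume_Ioo, sub_zero, ENNReal.ofReal_mul hj0.le]
        ring
    _ = C := by rw [mul_one_div_cancel hj0.ne', ENNReal.ofReal_one, one_mul]

lemma tendsto_meanDeviation (h : Tendsto w (𝓝[>] 0 ⊓ ae volume) (𝓝 a)) :
    Tendsto (meanDeviation w a) atTop (𝓝 0) := by
  refine ENNReal.tendsto_nhds_zero.2 fun ε hε => ?_
  obtain ⟨η, hη, hae⟩ := eventually_ae_Ioo
    (ENNReal.tendsto_nhds_zero.1 (tendsto_iff_edist_tendsto_0.1 h) ε hε)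
  simp only [edist_eq_enorm_sub] at hae
  filter_upwards [tendsto_one_div_add_atTop_nhds_zero_nat.eventually_lt_const hη] with j hj
  exact meanDeviation_le_of_ae hae hj.le

lemma tendsto_mean (hw : LocallyIntegrable w) (h : Tendsto w (𝓝[>] 0 ⊓ ae volume) (𝓝 a)) :
    Tendsto (fun j : ℕ => ((j : ℝ) + 1) * ∫ τ in Set.Ioo 0 (1 / ((j : ℝ) + 1)), w τ) atTop
      (𝓝 a) := by
  refine tendsto_iff_edist_tendsto_0.2 <| tendsto_of_tendsto_of_tendsto_of_le_of_le
    tendsto_const_nhds (tendsto_meanDeviation h) (fun _ => zero_le) fun j => ?_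
  have hj0 : (0 : ℝ) < (j : ℝ) + 1 := by positivity
  have hwj : IntegrableOn w (Set.Ioo 0 (1 / ((j : ℝ) + 1))) :=
    (hw.integrableOn_isCompact isCompact_Icc).mono_set Set.Ioo_subset_Icc_self
  have hsub : ((j : ℝ) + 1) * (∫ τ in Set.Ioo 0 (1 / ((j : ℝ) + 1)), w τ) - a
      = ((j : ℝ) + 1) * ∫ τ in Set.Ioo 0 (1 / ((j : ℝ) + 1)), (w τ - a) := by
    rw [integral_sub hwj (integrableOn_const (hs := by simp)), setIntegral_const,
      Real.volume_real_Ioo_of_le (by positivity), sub_zero, smul_eq_mul, mul_sub, ← mul_assoc,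
      mul_one_div_cancel hj0.ne', one_mul]
  simp only [edist_eq_enorm_sub, hsub, enorm_mul, meanDeviation, Real.enorm_of_nonneg hj0.le]
  gcongr
  exact enorm_integral_le_lintegral_enorm _

/-- The supremum of the mean deviations over the intervals `(0, 1 / (j + 1))` with `k ≤ j`. -/
noncomputable def supDeviation (w : ℝ → ℝ) (a : ℝ) (k : ℕ) : ℝ≥0∞ :=
  ⨆ (j : ℕ) (_ : k ≤ j), meanDeviation w a j

lemma tendsto_supDeviation (h : Tendsto w (𝓝[>] 0 ⊓ ae volume) (𝓝 a)) :
    Tendsto (supDeviation w a) atTop (𝓝 0) := by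
  refine ENNReal.tendsto_nhds_zero.2 fun ε hε => ?_
  obtain ⟨N, hN⟩ := eventually_atTop.1 (ENNReal.tendsto_nhds_zero.1 (tendsto_meanDeviation h) ε hε)
  exact eventually_atTop.2 ⟨N, fun k hk => iSup₂_le fun j hj => hN j (hk.trans hj)⟩

lemma supDeviation_le_of_ae {η : ℝ} {C : ℝ≥0∞}
    (h : ∀ᵐ τ ∂(volume.restrict (Set.Ioo 0 η)), ‖w τ - a‖ₑ ≤ C) {k : ℕ}
    (hk : 1 / ((k : ℝ) + 1) ≤ η) : supDeviation w a k ≤ C :=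
  iSup₂_le fun _ hj =>
    meanDeviation_le_of_ae h ((one_div_le_one_div_of_le (by positivity) (by gcongr)).trans hk)

lemma exists_nat_one_div_mem_Icc {s : ℝ} (hs : 0 < s) {k : ℕ} (hsk : s ≤ 1 / ((k : ℝ) + 1)) :
    ∃ j, k ≤ j ∧ 1 / ((j : ℝ) + 1) ∈ Set.Icc s (2 * s) := by
  have hk : k + 1 ≤ ⌊1 / s⌋₊ := Nat.le_floor <| by
    rw [le_div_comm₀ (by positivity) hs]
    exact_mod_cast hsk
  obtain ⟨j, hj⟩ : ∃ j, ⌊1 / s⌋₊ = j + 1 := ⟨⌊1 / s⌋₊ - 1, by omega⟩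
  have hle : (j : ℝ) + 1 ≤ 1 / s := by
    exact_mod_cast hj ▸ Nat.floor_le (one_div_nonneg.2 hs.le)
  have hlt : 1 / s < (j : ℝ) + 1 + 1 := by exact_mod_cast hj ▸ Nat.lt_floor_add_one (1 / s)
  refine ⟨j, by omega, (le_one_div (by positivity) hs).1 hle, ?_⟩
  rw [div_lt_iff₀ hs] at hlt
  rw [div_le_iff₀ (by positivity)]
  nlinarith [Nat.cast_nonneg (α := ℝ) j]

lemma lintegral_Ioo_le_supDeviation {k : ℕ} {s : ℝ} (hs : 0 < s) (hsk : s ≤ 1 / ((k : ℝ) + 1)) :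
    ∫⁻ τ in Set.Ioo 0 s, ‖w τ - a‖ₑ ≤ ENNReal.ofReal (2 * s) * supDeviation w a k := by
  obtain ⟨j, hkj, hsj, hjs⟩ := exists_nat_one_div_mem_Icc hs hsk
  have hj0 : (0 : ℝ) < (j : ℝ) + 1 := by positivity
  calc ∫⁻ τ in Set.Ioo 0 s, ‖w τ - a‖ₑ
      ≤ ∫⁻ τ in Set.Ioo 0 (1 / ((j : ℝ) + 1)), ‖w τ - a‖ₑ :=
        lintegral_mono_set (Set.Ioo_subset_Ioo_right hsj)
    _ = ENNReal.ofReal (1 / ((j : ℝ) + 1)) * meanDeviation w a j := by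
        rw [meanDeviation, ← mul_assoc, ← ENNReal.ofReal_mul (by positivity),
          one_div_mul_cancel hj0.ne', ENNReal.ofReal_one, one_mul]
    _ ≤ ENNReal.ofReal (2 * s) * supDeviation w a k := by
        gcongr
        exact le_iSup₂_of_le j hkj le_rfl

end Means

lemma GraphFrame.setLIntegral_point {m : ℕ} (c : GraphFrame m) {A : Set (𝔼 m)} {I : Set ℝ}
    {g : 𝔼(m + 1) → ℝ≥0∞} (hg : Measurable g) :
    ∫⁻ x in {x | c.base x ∈ A ∧ c.height x ∈ I}, g x
      = ∫⁻ w in A, ∫⁻ τ in I, g (c.point w τ) := by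
  have hpre : (fun x : 𝔼 m × ℝ => c.point x.1 x.2) ⁻¹'
      {x | c.base x ∈ A ∧ c.height x ∈ I} = A ×ˢ I := by
    ext ⟨w, τ⟩
    simp
  rw [← c.measurePreserving_point.setLIntegral_comp_preimage_emb c.measurableEmbedding_point,
    hpre, Measure.volume_eq_prod, ← Measure.prod_restrict]
  exact lintegral_prod (fun x : 𝔼 m × ℝ => g (c.point x.1 x.2))
    (hg.comp c.continuous_point.measurable).aemeasurable

namespace BoundaryChart

variable {m : ℕ} {Ω : Set 𝔼(m + 1)} (c : BoundaryChart Ω) {v : 𝔼(m + 1) → ℝ} {T : 𝔼 m → ℝ}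

lemma setOf_base_mem_height_mem_subset :
    {x | c.base x ∈ c.ball ∧ c.height x ∈ Set.Ioo 0 c.δ} ⊆ Ω := fun _ hx =>
  (c.mem_iff_height_pos hx.1
    (by rw [abs_of_pos hx.2.1]; linarith [hx.2.2, c.δ_pos])).2 hx.2.1

/-- An upper bound for the essential variation of `v` along the fibre over `w`, up to height `δ`. -/
noncomputable def fibreVariation (v : 𝔼(m + 1) → ℝ) (w : 𝔼 m) : ℝ≥0∞ :=
  liminf (quotientNorm c.δ fun τ => v (c.point w τ)) atTop

lemma measurable_quotientNorm (hv : Measurable v) (k : ℕ) :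
    Measurable fun w => quotientNorm c.δ (fun τ => v (c.point w τ)) k := by
  have hpoint : Measurable fun x : 𝔼 m × ℝ => v (c.point x.1 x.2) :=
    hv.comp c.continuous_point.measurable
  have hstep : Measurable fun x : 𝔼 m × ℝ => v (c.point x.1 (x.2 + 1 / ((k : ℝ) + 1))) :=
    hpoint.comp (measurable_fst.prodMk (measurable_snd.add_const _))
  exact Measurable.lintegral_prod_right' (ν := volume.restrict (Set.Ioo 0 c.δ))
    (measurable_const.mul (hstep.sub hpoint)).enorm

lemma measurable_fibreVariation (hv : Measurable v) : Measurable (c.fibreVariation v) :=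
  Measurable.liminf fun k => c.measurable_quotientNorm hv k

lemma lintegral_quotientNorm_le (hv : Measurable v) (hBV : IsBV Ω v) {k : ℕ}
    (hk : 1 / ((k : ℝ) + 1) < c.δ) :
    ∫⁻ w in c.ball, quotientNorm c.δ (fun τ => v (c.point w τ)) k
      ≤ ENNReal.ofReal (totalVariation Ω v) := by
  set h : ℝ := 1 / ((k : ℝ) + 1) with hh
  have hk0 : (0 : ℝ) < (k : ℝ) + 1 := by positivity
  have hh0 : 0 ≤ h := by positivity
  set U : Set 𝔼(m + 1) := {x | c.base x ∈ c.ball ∧ c.height x ∈ Set.Ioo 0 c.δ}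
  have hU : IsOpen U := (c.isOpen_ball.preimage c.base.continuous).inter
    (isOpen_Ioo.preimage c.contDiff_height.continuous)
  have hUΩ : ∀ x ∈ U, ∀ s ∈ Set.Icc 0 h, x + s • c.e ∈ Ω := by
    intro x hx s hs
    have hpos : 0 < c.height x + s := by linarith [hx.2.1, hs.1]
    rw [← c.point_base_height x, c.point_add]
    refine (c.mem_iff _ hx.1 _ ?_).2 hpos
    rw [abs_of_pos hpos]
    linarith [hx.2.2, hs.2]
  have hint : IntegrableOn (fun x => ((k : ℝ) + 1) * (v (x + h • c.e) - v x)) U :=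
    ((integrableOn_translate hBV.1 fun x hx => hUΩ x hx h (Set.right_mem_Icc.2 hh0)).sub
      (hBV.1.mono_set c.setOf_base_mem_height_mem_subset)).const_mul _
  have hfubini := c.setLIntegral_point (A := c.ball) (I := Set.Ioo 0 c.δ)
    (measurable_const.mul ((hv.comp (measurable_add_const (h • c.e))).sub hv)).enorm
      (g := fun x => ‖((k : ℝ) + 1) * (v (x + h • c.e) - v x)‖ₑ)
  simp only [c.point_add] at hfubini
  unfold quotientNorm
  rw [← hfubini, ← ofReal_integral_norm_eq_lintegral_enorm hint]
  simp only [norm_mul, Real.norm_eq_abs, abs_of_pos hk0, integral_const_mul]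
  refine ENNReal.ofReal_le_ofReal ?_
  calc ((k : ℝ) + 1) * ∫ x in U, |v (x + h • c.e) - v x|
      ≤ ((k : ℝ) + 1) * (totalVariation Ω v * h) := by
        gcongr
        exact hBV.setIntegral_abs_translate_sub_le hU c.norm_e.le hh0 hUΩ
    _ = totalVariation Ω v := by rw [hh]; field_simp

lemma lintegral_fibreVariation_ne_top (hv : Measurable v) (hBV : IsBV Ω v) :
    ∫⁻ w in c.ball, c.fibreVariation v w ≠ ∞ := by
  have hsmall : ∀ᶠ k : ℕ in atTop, 1 / ((k : ℝ) + 1) < c.δ :=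
    tendsto_one_div_add_atTop_nhds_zero_nat.eventually_lt_const c.δ_pos
  refine ne_top_of_le_ne_top (ENNReal.ofReal_ne_top (r := totalVariation Ω v)) ?_
  calc ∫⁻ w in c.ball, c.fibreVariation v w
      ≤ liminf (fun k => ∫⁻ w in c.ball, quotientNorm c.δ (fun τ => v (c.point w τ)) k) atTop :=
        lintegral_liminf_le fun k => c.measurable_quotientNorm hv k
    _ ≤ liminf (fun _ : ℕ => ENNReal.ofReal (totalVariation Ω v)) atTop :=
        liminf_le_liminf (hsmall.mono fun k hk => c.lintegral_quotientNorm_le hv hBV hk)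
    _ = ENNReal.ofReal (totalVariation Ω v) := liminf_const _

/-- `T` is the trace of `v` in the chart `c`, as an essential limit along the fibres. -/
structure IsFibreTrace (v : 𝔼(m + 1) → ℝ) (T : 𝔼 m → ℝ) : Prop where
  measurable : Measurable T
  integrableOn : IntegrableOn T c.ball
  tendsto : ∀ᵐ w ∂(volume.restrict c.ball),
    Tendsto (fun τ => v (c.point w τ)) (𝓝[>] 0 ⊓ ae volume) (𝓝 (T w))
  enorm_sub_le : ∀ᵐ w ∂(volume.restrict c.ball), ∀ᵐ τ ∂(volume.restrict (Set.Ioo 0 c.δ)),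
    ‖v (c.point w τ) - T w‖ₑ ≤ c.fibreVariation v w

lemma stronglyMeasurable_fibre_mean (hv : Measurable v) (j : ℕ) :
    StronglyMeasurable fun w =>
      ((j : ℝ) + 1) * ∫ τ in Set.Ioo 0 (1 / ((j : ℝ) + 1)), v (c.point w τ) :=
  (StronglyMeasurable.integral_prod_right'
    (f := fun x : 𝔼 m × ℝ => v (c.point x.1 x.2))
    (hv.comp c.continuous_point.measurable).stronglyMeasurable).const_mul _

lemma mul_enorm_trace_le {w : 𝔼 m}
    (h : ∀ᵐ τ ∂(volume.restrict (Set.Ioo 0 c.δ)),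
      ‖v (c.point w τ) - T w‖ₑ ≤ c.fibreVariation v w) :
    ENNReal.ofReal c.δ * ‖T w‖ₑ ≤ (∫⁻ τ in Set.Ioo 0 c.δ, ‖v (c.point w τ)‖ₑ)
      + c.fibreVariation v w * ENNReal.ofReal c.δ := by
  have htri : ∀ᵐ τ ∂(volume.restrict (Set.Ioo 0 c.δ)),
      ‖T w‖ₑ ≤ ‖v (c.point w τ)‖ₑ + c.fibreVariation v w := by
    filter_upwards [h] with τ hτ
    calc ‖T w‖ₑ = ‖v (c.point w τ) - (v (c.point w τ) - T w)‖ₑ := by rw [sub_sub_cancel]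
      _ ≤ ‖v (c.point w τ)‖ₑ + ‖v (c.point w τ) - T w‖ₑ := enorm_sub_le
      _ ≤ _ := by gcongr
  simpa only [lintegral_add_right _ measurable_const, setLIntegral_const, Real.volume_Ioo,
    sub_zero, mul_comm ‖T w‖ₑ] using lintegral_mono_ae htri

lemma lintegral_enorm_trace_ne_top (hv : Measurable v) (hBV : IsBV Ω v)
    (h : ∀ᵐ w ∂(volume.restrict c.ball), ∀ᵐ τ ∂(volume.restrict (Set.Ioo 0 c.δ)),
      ‖v (c.point w τ) - T w‖ₑ ≤ c.fibreVariation v w) :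
    ∫⁻ w in c.ball, ‖T w‖ₑ ≠ ∞ := by
  have hδ : ENNReal.ofReal c.δ ≠ 0 := by simpa using c.δ_pos
  have hfin : ∫⁻ w in c.ball, ENNReal.ofReal c.δ * ‖T w‖ₑ ≠ ∞ := by
    refine ne_top_of_le_ne_top ?_ (lintegral_mono_ae (h.mono fun w hw => c.mul_enorm_trace_le hw))
    rw [lintegral_add_right _ ((c.measurable_fibreVariation hv).mul_const _),
      ← c.setLIntegral_point hv.enorm, lintegral_mul_const _ (c.measurable_fibreVariation hv)]
    exact ENNReal.add_ne_top.2 ⟨(hBV.1.mono_set c.setOf_base_mem_height_mem_subset).2.ne,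
      ENNReal.mul_ne_top (c.lintegral_fibreVariation_ne_top hv hBV) ENNReal.ofReal_ne_top⟩
  rw [lintegral_const_mul' _ _ ENNReal.ofReal_ne_top] at hfin
  exact fun htop => hfin (by rw [htop, ENNReal.mul_top hδ])

lemma exists_isFibreTrace (hv : Measurable v) (hvi : Integrable v) (hBV : IsBV Ω v) :
    ∃ T, c.IsFibreTrace v T := by
  have hprod : Integrable (fun x : 𝔼 m × ℝ => v (c.point x.1 x.2)) (volume.prod volume) :=
    (c.measurePreserving_point.integrable_comp_emb c.measurableEmbedding_point).2 hvi
  have hfib : ∀ᵐ w ∂(volume.restrict c.ball), LocallyIntegrable fun τ => v (c.point w τ) :=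
    (ae_restrict_of_ae hprod.prod_right_ae).mono fun _ hw => hw.locallyIntegrable
  let T : 𝔼 m → ℝ := fun w => limUnder (𝓝[>] 0 ⊓ ae volume) fun τ => v (c.point w τ)
  have hT : ∀ᵐ w ∂(volume.restrict c.ball),
      Tendsto (fun τ => v (c.point w τ)) (𝓝[>] 0 ⊓ ae volume) (𝓝 (T w)) ∧
      ∀ᵐ τ ∂(volume.restrict (Set.Ioo 0 c.δ)),
        ‖v (c.point w τ) - T w‖ₑ ≤ c.fibreVariation v w := by
    filter_upwards [hfib, ae_lt_top (c.measurable_fibreVariation hv)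
      (c.lintegral_fibreVariation_ne_top hv hBV)] with w hw hfin
    obtain ⟨a, ha, hle⟩ := exists_essLimit hw c.δ_pos hfin.ne
    have hTa : T w = a := ha.limUnder_eq
    exact hTa ▸ ⟨ha, hle⟩
  have hTm : AEMeasurable T (volume.restrict c.ball) := by
    refine aemeasurable_of_tendsto_metrizable_ae atTop
      (fun j => (c.stronglyMeasurable_fibre_mean hv j).measurable.aemeasurable) ?_
    filter_upwards [hfib, hT] with w hw hTw using tendsto_mean hw hTw.1
  have hmk : ∀ᵐ w ∂(volume.restrict c.ball), _ := (hTm.ae_eq_mk.and hT).mono fun w hw => hw.1 ▸ hw.2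
  exact ⟨hTm.mk T, hTm.measurable_mk, ⟨hTm.measurable_mk.aestronglyMeasurable,
    (c.lintegral_enorm_trace_ne_top hv hBV (hmk.mono fun _ hw => hw.2)).lt_top⟩,
    hmk.mono fun _ hw => hw.1, hmk.mono fun _ hw => hw.2⟩

end BoundaryChart

section LebesgueDifferentiation

variable {X : Type*} [MetricSpace X] [MeasurableSpace X] [BorelSpace X]
  [SecondCountableTopology X] (μ : Measure X) [IsUnifLocDoublingMeasure μ]
  [IsLocallyFiniteMeasure μ] {B : Set X}

lemma tendsto_closedBall_filterAt_vitaliFamily (x : X) :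
    Tendsto (fun r : ℝ => Metric.closedBall x r) (𝓝[>] 0)
      ((IsUnifLocDoublingMeasure.vitaliFamily μ 1).filterAt x) :=
  IsUnifLocDoublingMeasure.tendsto_closedBall_filterAt μ (fun _ => x) id tendsto_id
    (eventually_nhdsWithin_of_forall fun r (hr : 0 < r) => by simpa using hr.le)

lemma ae_tendsto_setLIntegral_closedBall_div (hB : IsOpen B) {D : X → ℝ≥0∞} (hD : Measurable D)
    (hfin : ∫⁻ x in B, D x ∂μ ≠ ∞) :
    ∀ᵐ x ∂(μ.restrict B), Tendsto
      (fun r : ℝ => (∫⁻ y in Metric.closedBall x r, D y ∂μ) / μ (Metric.closedBall x r))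
      (𝓝[>] 0) (𝓝 (D x)) := by
  rw [← lintegral_indicator hB.measurableSet] at hfin
  have hlim := (IsUnifLocDoublingMeasure.vitaliFamily μ 1).ae_tendsto_lintegral_div
    (hD.indicator hB.measurableSet).aemeasurable hfin
  filter_upwards [ae_restrict_of_ae hlim, ae_restrict_mem hB.measurableSet] with x hlim hx
  rw [Set.indicator_of_mem hx] at hlim
  refine (hlim.comp (tendsto_closedBall_filterAt_vitaliFamily μ x)).congr' ?_
  filter_upwards [nhdsWithin_le_nhds (eventually_closedBall_subset (hB.mem_nhds hx))] with r hr
  simp only [Function.comp_apply]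
  rw [setLIntegral_congr_fun Metric.isClosed_closedBall.measurableSet
    fun y hy => Set.indicator_of_mem (hr hy) D]

lemma ae_tendsto_setLIntegral_closedBall_enorm_sub_div (hB : IsOpen B) {T : X → ℝ}
    (hT : IntegrableOn T B μ) :
    ∀ᵐ x ∂(μ.restrict B), Tendsto
      (fun r : ℝ => (∫⁻ y in Metric.closedBall x r, ‖T y - T x‖ₑ ∂μ) / μ (Metric.closedBall x r))
      (𝓝[>] 0) (𝓝 0) := by
  have hlim := (IsUnifLocDoublingMeasure.vitaliFamily μ 1).ae_tendsto_lintegral_enorm_sub_div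
    ((integrable_indicator_iff hB.measurableSet).2 hT).locallyIntegrable
  filter_upwards [ae_restrict_of_ae hlim, ae_restrict_mem hB.measurableSet] with x hlim hx
  rw [Set.indicator_of_mem hx] at hlim
  refine (hlim.comp (tendsto_closedBall_filterAt_vitaliFamily μ x)).congr' ?_
  filter_upwards [nhdsWithin_le_nhds (eventually_closedBall_subset (hB.mem_nhds hx))] with r hr
  simp only [Function.comp_apply]
  rw [setLIntegral_congr_fun Metric.isClosed_closedBall.measurableSet
    fun y hy => congrArg (‖· - T x‖ₑ) (Set.indicator_of_mem (hr hy) T)]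

end LebesgueDifferentiation

lemma hasTraceAt_of_lintegral {n : ℕ} {Ω : Set (𝔼 n)} {v : 𝔼 n → ℝ} (hv : IntegrableOn v Ω)
    {x : 𝔼 n} {a : ℝ}
    (h : Tendsto (fun r : ℝ => (∫⁻ y in Metric.ball x r ∩ Ω, ‖v y - a‖ₑ) / ENNReal.ofReal (r ^ n))
      (𝓝[>] 0) (𝓝 0)) : HasTraceAt Ω v x a := by
  refine ((ENNReal.tendsto_toReal ENNReal.zero_ne_top).comp h).congr'
    (eventually_nhdsWithin_of_forall fun r (hr : 0 < r) => ?_)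
  have hm : AEStronglyMeasurable (fun y => v y - a) (volume.restrict (Metric.ball x r ∩ Ω)) :=
    (hv.mono_set Set.inter_subset_right).1.sub aestronglyMeasurable_const
  simp only [Function.comp_apply, ENNReal.toReal_div, ← Real.norm_eq_abs]
  rw [ENNReal.toReal_ofReal (by positivity), ← integral_norm_eq_lintegral_enorm hm]

namespace BoundaryChart

variable {m : ℕ} {Ω : Set 𝔼(m + 1)} {c : BoundaryChart Ω} {v : 𝔼(m + 1) → ℝ} {T : 𝔼 m → ℝ}

lemma measurable_supDeviation (c : BoundaryChart Ω) (hv : Measurable v) (hT : Measurable T)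
    (k : ℕ) : Measurable fun w => supDeviation (fun τ => v (c.point w τ)) (T w) k := by
  have hsub : Measurable fun x : 𝔼 m × ℝ => ‖v (c.point x.1 x.2) - T x.1‖ₑ :=
    ((hv.comp c.continuous_point.measurable).sub (hT.comp measurable_fst)).enorm
  exact Measurable.iSup fun j => Measurable.iSup fun _ =>
    (Measurable.lintegral_prod_right' hsub).const_mul _

lemma exists_ball_point_inter_subset (c : BoundaryChart Ω) {w : 𝔼 m} (hw : w ∈ c.ball) :
    ∃ C > 0, ∀ᶠ r in 𝓝[>] (0 : ℝ), Metric.ball (c.point w 0) r ∩ Ω ⊆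
      {x | c.base x ∈ Metric.closedBall w r ∧ c.height x ∈ Set.Ioo 0 (C * r)} := by
  obtain ⟨L, hL⟩ := c.exists_lipschitzOnWith w 1
  have hdomain : c.point w 0 ∈ c.domain := c.point_mem_domain hw (by simpa using c.δ_pos)
  obtain ⟨R, hR, hRsub⟩ := Metric.isOpen_iff.1 c.isOpen_domain _ hdomain
  refine ⟨1 + L, by positivity, ?_⟩
  filter_upwards [Ioo_mem_nhdsGT (lt_min hR one_pos)] with r ⟨_, hr⟩
  obtain ⟨hrR, hr1⟩ := lt_min_iff.1 hr
  rintro y ⟨hy, hyΩ⟩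
  have hyd : y ∈ c.domain := hRsub (Metric.ball_subset_ball hrR.le hy)
  obtain ⟨z, rfl⟩ : ∃ z, y = c.point w 0 + z := ⟨_, (add_sub_cancel _ _).symm⟩
  have hz : ‖z‖ < r := by simpa using hy
  have hheight := (le_abs_self _).trans
    (c.abs_height_add_sub_le (x := c.point w 0) (by simpa using hL) (hz.trans hr1).le)
  rw [c.height_point, sub_zero] at hheight
  refine ⟨?_, (c.mem_iff_of_mem_domain hyd).1 hyΩ, hheight.trans_lt (by gcongr)⟩
  simpa using (c.norm_base_le z).trans hz.le

lemma lintegral_fibre_sub_le (c : BoundaryChart Ω) {w' : 𝔼 m} {a s : ℝ} (hs : 0 < s) {k : ℕ}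
    (hk : s ≤ 1 / ((k : ℝ) + 1)) :
    ∫⁻ τ in Set.Ioo 0 s, ‖v (c.point w' τ) - a‖ₑ ≤ ENNReal.ofReal s *
      (2 * supDeviation (fun τ => v (c.point w' τ)) (T w') k + ‖T w' - a‖ₑ) :=
  calc ∫⁻ τ in Set.Ioo 0 s, ‖v (c.point w' τ) - a‖ₑ
      ≤ ∫⁻ τ in Set.Ioo 0 s, (‖v (c.point w' τ) - T w'‖ₑ + ‖T w' - a‖ₑ) :=
        lintegral_mono fun τ => by
          simpa only [sub_add_sub_cancel] using enorm_add_le (v (c.point w' τ) - T w') (T w' - a)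
    _ = (∫⁻ τ in Set.Ioo 0 s, ‖v (c.point w' τ) - T w'‖ₑ)
          + ENNReal.ofReal s * ‖T w' - a‖ₑ := by
        rw [lintegral_add_right _ measurable_const, setLIntegral_const, Real.volume_Ioo, sub_zero,
          mul_comm ‖T w' - a‖ₑ]
    _ ≤ ENNReal.ofReal (2 * s) * supDeviation (fun τ => v (c.point w' τ)) (T w') k
          + ENNReal.ofReal s * ‖T w' - a‖ₑ := by
        gcongr
        exact lintegral_Ioo_le_supDeviation hs hk
    _ = _ := by
        rw [ENNReal.ofReal_mul zero_le_two, ENNReal.ofReal_ofNat]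
        ring

lemma setLIntegral_ball_le (hv : Measurable v) (hT : Measurable T) {w : 𝔼 m} {s r : ℝ}
    (hs : 0 < s) {k : ℕ} (hk : s ≤ 1 / ((k : ℝ) + 1))
    (hsub : Metric.ball (c.point w 0) r ∩ Ω ⊆
        {x | c.base x ∈ Metric.closedBall w r ∧ c.height x ∈ Set.Ioo 0 s}) :
    ∫⁻ y in Metric.ball (c.point w 0) r ∩ Ω, ‖v y - T w‖ₑ ≤
      ENNReal.ofReal s *
        (2 * (∫⁻ w' in Metric.closedBall w r, supDeviation (fun τ => v (c.point w' τ)) (T w') k) +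
          ∫⁻ w' in Metric.closedBall w r, ‖T w' - T w‖ₑ) :=
  calc ∫⁻ y in Metric.ball (c.point w 0) r ∩ Ω, ‖v y - T w‖ₑ
      ≤ ∫⁻ y in {x | c.base x ∈ Metric.closedBall w r ∧ c.height x ∈ Set.Ioo 0 s},
          ‖v y - T w‖ₑ := lintegral_mono_set hsub
    _ = ∫⁻ w' in Metric.closedBall w r, ∫⁻ τ in Set.Ioo 0 s, ‖v (c.point w' τ) - T w‖ₑ :=
        c.setLIntegral_point (hv.sub_const _).enorm
    _ ≤ ∫⁻ w' in Metric.closedBall w r, ENNReal.ofReal s *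
          (2 * supDeviation (fun τ => v (c.point w' τ)) (T w') k + ‖T w' - T w‖ₑ) :=
        lintegral_mono fun w' => c.lintegral_fibre_sub_le hs hk
    _ = _ := by
        rw [lintegral_const_mul' _ _ ENNReal.ofReal_ne_top,
          lintegral_add_right _ (hT.sub_const _).enorm, lintegral_const_mul' _ _ (by simp)]

lemma ofReal_mul_div_pow_succ {C r : ℝ} (hC : 0 ≤ C) (hr : 0 < r) (w : 𝔼 m) (Z : ℝ≥0∞) :
    ENNReal.ofReal (C * r) * Z / ENNReal.ofReal (r ^ (m + 1))
      = ENNReal.ofReal C * volume (Metric.closedBall (0 : 𝔼 m) 1)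
        * (Z / volume (Metric.closedBall w r)) := by
  have hR : ENNReal.ofReal r ≠ 0 := by simpa using hr
  have hω : volume (Metric.closedBall (0 : 𝔼 m) 1) ≠ 0 :=
    (Metric.measure_closedBall_pos _ _ one_pos).ne'
  rw [Measure.addHaar_closedBall' _ _ hr.le, finrank_euclideanSpace_fin, pow_succ,
    ENNReal.ofReal_mul hC, ENNReal.ofReal_mul (p := r ^ m) (by positivity), ← mul_div_assoc,
    mul_right_comm, mul_right_comm _ _ Z, ENNReal.mul_div_mul_right _ _ hR ENNReal.ofReal_ne_top,
    ENNReal.mul_div_mul_right _ _ hω measure_closedBall_lt_top.ne]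

lemma IsFibreTrace.hasTraceAt_point (h : c.IsFibreTrace v T) (hv : Measurable v)
    (hvΩ : IntegrableOn v Ω) {w : 𝔼 m} (hw : w ∈ c.ball)
    (hlim : Tendsto (fun τ => v (c.point w τ)) (𝓝[>] 0 ⊓ ae volume) (𝓝 (T w)))
    (hD : ∀ k : ℕ, 1 / ((k : ℝ) + 1) ≤ c.δ → Tendsto (fun r : ℝ =>
      (∫⁻ w' in Metric.closedBall w r, supDeviation (fun τ => v (c.point w' τ)) (T w') k)
        / volume (Metric.closedBall w r)) (𝓝[>] 0)
      (𝓝 (supDeviation (fun τ => v (c.point w τ)) (T w) k)))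
    (hT : Tendsto (fun r : ℝ => (∫⁻ w' in Metric.closedBall w r, ‖T w' - T w‖ₑ)
      / volume (Metric.closedBall w r)) (𝓝[>] 0) (𝓝 0)) :
    HasTraceAt Ω v (c.point w 0) (T w) := by
  obtain ⟨C, hC, hsub⟩ := c.exists_ball_point_inter_subset hw
  set κ : ℝ≥0∞ := ENNReal.ofReal C * volume (Metric.closedBall (0 : 𝔼 m) 1)
  have hκ : κ ≠ ∞ := ENNReal.mul_ne_top ENNReal.ofReal_ne_top measure_closedBall_lt_top.ne
  refine hasTraceAt_of_lintegral hvΩ (ENNReal.tendsto_nhds_zero.2 fun ε hε => ?_)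
  have hsup : Tendsto
      (fun k => κ * (2 * supDeviation (fun τ => v (c.point w τ)) (T w) k + 0)) atTop (𝓝 0) := by
    simpa using ENNReal.Tendsto.const_mul (a := κ) (((ENNReal.Tendsto.const_mul (a := 2)
      (tendsto_supDeviation hlim) (Or.inr (by simp)))).add_const 0) (Or.inr hκ)
  obtain ⟨k, hkε, hkδ⟩ := ((hsup.eventually_lt_const hε).and
    (tendsto_one_div_add_atTop_nhds_zero_nat.eventually_lt_const c.δ_pos)).exists
  have hmean := ENNReal.Tendsto.const_mul (a := κ) ((ENNReal.Tendsto.const_mul (a := 2)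
    (hD k hkδ.le) (Or.inr (by simp))).add hT) (Or.inr hκ)
  have hsmall : ∀ᶠ r in 𝓝[>] (0 : ℝ), C * r < 1 / ((k : ℝ) + 1) := by
    have hCr : Tendsto (fun r : ℝ => C * r) (𝓝[>] 0) (𝓝 0) :=
      tendsto_nhdsWithin_of_tendsto_nhds (by simpa using (continuous_const_mul C).tendsto 0)
    exact hCr.eventually_lt_const (by positivity)
  filter_upwards [hmean.eventually_lt_const hkε, hsub, hsmall, self_mem_nhdsWithin]
    with r hrε hrsub hrk (hr : 0 < r)
  calc (∫⁻ y in Metric.ball (c.point w 0) r ∩ Ω, ‖v y - T w‖ₑ) / ENNReal.ofReal (r ^ (m + 1))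
      ≤ _ := ENNReal.div_le_div_right
        (setLIntegral_ball_le hv h.measurable (mul_pos hC hr) hrk.le hrsub) _
    _ = _ := ofReal_mul_div_pow_succ hC.le hr w _
    _ ≤ ε := by
      rw [ENNReal.add_div, mul_div_assoc]
      exact hrε.le

lemma IsFibreTrace.ae_hasTraceAt (h : c.IsFibreTrace v T) (hv : Measurable v) (hBV : IsBV Ω v) :
    ∀ᵐ w ∂(volume.restrict c.ball), HasTraceAt Ω v (c.point w 0) (T w) := by
  have hD : ∀ᵐ w ∂(volume.restrict c.ball), ∀ k : ℕ, 1 / ((k : ℝ) + 1) ≤ c.δ → _ :=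
    ae_all_iff.2 fun k => eventually_imp_distrib_left.2 fun hk =>
      ae_tendsto_setLIntegral_closedBall_div volume c.isOpen_ball
        (c.measurable_supDeviation hv h.measurable k)
        (ne_top_of_le_ne_top (c.lintegral_fibreVariation_ne_top hv hBV)
          (lintegral_mono_ae (h.enorm_sub_le.mono fun w hw => supDeviation_le_of_ae hw hk)))
  filter_upwards [hD, h.tendsto, ae_restrict_mem c.measurableSet_ball,
    ae_tendsto_setLIntegral_closedBall_enorm_sub_div volume c.isOpen_ball h.integrableOn]
    with w hDw hlim hw hTw
  exact h.hasTraceAt_point hv hBV.1 hw hlim hDw hTw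

end BoundaryChart

/-! ### Cut-off functions near the boundary -/

section Profile

/-- A smooth nondecreasing profile, equal to `0` on `(-∞, 1]` and to `1` on `[2, ∞)`. -/
noncomputable def profile (t : ℝ) : ℝ := Real.smoothTransition (t - 1)

lemma contDiff_profile : ContDiff ℝ 1 profile :=
  Real.smoothTransition.contDiff.comp (contDiff_id.sub contDiff_const)

lemma profile_mem_Icc (t : ℝ) : profile t ∈ Set.Icc (0 : ℝ) 1 :=
  ⟨Real.smoothTransition.nonneg _, Real.smoothTransition.le_one _⟩

lemma profile_of_le_one {t : ℝ} (h : t ≤ 1) : profile t = 0 :=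
  Real.smoothTransition.zero_of_nonpos (by linarith)

lemma profile_of_two_le {t : ℝ} (h : 2 ≤ t) : profile t = 1 :=
  Real.smoothTransition.one_of_one_le (by linarith)

lemma monotone_profile : Monotone profile := fun _ _ h =>
  Real.smoothTransition.monotone (by linarith)

lemma deriv_profile_of_two_lt {t : ℝ} (h : 2 < t) : deriv profile t = 0 := by
  have hconst : profile =ᶠ[𝓝 t] fun _ => 1 := by
    filter_upwards [lt_mem_nhds h] with s hs using profile_of_two_le hs.le
  rw [hconst.deriv_eq, deriv_const]

/-- The derivative of the profile at scale `1 / (k + 1)`, an approximate identity. -/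
noncomputable def kernel (k : ℕ) (τ : ℝ) : ℝ := ((k : ℝ) + 1) * deriv profile (((k : ℝ) + 1) * τ)

lemma kernel_nonneg (k : ℕ) (τ : ℝ) : 0 ≤ kernel k τ :=
  mul_nonneg (by positivity) monotone_profile.deriv_nonneg

lemma kernel_of_lt {k : ℕ} {τ : ℝ} (h : 2 / ((k : ℝ) + 1) < τ) : kernel k τ = 0 := by
  rw [div_lt_iff₀ (by positivity), mul_comm] at h
  rw [kernel, deriv_profile_of_two_lt h, mul_zero]

lemma continuous_kernel (k : ℕ) : Continuous (kernel k) :=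
  continuous_const.mul
    ((contDiff_profile.continuous_deriv le_rfl).comp (continuous_const.mul continuous_id))

lemma hasDerivAt_profile_mul (k : ℕ) (τ : ℝ) :
    HasDerivAt (fun τ => profile (((k : ℝ) + 1) * τ)) (kernel k τ) τ := by
  have hlin : HasDerivAt (fun τ : ℝ => ((k : ℝ) + 1) * τ) ((k : ℝ) + 1) τ := by
    simpa using (hasDerivAt_id τ).const_mul ((k : ℝ) + 1)
  have hcomp := (contDiff_profile.differentiable one_ne_zero
    (((k : ℝ) + 1) * τ)).hasDerivAt.comp τ hlin
  rwa [mul_comm] at hcomp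

lemma lintegral_kernel_le {δ : ℝ} (hδ : 0 ≤ δ) (k : ℕ) :
    ∫⁻ τ in Set.Ioo 0 δ, ENNReal.ofReal (kernel k τ) ≤ 1 := by
  have hint : IntervalIntegrable (kernel k) volume 0 δ :=
    (continuous_kernel k).intervalIntegrable _ _
  calc ∫⁻ τ in Set.Ioo 0 δ, ENNReal.ofReal (kernel k τ)
      ≤ ∫⁻ τ in Set.Ioc 0 δ, ENNReal.ofReal (kernel k τ) :=
        lintegral_mono_set Set.Ioo_subset_Ioc_self
    _ = ENNReal.ofReal (∫ τ in (0 : ℝ)..δ, kernel k τ) := by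
        rw [intervalIntegral.integral_of_le hδ, ofReal_integral_eq_lintegral_ofReal
          ((intervalIntegrable_iff_integrableOn_Ioc_of_le hδ).1 hint)
          (Eventually.of_forall (kernel_nonneg k))]
    _ = ENNReal.ofReal (profile (((k : ℝ) + 1) * δ) - profile (((k : ℝ) + 1) * 0)) := by
        rw [intervalIntegral.integral_eq_sub_of_hasDerivAt
          (fun τ _ => hasDerivAt_profile_mul k τ) hint]
    _ ≤ 1 := ENNReal.ofReal_le_one.2 (by
        linarith [(profile_mem_Icc (((k : ℝ) + 1) * δ)).2, (profile_mem_Icc (((k : ℝ) + 1) * 0)).1])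

lemma lintegral_kernel_mul_le {δ : ℝ} (hδ : 0 ≤ δ) (k : ℕ) {g : ℝ → ℝ≥0∞} {C : ℝ≥0∞}
    (hC : C ≠ ∞)
    (h : ∀ᵐ τ ∂(volume.restrict (Set.Ioo 0 δ)), τ ≤ 2 / ((k : ℝ) + 1) → g τ ≤ C) :
    ∫⁻ τ in Set.Ioo 0 δ, ENNReal.ofReal (kernel k τ) * g τ ≤ C := by
  calc ∫⁻ τ in Set.Ioo 0 δ, ENNReal.ofReal (kernel k τ) * g τ
      ≤ ∫⁻ τ in Set.Ioo 0 δ, ENNReal.ofReal (kernel k τ) * C := by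
        refine lintegral_mono_ae (h.mono fun τ hτ => ?_)
        rcases le_or_gt τ (2 / ((k : ℝ) + 1)) with hle | hlt
        · gcongr
          exact hτ hle
        · simp [kernel_of_lt hlt]
    _ = (∫⁻ τ in Set.Ioo 0 δ, ENNReal.ofReal (kernel k τ)) * C := lintegral_mul_const' _ _ hC
    _ ≤ C := mul_le_of_le_one_left' (lintegral_kernel_le hδ k)

lemma limsup_lintegral_kernel_le {δ : ℝ} (hδ : 0 ≤ δ) {g : ℝ → ℝ≥0∞} {a : ℝ≥0∞}
    (h : Tendsto g (𝓝[>] 0 ⊓ ae volume) (𝓝 a)) :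
    limsup (fun k => ∫⁻ τ in Set.Ioo 0 δ, ENNReal.ofReal (kernel k τ) * g τ) atTop ≤ a := by
  refine ENNReal.le_of_forall_pos_le_add fun ε hε ha => ?_
  have hlt : a < a + ε := ENNReal.lt_add_right ha.ne (by simpa using hε.ne')
  obtain ⟨η, hη, hae⟩ := eventually_ae_Ioo (h.eventually_lt_const hlt)
  have hscale : Tendsto (fun k : ℕ => 2 / ((k : ℝ) + 1)) atTop (𝓝 0) := by
    simpa [div_eq_mul_inv] using tendsto_one_div_add_atTop_nhds_zero_nat.const_mul (2 : ℝ)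
  refine limsup_le_of_le (h := ?_)
  filter_upwards [hscale.eventually_lt_const hη] with k hk
  refine lintegral_kernel_mul_le hδ k (by simp [ha.ne]) ?_
  filter_upwards [ae_restrict_of_ae ((ae_restrict_iff' measurableSet_Ioo).1 hae),
    ae_restrict_mem measurableSet_Ioo] with τ hτ hτδ hle
  exact (hτ ⟨hτδ.1, hle.trans_lt hk⟩).le

end Profile

namespace BoundaryChart

variable {m : ℕ} {Ω : Set 𝔼(m + 1)} (c : BoundaryChart Ω) {v ζ : 𝔼(m + 1) → ℝ} {T : 𝔼 m → ℝ}

/-- The cut-off function which vanishes below height `1 / (k + 1)` and is `1` above height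
`2 / (k + 1)`. -/
noncomputable def heightCutoff (k : ℕ) (x : 𝔼(m + 1)) : ℝ := profile (((k : ℝ) + 1) * c.height x)

lemma contDiff_heightCutoff (k : ℕ) : ContDiff ℝ 1 (c.heightCutoff k) :=
  contDiff_profile.comp (contDiff_const.mul c.contDiff_height)

lemma norm_fderiv_heightCutoff_le (k : ℕ) (x : 𝔼(m + 1)) :
    ‖fderiv ℝ (c.heightCutoff k) x‖ ≤ kernel k (c.height x) * c.slope (c.base x) := by
  have hderiv : HasFDerivAt (c.heightCutoff k) (kernel k (c.height x) • fderiv ℝ c.height x) x :=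
    (hasDerivAt_profile_mul k (c.height x)).comp_hasFDerivAt x
      (c.contDiff_height.differentiable one_ne_zero x).hasFDerivAt
  rw [hderiv.fderiv, norm_smul, Real.norm_of_nonneg (kernel_nonneg _ _)]
  exact mul_le_mul_of_nonneg_left (c.norm_fderiv_height_le x) (kernel_nonneg _ _)

lemma tendsto_heightCutoff {x : 𝔼(m + 1)} (hx : 0 < c.height x) :
    Tendsto (fun k => c.heightCutoff k x) atTop (𝓝 1) := by
  have htop : Tendsto (fun k : ℕ => ((k : ℝ) + 1) * c.height x) atTop atTop :=
    (tendsto_atTop_add_const_right _ _ tendsto_natCast_atTop_atTop).atTop_mul_const hx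
  refine tendsto_const_nhds.congr' ?_
  filter_upwards [htop.eventually_ge_atTop 2] with k hk
  exact (profile_of_two_le hk).symm

/-- The fibre over `w` contributes at most this much to the integral of `|v| ζ ‖∇η‖`, where `η` is
the `k`-th height cut-off. -/
noncomputable def fibreFlux (v ζ : 𝔼(m + 1) → ℝ) (k : ℕ) (w : 𝔼 m) : ℝ≥0∞ :=
  ENNReal.ofReal (c.slope w) * ∫⁻ τ in Set.Ioo 0 c.δ,
    ENNReal.ofReal (kernel k τ) * (‖v (c.point w τ)‖ₑ * ENNReal.ofReal (ζ (c.point w τ)))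

lemma measurable_fibreFlux (hv : Measurable v) (hζ : Measurable ζ) (k : ℕ) :
    Measurable (c.fibreFlux v ζ k) :=
  c.continuous_slope.measurable.ennreal_ofReal.mul <| Measurable.lintegral_prod_right'
    (f := fun x : 𝔼 m × ℝ => ENNReal.ofReal (kernel k x.2) *
      (‖v (c.point x.1 x.2)‖ₑ * ENNReal.ofReal (ζ (c.point x.1 x.2)))) <|
    ((continuous_kernel k).measurable.comp measurable_snd).ennreal_ofReal.mul <|
      (hv.comp c.continuous_point.measurable).enorm.mul
        (hζ.comp c.continuous_point.measurable).ennreal_ofReal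

lemma mul_enorm_fderiv_heightCutoff_le (hζs : Function.support ζ ⊆ c.domain) (k : ℕ)
    {x : 𝔼(m + 1)} (hx : x ∈ Ω) :
    ‖v x‖ₑ * (ENNReal.ofReal (ζ x) * ‖fderiv ℝ (c.heightCutoff k) x‖ₑ)
      ≤ {x | c.base x ∈ c.ball ∧ c.height x ∈ Set.Ioo 0 c.δ}.indicator
        (fun x => ENNReal.ofReal (c.slope (c.base x)) *
          (ENNReal.ofReal (kernel k (c.height x)) * (‖v x‖ₑ * ENNReal.ofReal (ζ x)))) x := by
  by_cases hζx : ζ x = 0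
  · simp [hζx]
  have hxd : x ∈ c.domain := hζs hζx
  have hxD : x ∈ {x | c.base x ∈ c.ball ∧ c.height x ∈ Set.Ioo 0 c.δ} :=
    ⟨hxd.1, (c.mem_iff_of_mem_domain hxd).1 hx, (abs_lt.1 hxd.2).2⟩
  rw [Set.indicator_of_mem hxD]
  have hderiv : ‖fderiv ℝ (c.heightCutoff k) x‖ₑ
      ≤ ENNReal.ofReal (kernel k (c.height x)) * ENNReal.ofReal (c.slope (c.base x)) := by
    rw [← ENNReal.ofReal_mul (kernel_nonneg _ _), ← ofReal_norm]
    exact ENNReal.ofReal_le_ofReal (c.norm_fderiv_heightCutoff_le k x)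
  calc ‖v x‖ₑ * (ENNReal.ofReal (ζ x) * ‖fderiv ℝ (c.heightCutoff k) x‖ₑ)
      ≤ ‖v x‖ₑ * (ENNReal.ofReal (ζ x) *
        (ENNReal.ofReal (kernel k (c.height x)) * ENNReal.ofReal (c.slope (c.base x)))) := by gcongr
    _ = _ := by ring

lemma lintegral_heightCutoff_le (hΩ : MeasurableSet Ω) (hv : Measurable v) (hζ : Measurable ζ)
    (hζs : Function.support ζ ⊆ c.domain) (k : ℕ) :
    ∫⁻ x in Ω, ‖v x‖ₑ * (ENNReal.ofReal (ζ x) * ‖fderiv ℝ (c.heightCutoff k) x‖ₑ)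
      ≤ ∫⁻ w in c.ball, c.fibreFlux v ζ k w := by
  set D : Set 𝔼(m + 1) := {x | c.base x ∈ c.ball ∧ c.height x ∈ Set.Ioo 0 c.δ}
  have hD : MeasurableSet D := ((c.isOpen_ball.preimage c.base.continuous).inter
    (isOpen_Ioo.preimage c.contDiff_height.continuous)).measurableSet
  set g : 𝔼(m + 1) → ℝ≥0∞ := fun x => ENNReal.ofReal (c.slope (c.base x)) *
    (ENNReal.ofReal (kernel k (c.height x)) * (‖v x‖ₑ * ENNReal.ofReal (ζ x))) with hg
  have hgm : Measurable g :=
    (c.continuous_slope.comp c.base.continuous).measurable.ennreal_ofReal.mul <|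
      ((continuous_kernel k).comp c.contDiff_height.continuous).measurable.ennreal_ofReal.mul
        (hv.enorm.mul hζ.ennreal_ofReal)
  calc _ ≤ ∫⁻ x in Ω, D.indicator g x :=
        setLIntegral_mono' hΩ fun x hx => c.mul_enorm_fderiv_heightCutoff_le hζs k hx
    _ ≤ ∫⁻ x, D.indicator g x := setLIntegral_le_lintegral _ _
    _ = ∫⁻ x in D, g x := lintegral_indicator hD g
    _ = ∫⁻ w in c.ball, ∫⁻ τ in Set.Ioo 0 c.δ, g (c.point w τ) := c.setLIntegral_point hgm
    _ = ∫⁻ w in c.ball, c.fibreFlux v ζ k w := by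
        simp only [hg, c.base_point, c.height_point, fibreFlux,
          lintegral_const_mul' _ _ ENNReal.ofReal_ne_top]

variable {c}

lemma IsFibreTrace.ae_fibreFlux_le (h : c.IsFibreTrace v T) (hv : Measurable v) (hBV : IsBV Ω v)
    (hζ : ∀ x, ζ x ≤ 1) {S : ℝ} (hS : ∀ w ∈ c.ball, c.slope w ≤ S) (k : ℕ) :
    c.fibreFlux v ζ k ≤ᵐ[volume.restrict c.ball]
      fun w => ENNReal.ofReal S * (‖T w‖ₑ + c.fibreVariation v w) := by
  filter_upwards [h.enorm_sub_le, ae_lt_top (c.measurable_fibreVariation hv)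
    (c.lintegral_fibreVariation_ne_top hv hBV), ae_restrict_mem c.measurableSet_ball]
    with w hw hfin hwball
  unfold fibreFlux
  gcongr
  · exact hS w hwball
  refine lintegral_kernel_mul_le c.δ_pos.le k (by simp [hfin.ne]) (hw.mono fun τ hτ _ => ?_)
  calc ‖v (c.point w τ)‖ₑ * ENNReal.ofReal (ζ (c.point w τ))
      ≤ ‖v (c.point w τ)‖ₑ := mul_le_of_le_one_right' (ENNReal.ofReal_le_one.2 (hζ _))
    _ = ‖T w + (v (c.point w τ) - T w)‖ₑ := by rw [add_sub_cancel]
    _ ≤ ‖T w‖ₑ + ‖v (c.point w τ) - T w‖ₑ := enorm_add_le _ _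
    _ ≤ ‖T w‖ₑ + c.fibreVariation v w := by gcongr

lemma limsup_fibreFlux_le (hζ : Continuous ζ) {w : 𝔼 m}
    (hw : Tendsto (fun τ => v (c.point w τ)) (𝓝[>] 0 ⊓ ae volume) (𝓝 (T w))) :
    limsup (fun k => c.fibreFlux v ζ k w) atTop
      ≤ ENNReal.ofReal (c.slope w) * (‖T w‖ₑ * ENNReal.ofReal (ζ (c.point w 0))) := by
  unfold fibreFlux
  rw [ENNReal.limsup_const_mul_of_ne_top ENNReal.ofReal_ne_top]
  gcongr
  have hζw : Continuous fun τ => ENNReal.ofReal (ζ (c.point w τ)) :=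
    ENNReal.continuous_ofReal.comp (hζ.comp (c.continuous_point.comp (Continuous.prodMk_right w)))
  exact limsup_lintegral_kernel_le c.δ_pos.le <| ENNReal.Tendsto.mul
    (continuous_enorm.continuousAt.tendsto.comp hw) (Or.inr ENNReal.ofReal_ne_top)
    ((hζw.tendsto 0).mono_left (inf_le_left.trans nhdsWithin_le_nhds)) (Or.inr enorm_ne_top)

lemma IsFibreTrace.limsup_lintegral_heightCutoff_le (h : c.IsFibreTrace v T)
    (hΩ : MeasurableSet Ω) (hv : Measurable v) (hBV : IsBV Ω v) (hζ : Continuous ζ)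
    (hζs : Function.support ζ ⊆ c.domain) (hζ1 : ∀ x, ζ x ≤ 1) :
    limsup (fun k => ∫⁻ x in Ω, ‖v x‖ₑ *
        (ENNReal.ofReal (ζ x) * ‖fderiv ℝ (c.heightCutoff k) x‖ₑ)) atTop
      ≤ ∫⁻ w in c.ball, ‖T w‖ₑ * ENNReal.ofReal (ζ (c.point w 0))
        ∂(volume.withDensity fun w => ENNReal.ofReal (c.slope w)) := by
  obtain ⟨S, hS⟩ := (isCompact_closedBall c.center c.ρ).bddAbove_image
    c.continuous_slope.continuousOn
  have hζ0 : Continuous fun w => ζ (c.point w 0) :=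
    hζ.comp (c.continuous_point.comp (Continuous.prodMk_left 0))
  have hdominated : ∫⁻ w in c.ball, ENNReal.ofReal S * (‖T w‖ₑ + c.fibreVariation v w) ≠ ∞ := by
    rw [lintegral_const_mul' _ _ ENNReal.ofReal_ne_top,
      lintegral_add_right _ (c.measurable_fibreVariation hv)]
    exact ENNReal.mul_ne_top ENNReal.ofReal_ne_top (ENNReal.add_ne_top.2
      ⟨h.integrableOn.2.ne, c.lintegral_fibreVariation_ne_top hv hBV⟩)
  calc _ ≤ limsup (fun k => ∫⁻ w in c.ball, c.fibreFlux v ζ k w) atTop :=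
        limsup_le_limsup (Eventually.of_forall
          (c.lintegral_heightCutoff_le hΩ hv hζ.measurable hζs))
    _ ≤ ∫⁻ w in c.ball, limsup (fun k => c.fibreFlux v ζ k w) atTop :=
        limsup_lintegral_le _ (c.measurable_fibreFlux hv hζ.measurable)
          (h.ae_fibreFlux_le hv hBV hζ1 fun w hw =>
            hS ⟨w, Metric.ball_subset_closedBall hw, rfl⟩) hdominated
    _ ≤ ∫⁻ w in c.ball, ENNReal.ofReal (c.slope w) *
          (‖T w‖ₑ * ENNReal.ofReal (ζ (c.point w 0))) :=
        lintegral_mono_ae (h.tendsto.mono fun w hw => limsup_fibreFlux_le hζ hw)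
    _ = _ := by
        rw [restrict_withDensity c.measurableSet_ball]
        exact (lintegral_withDensity_eq_lintegral_mul _
          c.continuous_slope.measurable.ennreal_ofReal
          (h.measurable.enorm.mul hζ0.measurable.ennreal_ofReal)).symm

end BoundaryChart

/-! ### The trace operator -/

section Trace

variable {m : ℕ} {Ω : Set 𝔼(m + 1)} {v : 𝔼(m + 1) → ℝ}

lemma HasC1Boundary.exists_finite_cover (hΩb : Bornology.IsBounded Ω) (hΩ : HasC1Boundary Ω) :
    ∃ (N : ℕ) (c : Fin N → BoundaryChart Ω), frontier Ω ⊆ ⋃ i, (c i).domain := by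
  have hcompact : IsCompact (frontier Ω) :=
    hΩb.isCompact_closure.of_isClosed_subset isClosed_frontier frontier_subset_closure
  choose c hc using fun x : frontier Ω => hΩ.exists_boundaryChart x.2
  obtain ⟨t, ht⟩ := hcompact.elim_finite_subcover (fun x => (c x).domain)
    (fun x => (c x).isOpen_domain) fun x hx => Set.mem_iUnion.2 ⟨⟨x, hx⟩, hc ⟨x, hx⟩⟩
  refine ⟨t.card, fun i => c (t.equivFin.symm i), fun x hx => ?_⟩
  obtain ⟨y, hy, hxy⟩ := Set.mem_iUnion₂.1 (ht hx)
  exact Set.mem_iUnion.2 ⟨t.equivFin ⟨y, hy⟩, by simpa using hxy⟩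

open Classical in
/-- The trace of `v` on `∂Ω`, chosen pointwise: `0` at the points where `v` has no trace value. -/
noncomputable def trace (Ω : Set 𝔼(m + 1)) (v : 𝔼(m + 1) → ℝ) (x : 𝔼(m + 1)) : ℝ :=
  if h : ∃ a, HasTraceAt Ω v x a then h.choose else 0

lemma HasTraceAt.trace_eq (hΩ : HasC1Boundary Ω) (hv : IntegrableOn v Ω) {x : 𝔼(m + 1)}
    (hx : x ∈ frontier Ω) {a : ℝ} (h : HasTraceAt Ω v x a) : trace Ω v x = a := by
  have hex : ∃ a, HasTraceAt Ω v x a := ⟨a, h⟩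
  rw [trace, dif_pos hex]
  exact hex.choose_spec.unique hΩ hv hx h

namespace BoundaryChart

variable (c : BoundaryChart Ω) {T : 𝔼 m → ℝ}

lemma point_zero_mem {w : 𝔼 m} (hw : w ∈ c.ball) : c.point w 0 ∈ frontier Ω ∩ c.domain :=
  c.frontier_inter_domain ▸ Set.mem_image_of_mem _ hw

lemma exists_map_base_restrict_frontier_le :
    ∃ C : ℝ≥0∞, C ≠ ∞ ∧
      ((surfaceMeasure Ω).restrict c.domain).map c.base ≤ C • volume.restrict c.ball := by
  rw [surfaceMeasure, Measure.restrict_restrict c.isOpen_domain.measurableSet, Set.inter_comm,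
    c.frontier_inter_domain]
  exact c.exists_map_base_le c.center c.ρ

lemma ae_restrict_domain_of_ae_ball {P : 𝔼(m + 1) → 𝔼 m → Prop}
    (h : ∀ᵐ w ∂(volume.restrict c.ball), P (c.point w 0) w) :
    ∀ᵐ x ∂((surfaceMeasure Ω).restrict c.domain), P x (c.base x) := by
  obtain ⟨C, -, hle⟩ := c.exists_map_base_restrict_frontier_le
  have hac := (Measure.absolutelyContinuous_of_le hle).trans Measure.smul_absolutelyContinuous
  filter_upwards [ae_of_ae_map c.base.continuous.measurable.aemeasurable (hac.ae_le h),
    ae_restrict_mem c.isOpen_domain.measurableSet,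
    ae_restrict_of_ae (ae_surfaceMeasure_mem_frontier Ω)] with x hx hxd hxΩ
  rwa [← (c.mem_frontier_iff hxd).1 hxΩ, c.point_base_height] at hx

lemma setLIntegral_slope_le_surfaceMeasure (g : 𝔼(m + 1) → ℝ≥0∞) :
    ∫⁻ w in c.ball, g (c.point w 0) ∂(volume.withDensity fun w => ENNReal.ofReal (c.slope w))
      ≤ ∫⁻ x, g x ∂(surfaceMeasure Ω) :=
  (c.setLIntegral_slope_le c.ball g).trans (lintegral_mono_set
    (Set.image_subset_iff.2 fun _ hw => (c.point_zero_mem hw).1))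

namespace IsFibreTrace

variable {c}

lemma ae_trace_point_eq (h : c.IsFibreTrace v T) (hΩ : HasC1Boundary Ω) (hv : Measurable v)
    (hBV : IsBV Ω v) : ∀ᵐ w ∂(volume.restrict c.ball), trace Ω v (c.point w 0) = T w := by
  filter_upwards [h.ae_hasTraceAt hv hBV, ae_restrict_mem c.measurableSet_ball] with w hTw hw
  exact hTw.trace_eq hΩ hBV.1 (c.point_zero_mem hw).1

lemma ae_hasTraceAt_trace (h : c.IsFibreTrace v T) (hΩ : HasC1Boundary Ω) (hv : Measurable v)
    (hBV : IsBV Ω v) :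
    ∀ᵐ x ∂((surfaceMeasure Ω).restrict c.domain), HasTraceAt Ω v x (trace Ω v x) := by
  refine c.ae_restrict_domain_of_ae_ball (P := fun x _ => HasTraceAt Ω v x (trace Ω v x)) ?_
  filter_upwards [h.ae_hasTraceAt hv hBV, h.ae_trace_point_eq hΩ hv hBV] with w hTw htrace
  rwa [htrace]

lemma integrableOn_comp_base (h : c.IsFibreTrace v T) :
    IntegrableOn (fun x => T (c.base x)) c.domain (surfaceMeasure Ω) := by
  have hbase : Measurable c.base := c.base.continuous.measurable
  obtain ⟨C, hC, hle⟩ := c.exists_map_base_restrict_frontier_le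
  refine ⟨(h.measurable.comp hbase).aestronglyMeasurable, ?_⟩
  calc ∫⁻ x in c.domain, ‖T (c.base x)‖ₑ ∂(surfaceMeasure Ω)
      = ∫⁻ w, ‖T w‖ₑ ∂(((surfaceMeasure Ω).restrict c.domain).map c.base) :=
        (lintegral_map h.measurable.enorm hbase).symm
    _ ≤ ∫⁻ w, ‖T w‖ₑ ∂(C • volume.restrict c.ball) := lintegral_mono' hle le_rfl
    _ = C * ∫⁻ w in c.ball, ‖T w‖ₑ := by rw [lintegral_smul_measure, smul_eq_mul]
    _ < ∞ := ENNReal.mul_lt_top hC.lt_top h.integrableOn.2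

lemma integrableOn_trace (h : c.IsFibreTrace v T) (hΩ : HasC1Boundary Ω) (hv : Measurable v)
    (hBV : IsBV Ω v) : IntegrableOn (trace Ω v) c.domain (surfaceMeasure Ω) :=
  h.integrableOn_comp_base.congr <| (c.ae_restrict_domain_of_ae_ball
    (P := fun x w => trace Ω v x = T w) (h.ae_trace_point_eq hΩ hv hBV)).mono fun _ hx => hx.symm

end IsFibreTrace

end BoundaryChart

lemma hasTrace_trace (hΩb : Bornology.IsBounded Ω) (hΩ : HasC1Boundary Ω)
    (hv : Measurable v) (hvi : Integrable v) (hBV : IsBV Ω v) : HasTrace Ω v (trace Ω v) := by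
  obtain ⟨N, c, hcover⟩ := hΩ.exists_finite_cover hΩb
  choose T hT using fun i => (c i).exists_isFibreTrace hv hvi hBV
  have hrestrict : (surfaceMeasure Ω).restrict (⋃ i, (c i).domain) = surfaceMeasure Ω :=
    Measure.restrict_eq_self_of_ae_mem
      ((ae_surfaceMeasure_mem_frontier Ω).mono fun _ hx => hcover hx)
  rw [HasTrace, ← hrestrict]
  exact ⟨(integrableOn_finite_iUnion (f := trace Ω v)).2 fun i =>
      (hT i).integrableOn_trace hΩ hv hBV,
    (ae_restrict_iUnion_iff _ _).2 fun i => (hT i).ae_hasTraceAt_trace hΩ hv hBV⟩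

end Trace

/-! ### Gluing the cut-off functions -/

lemma ennreal_limsup_add_le {α : Type*} {l : Filter α} (u v : α → ℝ≥0∞) :
    limsup (fun k => u k + v k) l ≤ limsup u l + limsup v l := by
  refine ENNReal.le_of_forall_pos_le_add fun ε hε hfin => ?_
  have hu := (ENNReal.add_lt_top.1 hfin).1
  have hv := (ENNReal.add_lt_top.1 hfin).2
  have hε₂ : (ε / 2 : ℝ≥0∞) ≠ 0 := (ENNReal.half_pos (by simpa using hε.ne')).ne'
  refine limsup_le_of_le (h := ?_)
  filter_upwards [eventually_lt_of_limsup_lt (ENNReal.lt_add_right hu.ne hε₂),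
    eventually_lt_of_limsup_lt (ENNReal.lt_add_right hv.ne hε₂)] with k huk hvk
  calc u k + v k ≤ (limsup u l + ε / 2) + (limsup v l + ε / 2) := add_le_add huk.le hvk.le
    _ = limsup u l + limsup v l + ε := by rw [add_add_add_comm, ENNReal.add_halves]

lemma ennreal_limsup_sum_le {α ι : Type*} {l : Filter α} (s : Finset ι) (u : ι → α → ℝ≥0∞) :
    limsup (fun k => ∑ i ∈ s, u i k) l ≤ ∑ i ∈ s, limsup (u i) l := by
  classical
  induction s using Finset.induction_on with
  | empty => exact limsup_le_of_le (h := Eventually.of_forall fun _ => by simp)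
  | insert j s hj ih =>
    simp only [Finset.sum_insert hj]
    exact (ennreal_limsup_add_le _ _).trans (by gcongr)

section ChartPartition

variable {m : ℕ} {Ω : Set 𝔼(m + 1)} {v : 𝔼(m + 1) → ℝ}

/-- A partition of unity on `Ω` subordinate to `Ω` itself and to finitely many boundary charts. It
is used to glue the cut-off functions of the charts. -/
structure ChartPartition (Ω : Set 𝔼(m + 1)) where
  card : ℕ
  chart : Fin card → BoundaryChart Ω
  inner : 𝔼(m + 1) → ℝ
  outer : Fin card → 𝔼(m + 1) → ℝ
  contDiff_inner : ContDiff ℝ 1 inner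
  contDiff_outer : ∀ i, ContDiff ℝ 1 (outer i)
  tsupport_inner : tsupport inner ⊆ Ω
  tsupport_outer : ∀ i, tsupport (outer i) ⊆ (chart i).domain
  inner_nonneg : ∀ x, 0 ≤ inner x
  outer_nonneg : ∀ i x, 0 ≤ outer i x
  sum_le_one : ∀ x, inner x + ∑ i, outer i x ≤ 1
  sum_eq_one : ∀ x ∈ Ω, inner x + ∑ i, outer i x = 1

open scoped Manifold in
lemma HasC1Boundary.nonempty_chartPartition (hΩo : IsOpen Ω) (hΩb : Bornology.IsBounded Ω)
    (hΩ : HasC1Boundary Ω) : Nonempty (ChartPartition Ω) := by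
  obtain ⟨N, c, hcover⟩ := hΩ.exists_finite_cover hΩb
  let U : Option (Fin N) → Set 𝔼(m + 1) := fun o => o.elim Ω fun i => (c i).domain
  have hUopen : ∀ o, IsOpen (U o) :=
    Option.forall.2 ⟨hΩo, fun i => (c i).isOpen_domain⟩
  have hUcover : closure Ω ⊆ ⋃ o, U o := by
    rw [closure_eq_interior_union_frontier, hΩo.interior_eq, Set.iUnion_option]
    exact Set.union_subset_union_right Ω hcover
  obtain ⟨φ, hφ⟩ := SmoothPartitionOfUnity.exists_isSubordinate 𝓘(ℝ, 𝔼(m + 1))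
    isClosed_closure U hUopen hUcover
  have hsum (x : 𝔼(m + 1)) : ∑ᶠ o, φ o x = φ none x + ∑ i, φ (some i) x := by
    rw [finsum_eq_sum_of_fintype, Fintype.sum_option]
  have hsmooth (o) : ContDiff ℝ 1 (φ o) := (φ o).contMDiff.contDiff.of_le (by norm_cast)
  exact ⟨{  card := N, chart := c, inner := φ none, outer := fun i => φ (some i)
            contDiff_inner := hsmooth none
            contDiff_outer := fun i => hsmooth (some i)
            tsupport_inner := hφ none
            tsupport_outer := fun i => hφ (some i)
            inner_nonneg := φ.nonneg none
            outer_nonneg := fun i => φ.nonneg (some i)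
            sum_le_one := fun x => hsum x ▸ φ.sum_le_one x
            sum_eq_one := fun x hx => hsum x ▸ φ.sum_eq_one (subset_closure hx) }⟩

namespace ChartPartition

variable (P : ChartPartition Ω)

/-- The cut-off functions of the charts at scale `1 / (k + 1)`, glued together. -/
noncomputable def cutoff (k : ℕ) (x : 𝔼(m + 1)) : ℝ :=
  P.inner x + ∑ i, P.outer i x * (P.chart i).heightCutoff k x

lemma sum_outer_le_one (x : 𝔼(m + 1)) : ∑ i, P.outer i x ≤ 1 := by
  linarith [P.sum_le_one x, P.inner_nonneg x]

lemma outer_le_one (i : Fin P.card) (x : 𝔼(m + 1)) : P.outer i x ≤ 1 :=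
  (Finset.single_le_sum (fun j _ => P.outer_nonneg j x) (Finset.mem_univ i)).trans
    (P.sum_outer_le_one x)

lemma contDiff_cutoff (k : ℕ) : ContDiff ℝ 1 (P.cutoff k) :=
  P.contDiff_inner.add (ContDiff.sum fun i _ =>
    (P.contDiff_outer i).mul ((P.chart i).contDiff_heightCutoff k))

lemma cutoff_mem_Icc (k : ℕ) (x : 𝔼(m + 1)) : P.cutoff k x ∈ Set.Icc (0 : ℝ) 1 := by
  refine ⟨add_nonneg (P.inner_nonneg x) (Finset.sum_nonneg fun i _ =>
    mul_nonneg (P.outer_nonneg i x) (profile_mem_Icc _).1), le_trans ?_ (P.sum_le_one x)⟩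
  unfold cutoff
  gcongr with i
  exact mul_le_of_le_one_right (P.outer_nonneg i x) (profile_mem_Icc _).2

lemma eventually_outer_mul_heightCutoff_eq_zero (k : ℕ) {x : 𝔼(m + 1)} (hx : x ∉ Ω)
    (i : Fin P.card) : ∀ᶠ y in 𝓝 x, P.outer i y * (P.chart i).heightCutoff k y = 0 := by
  by_cases hi : x ∈ tsupport (P.outer i)
  · have hle : (P.chart i).height x ≤ 0 :=
      not_lt.1 (mt ((P.chart i).mem_iff_of_mem_domain (P.tsupport_outer i hi)).2 hx)
    have hlt : ((k : ℝ) + 1) * (P.chart i).height x < 1 :=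
      (mul_nonpos_of_nonneg_of_nonpos (by positivity) hle).trans_lt one_pos
    have hcont : Continuous fun y => ((k : ℝ) + 1) * (P.chart i).height y :=
      continuous_const.mul (P.chart i).contDiff_height.continuous
    filter_upwards [hcont.continuousAt.eventually_lt_const hlt] with y hy
    rw [BoundaryChart.heightCutoff, profile_of_le_one hy.le, mul_zero]
  · filter_upwards [notMem_tsupport_iff_eventuallyEq.1 hi] with y hy
    rw [hy, Pi.zero_apply, zero_mul]

lemma tsupport_cutoff_subset (k : ℕ) : tsupport (P.cutoff k) ⊆ Ω := by
  intro x
  contrapose!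
  intro hx
  rw [notMem_tsupport_iff_eventuallyEq]
  filter_upwards [notMem_tsupport_iff_eventuallyEq.1 (mt (@P.tsupport_inner x) hx),
    eventually_all.2 (P.eventually_outer_mul_heightCutoff_eq_zero k hx)] with y hinner houter
  simp [cutoff, hinner, houter]

lemma isTest_cutoff (hΩb : Bornology.IsBounded Ω) (k : ℕ) : IsTest Ω (P.cutoff k) :=
  ⟨P.contDiff_cutoff k, hΩb.isCompact_closure.of_isClosed_subset (isClosed_tsupport _)
    ((P.tsupport_cutoff_subset k).trans subset_closure), P.tsupport_cutoff_subset k⟩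

lemma tendsto_heightCutoff {i : Fin P.card} {x : 𝔼(m + 1)} (hx : x ∈ Ω)
    (hi : x ∈ tsupport (P.outer i)) :
    Tendsto (fun k => (P.chart i).heightCutoff k x) atTop (𝓝 1) :=
  (P.chart i).tendsto_heightCutoff
    (((P.chart i).mem_iff_of_mem_domain (P.tsupport_outer i hi)).1 hx)

lemma tendsto_cutoff {x : 𝔼(m + 1)} (hx : x ∈ Ω) :
    Tendsto (fun k => P.cutoff k x) atTop (𝓝 1) := by
  rw [← P.sum_eq_one x hx]
  refine tendsto_const_nhds.add (tendsto_finsetSum _ fun i _ => ?_)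
  by_cases hi : x ∈ tsupport (P.outer i)
  · simpa using (P.tendsto_heightCutoff hx hi).const_mul (P.outer i x)
  · simp [image_eq_zero_of_notMem_tsupport hi]

lemma fderiv_inner (hΩo : IsOpen Ω) {x : 𝔼(m + 1)} (hx : x ∈ Ω) :
    fderiv ℝ P.inner x = -∑ i, fderiv ℝ (P.outer i) x := by
  have hsum : HasFDerivAt (fun y => P.inner y + ∑ i, P.outer i y)
      (fderiv ℝ P.inner x + ∑ i, fderiv ℝ (P.outer i) x) x :=
    (P.contDiff_inner.differentiable one_ne_zero x).hasFDerivAt.add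
      (HasFDerivAt.fun_sum fun i _ =>
        ((P.contDiff_outer i).differentiable one_ne_zero x).hasFDerivAt)
  have hone : (fun y => P.inner y + ∑ i, P.outer i y) =ᶠ[𝓝 x] fun _ => 1 := by
    filter_upwards [hΩo.mem_nhds hx] with y hy using P.sum_eq_one y hy
  exact eq_neg_of_add_eq_zero_left
    (hsum.unique ((hasFDerivAt_const (1 : ℝ) x).congr_of_eventuallyEq hone))

lemma fderiv_cutoff (hΩo : IsOpen Ω) (k : ℕ) {x : 𝔼(m + 1)} (hx : x ∈ Ω) :
    fderiv ℝ (P.cutoff k) x = ∑ i, (P.outer i x • fderiv ℝ ((P.chart i).heightCutoff k) x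
      + ((P.chart i).heightCutoff k x - 1) • fderiv ℝ (P.outer i) x) := by
  have hcutoff : HasFDerivAt (P.cutoff k) (fderiv ℝ P.inner x + ∑ i,
      (P.outer i x • fderiv ℝ ((P.chart i).heightCutoff k) x
        + (P.chart i).heightCutoff k x • fderiv ℝ (P.outer i) x)) x :=
    (P.contDiff_inner.differentiable one_ne_zero x).hasFDerivAt.add
      (HasFDerivAt.fun_sum fun i _ =>
        ((P.contDiff_outer i).differentiable one_ne_zero x).hasFDerivAt.mul
          (((P.chart i).contDiff_heightCutoff k).differentiable one_ne_zero x).hasFDerivAt)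
  rw [hcutoff.fderiv, P.fderiv_inner hΩo hx, neg_add_eq_sub, ← Finset.sum_sub_distrib]
  simp only [sub_smul, one_smul, add_sub_assoc]

lemma enorm_fderiv_cutoff_le (hΩo : IsOpen Ω) (k : ℕ) {x : 𝔼(m + 1)} (hx : x ∈ Ω) :
    ‖fderiv ℝ (P.cutoff k) x‖ₑ
      ≤ ∑ i, (ENNReal.ofReal (P.outer i x) * ‖fderiv ℝ ((P.chart i).heightCutoff k) x‖ₑ
        + ‖(P.chart i).heightCutoff k x - 1‖ₑ * ‖fderiv ℝ (P.outer i) x‖ₑ) := by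
  rw [P.fderiv_cutoff hΩo k hx]
  have hnorm := nnnorm_sum_le_of_le Finset.univ fun i _ => nnnorm_add_le
    (P.outer i x • fderiv ℝ ((P.chart i).heightCutoff k) x)
    (((P.chart i).heightCutoff k x - 1) • fderiv ℝ (P.outer i) x)
  simp only [nnnorm_smul] at hnorm
  simp only [← Real.enorm_of_nonneg (P.outer_nonneg _ x), enorm_eq_nnnorm]
  exact_mod_cast hnorm

lemma lintegral_enorm_fderiv_cutoff_le (hΩo : IsOpen Ω) (hv : Measurable v) (k : ℕ) :
    ∫⁻ x in Ω, ‖v x‖ₑ * ‖fderiv ℝ (P.cutoff k) x‖ₑ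
      ≤ ∑ i, ((∫⁻ x in Ω, ‖v x‖ₑ *
          (ENNReal.ofReal (P.outer i x) * ‖fderiv ℝ ((P.chart i).heightCutoff k) x‖ₑ))
        + ∫⁻ x in Ω, ‖v x‖ₑ *
          (‖(P.chart i).heightCutoff k x - 1‖ₑ * ‖fderiv ℝ (P.outer i) x‖ₑ)) := by
  have hmain (i) : Measurable fun x => ‖v x‖ₑ *
      (ENNReal.ofReal (P.outer i x) * ‖fderiv ℝ ((P.chart i).heightCutoff k) x‖ₑ) :=
    hv.enorm.mul ((P.contDiff_outer i).continuous.measurable.ennreal_ofReal.mul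
      (((P.chart i).contDiff_heightCutoff k).continuous_fderiv one_ne_zero).measurable.enorm)
  have herror (i) : Measurable fun x => ‖v x‖ₑ *
      (‖(P.chart i).heightCutoff k x - 1‖ₑ * ‖fderiv ℝ (P.outer i) x‖ₑ) :=
    hv.enorm.mul ((((P.chart i).contDiff_heightCutoff k).continuous.measurable.sub_const
      1).enorm.mul ((P.contDiff_outer i).continuous_fderiv one_ne_zero).measurable.enorm)
  simp only [← lintegral_add_left (hmain _)]
  rw [← lintegral_finsetSum _ fun i _ => by exact (hmain i).add (herror i)]
  refine setLIntegral_mono' hΩo.measurableSet fun x hx => ?_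
  simp only [← mul_add, ← Finset.mul_sum]
  gcongr
  exact P.enorm_fderiv_cutoff_le hΩo k hx

lemma tendsto_enorm_heightCutoff_sub_one_mul {x : 𝔼(m + 1)} (hx : x ∈ Ω) (i : Fin P.card) :
    Tendsto (fun k => ‖v x‖ₑ *
      (‖(P.chart i).heightCutoff k x - 1‖ₑ * ‖fderiv ℝ (P.outer i) x‖ₑ)) atTop (𝓝 0) := by
  by_cases hi : x ∈ tsupport (P.outer i)
  · have hlim : Tendsto (fun k => ‖(P.chart i).heightCutoff k x - 1‖ₑ) atTop (𝓝 0) := by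
      simpa [edist_eq_enorm_sub] using
        tendsto_iff_edist_tendsto_0.1 (P.tendsto_heightCutoff hx hi)
    simpa using ENNReal.Tendsto.const_mul (a := ‖v x‖ₑ) (ENNReal.Tendsto.mul_const
      (b := ‖fderiv ℝ (P.outer i) x‖ₑ) hlim (Or.inr enorm_ne_top)) (Or.inr enorm_ne_top)
  · have hzero : fderiv ℝ (P.outer i) x = 0 :=
      Function.notMem_support.1 fun h => hi (support_fderiv_subset ℝ h)
    simp [hzero, ← ofReal_norm (0 : 𝔼(m + 1) →L[ℝ] ℝ)]

lemma tendsto_lintegral_heightCutoff_sub_one (hΩo : IsOpen Ω) (hΩb : Bornology.IsBounded Ω)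
    (hv : Measurable v) (hvi : IntegrableOn v Ω) (i : Fin P.card) :
    Tendsto (fun k => ∫⁻ x in Ω, ‖v x‖ₑ *
      (‖(P.chart i).heightCutoff k x - 1‖ₑ * ‖fderiv ℝ (P.outer i) x‖ₑ)) atTop (𝓝 0) := by
  have hderiv : Continuous fun x => fderiv ℝ (P.outer i) x :=
    (P.contDiff_outer i).continuous_fderiv one_ne_zero
  obtain ⟨C, hC⟩ := hΩb.isCompact_closure.exists_bound_of_continuousOn hderiv.continuousOn
  have hone (k x) : ‖(P.chart i).heightCutoff k x - 1‖ₑ ≤ 1 := by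
    obtain ⟨h₀, h₁⟩ := profile_mem_Icc (((k : ℝ) + 1) * (P.chart i).height x)
    rw [← ofReal_norm, ENNReal.ofReal_le_one, Real.norm_eq_abs, abs_le, BoundaryChart.heightCutoff]
    constructor <;> linarith
  rw [← lintegral_zero (μ := volume.restrict Ω)]
  refine tendsto_lintegral_of_dominated_convergence (fun x => ‖v x‖ₑ * ENNReal.ofReal C)
    (fun k => ?_) (fun k => ?_) ?_ ?_
  · exact hv.enorm.mul ((((P.chart i).contDiff_heightCutoff k).continuous.measurable.sub_const
      1).enorm.mul hderiv.measurable.enorm)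
  · filter_upwards [ae_restrict_mem hΩo.measurableSet] with x hx
    gcongr
    refine mul_le_of_le_one_of_le (hone k x) ?_
    rw [← ofReal_norm]
    exact ENNReal.ofReal_le_ofReal (hC x (subset_closure hx))
  · rw [lintegral_mul_const' _ _ ENNReal.ofReal_ne_top]
    exact ENNReal.mul_ne_top hvi.2.ne ENNReal.ofReal_ne_top
  · filter_upwards [ae_restrict_mem hΩo.measurableSet] with x hx
    exact P.tendsto_enorm_heightCutoff_sub_one_mul hx i

lemma limsup_lintegral_outer_le (hΩo : IsOpen Ω) (hΩ : HasC1Boundary Ω) (hv : Measurable v)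
    (hvi : Integrable v) (hBV : IsBV Ω v) (i : Fin P.card) :
    limsup (fun k => ∫⁻ x in Ω, ‖v x‖ₑ *
        (ENNReal.ofReal (P.outer i x) * ‖fderiv ℝ ((P.chart i).heightCutoff k) x‖ₑ)) atTop
      ≤ ∫⁻ x, ‖trace Ω v x‖ₑ * ENNReal.ofReal (P.outer i x) ∂(surfaceMeasure Ω) := by
  obtain ⟨T, hT⟩ := (P.chart i).exists_isFibreTrace hv hvi hBV
  have hac : (volume.withDensity fun w => ENNReal.ofReal ((P.chart i).slope w)).restrict
      (P.chart i).ball ≪ volume.restrict (P.chart i).ball :=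
    (withDensity_absolutelyContinuous _ _).restrict _
  refine (hT.limsup_lintegral_heightCutoff_le hΩo.measurableSet hv hBV
    (P.contDiff_outer i).continuous ((subset_tsupport _).trans (P.tsupport_outer i))
    (P.outer_le_one i)).trans (le_of_eq_of_le (lintegral_congr_ae (hac.ae_le ?_))
      ((P.chart i).setLIntegral_slope_le_surfaceMeasure
        fun x => ‖trace Ω v x‖ₑ * ENNReal.ofReal (P.outer i x)))
  filter_upwards [hT.ae_trace_point_eq hΩ hv hBV] with w hw
  rw [hw]

lemma sum_lintegral_mul_outer_le {μ : Measure 𝔼(m + 1)} {g : 𝔼(m + 1) → ℝ≥0∞}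
    (hg : AEMeasurable g μ) :
    ∑ i, ∫⁻ x, g x * ENNReal.ofReal (P.outer i x) ∂μ ≤ ∫⁻ x, g x ∂μ := by
  rw [← lintegral_finsetSum' _ fun i _ => by
    exact hg.mul (P.contDiff_outer i).continuous.measurable.ennreal_ofReal.aemeasurable]
  refine lintegral_mono fun x => ?_
  rw [← Finset.mul_sum, ← ENNReal.ofReal_sum_of_nonneg fun i _ => P.outer_nonneg i x]
  exact mul_le_of_le_one_right' (ENNReal.ofReal_le_one.2 (P.sum_outer_le_one x))

lemma limsup_lintegral_fderiv_cutoff_le (hΩo : IsOpen Ω) (hΩb : Bornology.IsBounded Ω)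
    (hΩ : HasC1Boundary Ω) (hv : Measurable v) (hvi : Integrable v) (hBV : IsBV Ω v) :
    limsup (fun k => ∫⁻ x in Ω, ‖v x‖ₑ * ‖fderiv ℝ (P.cutoff k) x‖ₑ) atTop
      ≤ ∫⁻ x, ‖trace Ω v x‖ₑ ∂(surfaceMeasure Ω) := by
  refine ((limsup_le_limsup (Eventually.of_forall
    (P.lintegral_enorm_fderiv_cutoff_le hΩo hv))).trans (ennreal_limsup_sum_le _ _)).trans ?_
  refine le_trans (Finset.sum_le_sum fun i _ => ?_)
    (P.sum_lintegral_mul_outer_le (hasTrace_trace hΩb hΩ hv hvi hBV).1.1.enorm)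
  exact (ENNReal.limsup_add_of_right_tendsto_zero
    (P.tendsto_lintegral_heightCutoff_sub_one hΩo hΩb hv hvi.integrableOn i) _).trans_le
      (P.limsup_lintegral_outer_le hΩo hΩ hv hvi hBV i)

end ChartPartition

end ChartPartition

/-! ### Minimality -/

section Limits

variable {α β : Type*} [MeasurableSpace α] [MeasurableSpace β] {μ : Measure α} {ν : Measure β}

lemma eventually_integral_le_integral_norm_add {f : ℕ → α → ℝ} {g : β → ℝ} (hg : Integrable g ν)
    (hle : limsup (fun k => ∫⁻ x, ‖f k x‖ₑ ∂μ) atTop ≤ ∫⁻ y, ‖g y‖ₑ ∂ν) {ε : ℝ} (hε : 0 < ε) :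
    ∀ᶠ k in atTop, ∫ x, f k x ∂μ ≤ (∫ y, ‖g y‖ ∂ν) + ε := by
  have hlt : ∫⁻ y, ‖g y‖ₑ ∂ν < ∫⁻ y, ‖g y‖ₑ ∂ν + ENNReal.ofReal ε :=
    ENNReal.lt_add_right hg.2.ne (ENNReal.ofReal_pos.2 hε).ne'
  filter_upwards [eventually_lt_of_limsup_lt (hle.trans_lt hlt)] with k hk
  have hnonneg : 0 ≤ ∫ y, ‖g y‖ ∂ν := integral_nonneg fun y => norm_nonneg _
  rw [← ofReal_integral_norm_eq_lintegral_enorm hg, ← ENNReal.ofReal_add hnonneg hε.le] at hk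
  have henorm := (enorm_integral_le_lintegral_enorm (μ := μ) (f k)).trans hk.le
  rw [← ofReal_norm, ENNReal.ofReal_le_ofReal_iff (by positivity)] at henorm
  exact (le_abs_self _).trans henorm

lemma tendsto_integral_cutoff_mul {η : ℕ → α → ℝ} {g : α → ℝ} (hg : Integrable g μ)
    (hη : ∀ k, AEStronglyMeasurable (η k) μ) (h01 : ∀ k x, η k x ∈ Set.Icc (0 : ℝ) 1)
    (hone : ∀ᵐ x ∂μ, Tendsto (fun k => η k x) atTop (𝓝 1)) :
    Tendsto (fun k => ∫ x, η k x * g x ∂μ) atTop (𝓝 (∫ x, g x ∂μ)) :=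
  tendsto_integral_of_dominated_convergence (fun x => ‖g x‖) (fun k => (hη k).mul hg.1) hg.norm
    (fun k => .of_forall fun x => norm_smul_le_of_mem_Icc (h01 k x) (g x))
    (hone.mono fun x hx => by simpa using hx.mul_const (g x))

lemma exists_measurable_integrable_ae_eq {s : Set α} (hs : MeasurableSet s) {v : α → ℝ}
    (hv : IntegrableOn v s μ) :
    ∃ w, Measurable w ∧ Integrable w μ ∧ v =ᵐ[μ.restrict s] w := by
  obtain ⟨w, hw, hvw⟩ := hv.1
  refine ⟨s.indicator w, hw.measurable.indicator hs,
    (integrable_indicator_iff hs).2 (hv.congr hvw), ?_⟩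
  exact hvw.trans (indicator_ae_eq_restrict hs).symm

end Limits

section Minimality

variable {m : ℕ} {Ω : Set 𝔼(m + 1)} {K u v : 𝔼(m + 1) → ℝ} {p : ℝ}

lemma IsBV.exists_hasTrace_cutoff (hΩo : IsOpen Ω) (hΩb : Bornology.IsBounded Ω)
    (hΩ : HasC1Boundary Ω) (hv : IsBV Ω v) :
    ∃ T, HasTrace Ω v T ∧ ∃ η : ℕ → 𝔼(m + 1) → ℝ,
      (∀ k, IsTest Ω (η k)) ∧ (∀ k x, η k x ∈ Set.Icc (0 : ℝ) 1) ∧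
      (∀ x ∈ Ω, Tendsto (fun k => η k x) atTop (𝓝 1)) ∧
      ∀ ε > 0, ∀ᶠ k in atTop,
        ∫ x in Ω, |v x| * ‖fderiv ℝ (η k) x‖ ≤ (∫ x, |T x| ∂(surfaceMeasure Ω)) + ε := by
  obtain ⟨w, hw, hwi, hvw⟩ := exists_measurable_integrable_ae_eq hΩo.measurableSet hv.1
  have hT := hasTrace_trace hΩb hΩ hw hwi (hv.congr hvw)
  obtain ⟨P⟩ := hΩ.nonempty_chartPartition hΩo hΩb
  refine ⟨trace Ω w, hT.congr hvw.symm, P.cutoff, P.isTest_cutoff hΩb, P.cutoff_mem_Icc,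
    fun x hx => P.tendsto_cutoff hx, fun ε hε => ?_⟩
  have hcost (k) : ∫ x in Ω, |v x| * ‖fderiv ℝ (P.cutoff k) x‖
      = ∫ x in Ω, |w x| * ‖fderiv ℝ (P.cutoff k) x‖ :=
    integral_congr_ae (hvw.mono fun x hx => by simp only [hx])
  simp only [hcost]
  refine eventually_integral_le_integral_norm_add hT.1 ?_ hε
  simpa using P.limsup_lintegral_fderiv_cutoff_le hΩo hΩb hΩ hw hwi (hv.congr hvw)

lemma exists_hasTrace_and_le_of_forall_vanishesOnBoundary (hΩo : IsOpen Ω)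
    (hΩb : Bornology.IsBounded Ω) (hΩ : HasC1Boundary Ω) {c : ℝ}
    (hc : ∀ w, IsAdmissible Ω p w → VanishesOnBoundary Ω w →
      c ≤ area Ω w - ∫ x in Ω, K x * w x)
    (hv : IsAdmissible Ω p v) (hKv : IntegrableOn (fun x => K x * v x) Ω) :
    ∃ T, HasTrace Ω v T ∧
      c ≤ area Ω v - (∫ x in Ω, K x * v x) + ∫ x, |T x| ∂(surfaceMeasure Ω) := by
  obtain ⟨T, hT, η, hη, h01, hone, hcost⟩ := hv.2.exists_hasTrace_cutoff hΩo hΩb hΩ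
  refine ⟨T, hT, le_of_forall_pos_le_add fun ε hε => ?_⟩
  have hlim : Tendsto (fun k => ∫ x in Ω, K x * (η k x * v x)) atTop
      (𝓝 (∫ x in Ω, K x * v x)) := by
    simp only [mul_left_comm (K _)]
    exact tendsto_integral_cutoff_mul hKv (fun k => (hη k).continuous.aestronglyMeasurable) h01
      (ae_restrict_of_forall_mem hΩo.measurableSet hone)
  have hbound : c ≤ area Ω v + ((∫ x, |T x| ∂(surfaceMeasure Ω)) + ε) - ∫ x in Ω, K x * v x := by
    refine ge_of_tendsto (hlim.const_sub _) ?_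
    filter_upwards [hcost ε hε] with k hk
    have hmin := hc _ (hv.cutoff (hη k) (h01 k)) ((hη k).vanishesOnBoundary_mul hΩo v)
    have harea := area_cutoff_le hΩb hv.2 (hη k) (h01 k)
    linarith
  linarith

lemma area_sub_le_of_forall_hasAreaDeriv (hΩb : Bornology.IsBounded Ω)
    (hK : ∀ v, IsAdmissible Ω p v → IntegrableOn (fun x => K x * v x) Ω)
    (hu : IsAdmissible Ω p u) (hu₀ : VanishesOnBoundary Ω u)
    (hvar : ∀ φ, IsAdmissible Ω p φ → VanishesOnBoundary Ω φ →
      ∃ ℓ, HasAreaDeriv Ω u φ ℓ ∧ ∫ x in Ω, K x * φ x ≤ ℓ)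
    (hv : IsAdmissible Ω p v) (hv₀ : VanishesOnBoundary Ω v) :
    area Ω u - ∫ x in Ω, K x * u x ≤ area Ω v - ∫ x in Ω, K x * v x := by
  have hφ : IsAdmissible Ω p (fun x => v x + (-1) * u x) := hv.add (hu.const_mul (-1))
  obtain ⟨ℓ, hℓ, hle⟩ := hvar _ hφ (hv₀.add_const_mul hv.2.1 hu.2.1 hu₀ (-1))
  have hslope : ℓ ≤ area Ω v - area Ω u := by
    simpa using hℓ.le_area_add_sub hΩb hu.2 hφ.2
  have hsource : ∫ x in Ω, K x * (v x + (-1) * u x)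
      = (∫ x in Ω, K x * v x) - ∫ x in Ω, K x * u x := by
    rw [← integral_sub (hK v hv) (hK u hu)]
    congr with x
    ring
  linarith

lemma exists_hasAreaDeriv_of_forall_hasTrace_le (hΩb : Bornology.IsBounded Ω)
    (hΩ : HasC1Boundary Ω) (hK : ∀ v, IsAdmissible Ω p v → IntegrableOn (fun x => K x * v x) Ω)
    (hu : IsAdmissible Ω p u) (hu₀ : VanishesOnBoundary Ω u)
    (hmin : ∀ v, IsAdmissible Ω p v → ∃ T, HasTrace Ω v T ∧
      area Ω u - ∫ x in Ω, K x * u x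
        ≤ area Ω v - (∫ x in Ω, K x * v x) + ∫ x, |T x| ∂(surfaceMeasure Ω))
    {φ : 𝔼(m + 1) → ℝ} (hφ : IsAdmissible Ω p φ) (hφ₀ : VanishesOnBoundary Ω φ) :
    ∃ ℓ, HasAreaDeriv Ω u φ ℓ ∧ ∫ x in Ω, K x * φ x ≤ ℓ := by
  obtain ⟨ℓ, hℓ⟩ := exists_hasAreaDeriv hΩb hu.2 hφ.2
  refine ⟨ℓ, hℓ, hℓ.le_of_forall_mul_le fun t _ => ?_⟩
  have hv : IsAdmissible Ω p (fun x => u x + t * φ x) := hu.add (hφ.const_mul t)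
  obtain ⟨T, hT, hle⟩ := hmin _ hv
  have hT₀ : ∫ x, |T x| ∂(surfaceMeasure Ω) = 0 := by
    refine integral_eq_zero_of_ae ?_
    filter_upwards [hT.ae_eq hΩ hv.2.1 (hu₀.add_const_mul hu.2.1 hφ.2.1 hφ₀ t)] with x hx
    simp [hx]
  have hsource : ∫ x in Ω, K x * (u x + t * φ x)
      = (∫ x in Ω, K x * u x) + t * ∫ x in Ω, K x * φ x := by
    rw [← integral_const_mul, ← integral_add (hK u hu) ((hK φ hφ).const_mul t)]
    congr with x
    ring
  linarith

end Minimality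

end MeanCurvature

theorem mainTheorem8_general (n : ℕ) (hn : 1 ≤ n) (Ω : Set (EuclideanSpace ℝ (Fin n)))
    (hΩo : IsOpen Ω) (hΩb : Bornology.IsBounded Ω) (hΩ : MeanCurvature.HasC1Boundary Ω)
    (H : EuclideanSpace ℝ (Fin n) → ℝ) (p : ℝ) (hp : 0 < p)
    (hH : MemLp H (ENNReal.ofReal ((p + 1) / p)) (volume.restrict Ω)) (lam : ℝ)
    (u : EuclideanSpace ℝ (Fin n) → ℝ) (hu : MeanCurvature.IsAdmissible Ω p u)
    (hu0 : ∀ᵐ x ∂(volume.restrict Ω), 0 ≤ u x) :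
    (∀ s t : ℝ, 0 ≤ MeanCurvature.G p s t) ∧
    List.TFAE [
      MeanCurvature.IsWeakSolution Ω H p lam u,
      MeanCurvature.VanishesOnBoundary Ω u ∧
        ∀ v : EuclideanSpace ℝ (Fin n) → ℝ, MeanCurvature.IsAdmissible Ω p v →
          ∃ T : EuclideanSpace ℝ (Fin n) → ℝ, MeanCurvature.HasTrace Ω v T ∧
            MeanCurvature.area Ω u - ∫ x in Ω, (H x + lam * MeanCurvature.f p (u x)) * u x
              ≤ MeanCurvature.area Ω v
                - (∫ x in Ω, (H x + lam * MeanCurvature.f p (u x)) * v x)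
                + ∫ x, |T x| ∂(MeanCurvature.surfaceMeasure Ω),
      MeanCurvature.VanishesOnBoundary Ω u ∧
        ∀ v : EuclideanSpace ℝ (Fin n) → ℝ, MeanCurvature.IsAdmissible Ω p v →
          ∃ T : EuclideanSpace ℝ (Fin n) → ℝ, MeanCurvature.HasTrace Ω v T ∧
            MeanCurvature.energy Ω H p lam u
              ≤ MeanCurvature.energy Ω H p lam v
                + (∫ x in Ω, lam * MeanCurvature.G p (u x) (v x))
                + ∫ x, |T x| ∂(MeanCurvature.surfaceMeasure Ω)] := by
  obtain ⟨m, rfl⟩ : ∃ m, n = m + 1 := ⟨n - 1, by omega⟩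
  have hK (v) (hv : MeanCurvature.IsAdmissible Ω p v) :
      IntegrableOn (fun x => (H x + lam * MeanCurvature.f p (u x)) * v x) Ω :=
    MeanCurvature.integrableOn_mul_of_memLp hp
      (hH.add ((MeanCurvature.memLp_f_comp hp hu.1).const_mul lam)) hv.1
  refine ⟨MeanCurvature.G_nonneg hp, ?_⟩
  tfae_have 1 → 2 := fun ⟨_, hvar, _, hu₀⟩ => ⟨hu₀, fun v hv =>
    MeanCurvature.exists_hasTrace_and_le_of_forall_vanishesOnBoundary hΩo hΩb hΩ
      (fun w hw hw₀ =>
        MeanCurvature.area_sub_le_of_forall_hasAreaDeriv hΩb hK hu hu₀ hvar hw hw₀)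
      hv (hK v hv)⟩
  tfae_have 2 → 1 := fun ⟨hu₀, hmin⟩ => ⟨hu, fun φ hφ hφ₀ =>
    MeanCurvature.exists_hasAreaDeriv_of_forall_hasTrace_le hΩb hΩ hK hu hu₀ hmin hφ hφ₀,
    hu0, hu₀⟩
  tfae_have 2 ↔ 3 := by
    refine and_congr_right fun _ => forall₂_congr fun v hv => exists_congr fun T =>
      and_congr_right fun _ => ?_
    rw [MeanCurvature.energy_eq hp hH hu, MeanCurvature.energy_add_integral_G hp hH hu hv,
      add_right_comm, add_le_add_iff_right]
  tfae_finish

theorem mainTheorem8 (n : ℕ) (hn : 1 ≤ n) (Ω : Set (EuclideanSpace ℝ (Fin n)))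
    (hΩo : IsOpen Ω) (hΩb : Bornology.IsBounded Ω) (hΩ : MeanCurvature.HasC1Boundary Ω)
    (H : EuclideanSpace ℝ (Fin n) → ℝ) (hH : MemLp H ∞ (volume.restrict Ω))
    (p : ℝ) (hp : 1 ≤ p) (lam : ℝ)
    (u : EuclideanSpace ℝ (Fin n) → ℝ) (hu : MeanCurvature.IsAdmissible Ω p u)
    (hu0 : ∀ᵐ x ∂(volume.restrict Ω), 0 ≤ u x) :
    (∀ s t : ℝ, 0 ≤ MeanCurvature.G p s t) ∧
    List.TFAE [
      MeanCurvature.IsWeakSolution Ω H p lam u,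
      MeanCurvature.VanishesOnBoundary Ω u ∧
        ∀ v : EuclideanSpace ℝ (Fin n) → ℝ, MeanCurvature.IsAdmissible Ω p v →
          ∃ T : EuclideanSpace ℝ (Fin n) → ℝ, MeanCurvature.HasTrace Ω v T ∧
            MeanCurvature.area Ω u - ∫ x in Ω, (H x + lam * MeanCurvature.f p (u x)) * u x
              ≤ MeanCurvature.area Ω v
                - (∫ x in Ω, (H x + lam * MeanCurvature.f p (u x)) * v x)
                + ∫ x, |T x| ∂(MeanCurvature.surfaceMeasure Ω),
      MeanCurvature.VanishesOnBoundary Ω u ∧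
        ∀ v : EuclideanSpace ℝ (Fin n) → ℝ, MeanCurvature.IsAdmissible Ω p v →
          ∃ T : EuclideanSpace ℝ (Fin n) → ℝ, MeanCurvature.HasTrace Ω v T ∧
            MeanCurvature.energy Ω H p lam u
              ≤ MeanCurvature.energy Ω H p lam v
                + (∫ x in Ω, lam * MeanCurvature.G p (u x) (v x))
                + ∫ x, |T x| ∂(MeanCurvature.surfaceMeasure Ω)] :=
  have : IsFiniteMeasure (volume.restrict Ω) := isFiniteMeasure_restrict.2 hΩb.measure_lt_top.ne
  mainTheorem8_general n hn Ω hΩo hΩb hΩ H p (by linarith) (hH.mono_exponent le_top) lam u hu hu0
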